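/- Let $\alpha\ge 0$ and $\eta,\theta>0$. For $N\ge 1$ let $\mathbf X=(X_{i,j})_{1\le i,j\le N}$ be the random array with values in the set of arrays with entries in $(0,1)$ and strictly increasing rows and columns, with density with respect to Lebesgue measure proportional to $$\prod_{i>j}X_{i,j}^{\eta-1}\;\prod_{i}X_{i,i}^{\alpha+\frac{\eta+\theta}{2}-1}\;\prod_{i<j}X_{i,j}^{\theta-1}.$$ Its diagonals $\mathbf x^{(t)}$, $-N+1\le t\le N-1$, given by $x^{(t)}_k=X_{k+t^-,\,k+t^+}$ for $1\le k\le N-|t|$ (with $t^+=\max(t,0)$, $t^-=\max(-t,0)$), are the interlacing time slices $x^{(t)}_1<\dots<x^{(t)}_{N-|t|}$ of the continuous (Jacobi-like) Muttalib–Borodin process with $M=N$. For an integer $t$ and $x,y>0$ let $$K_{he}(t,x;t,y)=\frac{1}{\sqrt{xy}}\int_{C_\zeta}\frac{d\zeta}{2\pi i}\int_{C_\omega}\frac{d\omega}{2\pi i}\,\frac{F_{he}(t,\zeta)}{F_{he}(t,\omega)}\,\frac{x^\zeta}{y^\omega}\,\frac{1}{\zeta-\omega},\qquad F_{he}(t,\zeta)=\frac{\eta^{t^-}}{\theta^{t^+}}\,\frac{\Gamma\left(\frac{\alpha}{2\eta}-\frac{\zeta}{\eta}+t^-+\frac12\right)}{\Gamma\left(\frac{\alpha}{2\theta}+\frac{\zeta}{\theta}+t^++\frac12\right)},$$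 where, for any $0<\delta<\min\left(\frac{\alpha+\eta}{2},\frac{\alpha+\theta}{2}\right)$ and $h>0$, $C_\zeta$ is the Hankel contour $+\infty-ih\to\delta-ih\to\delta+ih\to+\infty+ih$ and $C_\omega$ is the Hankel contour $-\infty-ih\to-\delta-ih\to-\delta+ih\to-\infty+ih$. Then for every fixed integer $t$ and every $r>0$, $$\lim_{N\to\infty}\mathbb P\left(N^{\frac1\eta+\frac1\theta}\,x^{(t)}_1>r\right)=\det\left(1-K_{he}(t,\cdot\,;t,\cdot)\right)_{L^2(0,r)},$$ where the right-hand side is the Fredholm determinant given by the absolutely convergent Fredholm series $$\sum_{n\ge0}\frac{(-1)^n}{n!}\int_{(0,r)^n}\det_{1\le i,j\le n}K_{he}(t,x_i;t,x_j)\,dx_1\cdots dx_n .$$ -/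

import Mathlib

open MeasureTheory Filter Topology

noncomputable section

/-! ## The continuous Muttalib-Borodin process -/

/-- The exponent attached to the entry `(i, j)` of an `M × N` array.  Entries strictly below the
main diagonal belong to negative times, entries on it to time `0`, entries strictly above it to
positive times. -/
def mbExponent (α η θ : ℝ) (i j : ℕ) : ℝ :=
  if j < i then η else if i < j then θ else α + (η + θ) / 2

/-- The state space of the process: arrays in `(0, 1)` with strictly increasing rows and columns.
Reading the array along its diagonals (see `mbParticle`), monotonicity of the rows and columns is
exactly the chain of interlacing relations
`x⁽⁻ᴹ⁺¹⁾ ≺ ⋯ ≺ x⁽⁻¹⁾ ≺ x⁽⁰⁾ ≻ x⁽¹⁾ ≻ ⋯ ≻ x⁽ᴺ⁻¹⁾` between consecutive time slices, where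
`y ≺ x` means `x₁ < y₁ < x₂ < y₂ < ⋯`. -/
def mbArrays (M N : ℕ) : Set (Fin M → Fin N → ℝ) :=
  {X | (∀ i j, X i j ∈ Set.Ioo (0 : ℝ) 1) ∧
    (∀ i, StrictMono fun j => X i j) ∧ (∀ j, StrictMono fun i => X i j)}

/-- The unnormalised law: Lebesgue measure on the interlacing arrays with density
`∏_{t<0} |x⁽ᵗ⁾|^(η-1) · |x⁽⁰⁾|^(α+(η+θ)/2-1) · ∏_{t>0} |x⁽ᵗ⁾|^(θ-1)`, with `|x| = ∏ᵢ xᵢ`. -/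
def mbWeight (M N : ℕ) (α η θ : ℝ) : Measure (Fin M → Fin N → ℝ) :=
  (volume.restrict (mbArrays M N)).withDensity fun X =>
    ENNReal.ofReal (∏ i, ∏ j, X i j ^ (mbExponent α η θ i j - 1))

/-- The law of the continuous Muttalib-Borodin process. -/
def mbProcess (M N : ℕ) (α η θ : ℝ) : Measure (Fin M → Fin N → ℝ) :=
  (mbWeight M N α η θ Set.univ)⁻¹ • mbWeight M N α η θ

/-- The particle with index `k` (counted from `0`, in increasing order) of the time slice
`x⁽ᵗ⁾`, for an integer time `t`: it is the entry `(k + t⁻, k + t⁺)` of the array.  Slices are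
padded by `1` after their last particle. -/
def mbParticle {M N : ℕ} (X : Fin M → Fin N → ℝ) (t : ℤ) (k : ℕ) : ℝ :=
  if h : k + (-t).toNat < M ∧ k + t.toNat < N then
    X ⟨k + (-t).toNat, h.1⟩ ⟨k + t.toNat, h.2⟩
  else 1

/-! ## The hard-edge kernel -/

/-- `(2πi)⁻¹ ∫ f(ζ) dζ` over the Hankel contour that comes from `+∞ - ih`, goes left to
`δ - ih`, up to `δ + ih`, and back right to `+∞ + ih`. -/
def hankelRight (δ h : ℝ) (f : ℂ → ℂ) : ℂ :=
  (2 * Real.pi * Complex.I)⁻¹ *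
    (-(∫ τ in Set.Ioi δ, f (τ - h * Complex.I))
      + Complex.I * (∫ v in (-h)..h, f (δ + v * Complex.I))
      + ∫ τ in Set.Ioi δ, f (τ + h * Complex.I))

/-- `(2πi)⁻¹ ∫ f(ω) dω` over the Hankel contour that comes from `-∞ - ih`, goes right to
`-δ - ih`, up to `-δ + ih`, and back left to `-∞ + ih`. -/
def hankelLeft (δ h : ℝ) (f : ℂ → ℂ) : ℂ :=
  (2 * Real.pi * Complex.I)⁻¹ *
    ((∫ τ in Set.Iio (-δ), f (τ - h * Complex.I))
      + Complex.I * (∫ v in (-h)..h, f (-δ + v * Complex.I))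
      - ∫ τ in Set.Iio (-δ), f (τ + h * Complex.I))

/-- The function `F_he(t, ζ)`; here `t⁺ = t.toNat` and `t⁻ = (-t).toNat`. -/
def heF (α η θ : ℝ) (t : ℤ) (ζ : ℂ) : ℂ :=
  (η : ℂ) ^ (-t).toNat / (θ : ℂ) ^ t.toNat *
    (Complex.Gamma (α / (2 * η) - ζ / η + (-t).toNat + 1 / 2) /
      Complex.Gamma (α / (2 * θ) + ζ / θ + t.toNat + 1 / 2))

/-- The equal-time hard-edge kernel `K_he(t, x; t, y)`, for `x, y > 0`.  At equal times the single
contour integral of the extended kernel is absent.  The two contours separate the poles of the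
integrand; the `ζ` contour is closed at `+∞` and the `ω` contour at `-∞`, where the integrals
converge absolutely. -/
def heKernel (α η θ δ h : ℝ) (t : ℤ) (x y : ℝ) : ℂ :=
  ((Real.sqrt (x * y))⁻¹ : ℝ) *
    hankelRight δ h fun ζ => hankelLeft δ h fun ω =>
      heF α η θ t ζ / heF α η θ t ω * ((x : ℂ) ^ ζ / (y : ℂ) ^ ω) * (1 / (ζ - ω))

/-! ## Fredholm determinants -/

/-- `HasFredholmDet K s d` says that the Fredholm series
`∑ₙ (-1)ⁿ / n! ∫_{sⁿ} det (K (xᵢ, xⱼ)) dx₁ ⋯ dxₙ` of `det (1 - K)` on `L²(s)` is well defined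
(every integrand is integrable, the series is absolutely convergent) and has the sum `d`. -/
def HasFredholmDet (K : ℝ → ℝ → ℂ) (s : Set ℝ) (d : ℂ) : Prop :=
  (∀ n : ℕ, IntegrableOn
    (fun x : Fin n → ℝ => (Matrix.of fun i j => K (x i) (x j)).det)
    (Set.univ.pi fun _ => s)) ∧
  HasSum (fun n : ℕ => (-1 : ℂ) ^ n / (n.factorial : ℂ) *
    ∫ x in (Set.univ.pi fun _ : Fin n => s), (Matrix.of fun i j => K (x i) (x j)).det) d

end

/-!
For `N` large the probability that the first particle of the diagonal `t` exceeds `s` can be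
computed in closed form, and after rescaling each ingredient of the formula converges.

*Finite `N`.*  The entries above the diagonal `t = 0` of an array form levels that interlace, and so
do the entries below.  Integrating a level out replaces a determinant of functions by the determinant
of their antiderivatives (`lmarginal_triWeight`), because the differences of consecutive columns of a
matrix with a row of ones have the determinant of the matrix.  Both triangles thus contribute
a determinant on the main diagonal, and Andréief's identity turns the remaining integral into
a determinant of moments (`lintegral_mbArrays`).  The restriction to particles above `s` is a change
of the weight of one level.  With antiderivatives that vanish at `1` the moments are explicit, and
the gap probability is a ratio `det (gapMatrix s) / det (gapMatrix 0)`
(`real_mbProcess_upper`, `real_mbProcess_lower`).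

*Fredholm form.*  The matrices at `s` and at `0` differ in as many columns as the diagonal has
particles.  The rows of the inverse matrix that matter are Lagrange interpolation coefficients, so
the ratio is the Fredholm determinant of a kernel of finite rank on `(0, r)`, with coefficients that
are products (`det_gapMatrix_div`, `hasSum_finiteKernel`).

*Limit.*  With `s = r N^(-(1/η + 1/θ))` all powers of `N` in a coefficient combine into two instances
of Euler's product for `1 / Γ` (`leftCoeff_mul_rightCoeff`, `tendsto_gammaRatio`), which are
bounded by exponentials uniformly in `N` (`gammaRatio_le`).  Hence the kernels converge, dominated
by a product kernel, to a double series `hardEdgeSeries`, and Hadamard's bound gives the convergence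
of the Fredholm series (`fredholm_limit`, `tendsto_fredholm_finiteKernel`).

*Contours.*  On a Hankel contour the Gamma function is a sum over its poles plus an entire function
(`hasSum_Gamma_sub_upperGamma`), and `1 / Γ` decays faster than any exponential to the right.  By
Cauchy's formula a Hankel integral against a Gamma function is the sum of the residues
(`hasSum_hankelLeft_Gamma`); both contour integrals of the hard-edge kernel are of this form, and
together they give `hardEdgeSeries` (`heKernel_eq_hardEdgeSeries`).

Diagonals below the main one are treated by exchanging `η` and `θ`, which transposes the kernel.
-/

noncomputable section

/-! ### Determinants: Hadamard's bound and integration column by column -/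

lemma integrable_det {n : ℕ} {μ : Measure ℝ} [SigmaFinite μ] {g : Fin n → Fin n → ℝ → ℝ}
    (hg : ∀ i j, Integrable (g i j) μ) :
    Integrable (fun y : Fin n → ℝ => (Matrix.of fun i j => g i j (y j)).det)
      (Measure.pi fun _ => μ) := by
  simp only [Matrix.det_apply, Matrix.of_apply]
  refine integrable_finsetSum _ fun σ _ => ?_
  exact (Integrable.fintype_prod (f := fun j => g (σ j) j) fun j => hg _ _).smul _

/-- A determinant whose `j`-th column depends on the variable `y j` only can be integrated column
by column. -/
lemma integral_det {n : ℕ} {μ : Measure ℝ} [SigmaFinite μ] {g : Fin n → Fin n → ℝ → ℝ}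
    (hg : ∀ i j, Integrable (g i j) μ) :
    ∫ y : Fin n → ℝ, (Matrix.of fun i j => g i j (y j)).det ∂(Measure.pi fun _ => μ) =
      (Matrix.of fun i j => ∫ y, g i j y ∂μ).det := by
  simp only [Matrix.det_apply', Matrix.of_apply]
  rw [integral_finsetSum]
  · refine Finset.sum_congr rfl fun σ _ => ?_
    rw [integral_const_mul]
    congr 1
    exact integral_fintype_prod_eq_prod (μ := fun _ => μ) (fun j => g (σ j) j)
  · intro σ _
    exact (Integrable.fintype_prod (f := fun j => g (σ j) j) fun j => hg _ _).const_mul _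

/-- **Hadamard's inequality** for matrices with entries in `[-1, 1]`: the eigenvalues of `A * Aᴴ`
are nonnegative and add up to at most `n²`, so their product is at most `nⁿ`. -/
lemma abs_det_le_sqrt_of_abs_le_one {n : ℕ} (A : Matrix (Fin n) (Fin n) ℝ)
    (hA : ∀ i j, |A i j| ≤ 1) : |A.det| ≤ √((n : ℝ) ^ n) := by
  rcases Nat.eq_zero_or_pos n with rfl | hn
  · simp
  have hn' : (0 : ℝ) < n := by exact_mod_cast hn
  have hP := Matrix.posSemidef_self_mul_conjTranspose A
  set H := A * A.conjTranspose with hH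
  have hdet : H.det = A.det ^ 2 := by
    rw [hH, Matrix.det_mul, Matrix.det_conjTranspose]; simp [sq]
  have htr : H.trace ≤ n * n := by
    rw [hH, Matrix.trace]
    calc ∑ i, (A * A.conjTranspose).diag i ≤ ∑ i : Fin n, (n : ℝ) := by
          refine Finset.sum_le_sum fun i _ => ?_
          rw [Matrix.diag_apply, Matrix.mul_apply]
          calc ∑ j, A i j * A.conjTranspose j i ≤ ∑ j : Fin n, (1 : ℝ) := by
                refine Finset.sum_le_sum fun j _ => ?_
                have := hA i j
                simp only [Matrix.conjTranspose_apply, star_trivial]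
                nlinarith [abs_mul_abs_self (A i j), abs_nonneg (A i j)]
            _ = n := by simp
      _ = n * n := by simp
  have hle : H.det ≤ (n : ℝ) ^ n := by
    have h1 := hP.isHermitian.det_eq_prod_eigenvalues
    have h2 := hP.isHermitian.trace_eq_sum_eigenvalues
    simp only [RCLike.ofReal_real_eq_id, id] at h1 h2
    have h0 := hP.eigenvalues_nonneg
    have h3 := Real.geom_mean_le_arith_mean_weighted Finset.univ (fun _ : Fin n => (n : ℝ)⁻¹)
      hP.isHermitian.eigenvalues (fun _ _ => by positivity) (by simp [hn'.ne'])
      (fun i _ => h0 i)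
    rw [Real.finsetProd_rpow _ _ (fun i _ => h0 i), ← h1, ← Finset.mul_sum, ← h2] at h3
    have h4 : (n : ℝ)⁻¹ * H.trace ≤ n := by
      rw [inv_mul_le_iff₀ hn']; exact htr
    have h5 := pow_le_pow_left₀ (by
      rw [h1]; exact Real.rpow_nonneg (Finset.prod_nonneg fun i _ => h0 i) _) (h3.trans h4) n
    rwa [Real.rpow_inv_natCast_pow (by rw [hdet]; positivity) hn.ne'] at h5
  apply Real.abs_le_sqrt
  rwa [← hdet]

/-! ### Fredholm series -/

/-- The `m`-th term of the Fredholm series of a real kernel with respect to the measure `μ`. -/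
def fredholmTerm (μ : Measure ℝ) (K : ℝ → ℝ → ℝ) (m : ℕ) : ℝ :=
  (-1) ^ m / (m.factorial : ℝ) *
    ∫ x : Fin m → ℝ, (Matrix.of fun i j => K (x i) (x j)).det ∂(Measure.pi fun _ => μ)

/-- The sum of all principal minors of size `m`, each counted `m!` times, in terms of arbitrary
index maps: maps that are not injective contribute zero. -/
lemma sum_det_submatrix {n : ℕ} (B : Matrix (Fin n) (Fin n) ℝ) (m : ℕ) :
    ∑ f : Fin m → Fin n, (B.submatrix f f).det =
      m.factorial * ∑ s ∈ Finset.univ.powersetCard m,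
        (B.submatrix (Subtype.val : s → Fin n) Subtype.val).det := by
  classical
  have hinj : ∑ f : Fin m → Fin n, (B.submatrix f f).det =
      ∑ f : Fin m → Fin n with Function.Injective f, (B.submatrix f f).det := by
    rw [Finset.sum_filter]
    refine Finset.sum_congr rfl fun f _ => ?_
    split_ifs with h
    · rfl
    · rw [Function.Injective] at h
      push Not at h
      obtain ⟨i, j, hij, hne⟩ := h
      exact Matrix.det_zero_of_row_eq hne (by ext k; simp [hij])
  rw [hinj, Finset.mul_sum]
  rw [← Finset.sum_fiberwise_of_maps_to (s := Finset.univ.filter Function.Injective)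
    (t := Finset.univ.powersetCard m) (g := fun f : Fin m → Fin n => Finset.univ.image f)]
  · refine Finset.sum_congr rfl fun s hs => ?_
    have hcard : s.card = m := (Finset.mem_powersetCard.mp hs).2
    have hval : ∀ f ∈ {f ∈ Finset.univ.filter (Function.Injective (α := Fin m) (β := Fin n)) |
        Finset.univ.image f = s}, (B.submatrix f f).det =
        (B.submatrix (Subtype.val : s → Fin n) Subtype.val).det := by
      intro f hf
      simp only [Finset.mem_filter, Finset.mem_univ, true_and] at hf
      have hmem : ∀ i, f i ∈ s := fun i => by rw [← hf.2]; simp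
      let e : Fin m ≃ s := Equiv.ofBijective (fun i => ⟨f i, hmem i⟩) (by
        rw [Fintype.bijective_iff_injective_and_card]
        refine ⟨fun i j hij => hf.1 (by simpa using hij), by simp [hcard]⟩)
      rw [← Matrix.det_submatrix_equiv_self e]
      rfl
    rw [Finset.sum_congr rfl hval, Finset.sum_const, nsmul_eq_mul]
    congr 2
    -- the maps with image `s` are the `m!` bijections onto `s`
    let F : (Fin m ≃ s) → (Fin m → Fin n) := fun e i => (e i : Fin n)
    have himg : {f ∈ Finset.univ.filter (Function.Injective (α := Fin m) (β := Fin n)) |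
        Finset.univ.image f = s} = Finset.univ.image F := by
      ext f
      simp only [Finset.mem_filter, Finset.mem_univ, true_and, Finset.mem_image]
      constructor
      · rintro ⟨h1, h2⟩
        have hmem : ∀ i, f i ∈ s := fun i => by rw [← h2]; simp
        refine ⟨Equiv.ofBijective (fun i => ⟨f i, hmem i⟩) ?_, rfl⟩
        rw [Fintype.bijective_iff_injective_and_card]
        exact ⟨fun i j hij => h1 (by simpa using hij), by simp [hcard]⟩
      · rintro ⟨e, rfl⟩
        refine ⟨fun i j hij => e.injective (Subtype.ext hij), ?_⟩
        ext x
        simp only [Finset.mem_image, Finset.mem_univ, true_and, F]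
        exact ⟨fun ⟨i, hi⟩ => hi ▸ (e i).2, fun hx => ⟨e.symm ⟨x, hx⟩, by simp⟩⟩
    rw [himg, Finset.card_image_of_injective, Finset.card_univ,
      Fintype.card_equiv (Fintype.equivOfCardEq (by simp [hcard])), Fintype.card_fin]
    intro e e' h
    ext i
    exact congrArg Fin.val (congrFun h i)
  · intro f hf
    simp only [Finset.mem_filter, Finset.mem_univ, true_and] at hf
    simp [Finset.mem_powersetCard, Finset.card_image_of_injective _ hf]

/-- Expansion of `det (1 - B)` in principal minors. -/
lemma hasSum_det_one_sub {n : ℕ} (B : Matrix (Fin n) (Fin n) ℝ) :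
    HasSum (fun m : ℕ => (-1 : ℝ) ^ m / (m.factorial : ℝ) *
      ∑ f : Fin m → Fin n, (B.submatrix f f).det) (1 - B).det := by
  have hterm : ∀ m : ℕ, (-1 : ℝ) ^ m / (m.factorial : ℝ) *
      ∑ f : Fin m → Fin n, (B.submatrix f f).det =
      (-1) ^ m * (Matrix.det (1 + (Polynomial.X : Polynomial ℝ) • B.map Polynomial.C)).coeff m := by
    intro m
    rw [sum_det_submatrix, Matrix.coeff_det_one_add_X_smul_eq_sum_minors]
    have : (m.factorial : ℝ) ≠ 0 := by positivity
    field_simp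
  simp only [hterm]
  set p := Matrix.det (1 + (Polynomial.X : Polynomial ℝ) • B.map Polynomial.C) with hp
  -- the coefficients of `det (1 + X B)` are the sums of the principal minors
  have heval : (1 - B).det = p.eval (-1) := by
    rw [hp, ← Polynomial.coe_evalRingHom, RingHom.map_det]
    congr 1
    ext i j
    simp [Matrix.one_apply, sub_eq_add_neg]
    split_ifs <;> simp
  rw [heval, Polynomial.eval_eq_sum_range]
  have := hasSum_sum_of_ne_finset_zero (L := SummationFilter.unconditional ℕ)
    (f := fun m => (-1 : ℝ) ^ m * p.coeff m) (s := Finset.range (p.natDegree + 1)) (fun m hm => by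
      rw [Polynomial.coeff_eq_zero_of_natDegree_lt (by simpa using hm), mul_zero])
  convert this using 1
  exact Finset.sum_congr rfl fun m _ => mul_comm _ _

/-- For a kernel of finite rank the Fredholm series is a finite-dimensional determinant. -/
lemma hasSum_fredholmTerm_finite_rank {n : ℕ} {μ : Measure ℝ} [SigmaFinite μ]
    (φ ψ : Fin n → ℝ → ℝ) (hint : ∀ k l, Integrable (fun x => φ k x * ψ l x) μ) :
    HasSum (fredholmTerm μ fun x y => ∑ k, φ k x * ψ k y)
      (1 - Matrix.of fun k l => ∫ x, φ k x * ψ l x ∂μ).det := by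
  convert hasSum_det_one_sub _ using 1
  funext m
  rw [fredholmTerm]
  congr 1
  have hexp : ∀ x : Fin m → ℝ,
      (Matrix.of fun p q => ∑ k, φ k (x p) * ψ k (x q)).det =
      ∑ f : Fin m → Fin n, (Matrix.of fun p q => φ (f q) (x q) * ψ (f p) (x q)).det := by
    intro x
    have h1 : (Matrix.of fun p q => ∑ k, φ k (x p) * ψ k (x q)) =
        fun p => ∑ k, (fun q => φ k (x p) * ψ k (x q)) := by
      ext p q; simp
    rw [h1]
    have h2 := (Matrix.detRowAlternating (n := Fin m) (R := ℝ)).toMultilinearMap.map_sum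
      (fun p (k : Fin n) => (fun q => φ k (x p) * ψ k (x q)))
    refine h2.trans (Finset.sum_congr rfl fun f _ => ?_)
    have h3 := Matrix.det_mul_row (fun q => φ (f q) (x q))
      (Matrix.of fun p q => ψ (f p) (x q))
    have h4 := Matrix.det_mul_column (fun p => φ (f p) (x p))
      (Matrix.of fun p q => ψ (f p) (x q))
    exact h4.trans h3.symm
  simp only [hexp]
  rw [integral_finsetSum]
  · refine Finset.sum_congr rfl fun f _ => ?_
    rw [integral_det (g := fun p q y => φ (f q) y * ψ (f p) y) (fun p q => hint _ _),
      ← Matrix.det_transpose]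
    rfl
  · intro f _
    exact integrable_det (g := fun p q y => φ (f q) y * ψ (f p) y) (fun p q => hint _ _)

lemma abs_det_kernel_le {m : ℕ} {K : ℝ → ℝ → ℝ} {u v : ℝ → ℝ} {s : Set ℝ}
    (hu : ∀ x ∈ s, 0 < u x) (hv : ∀ x ∈ s, 0 < v x)
    (hK : ∀ x ∈ s, ∀ y ∈ s, |K x y| ≤ u x * v y) (x : Fin m → ℝ) (hx : ∀ i, x i ∈ s) :
    |(Matrix.of fun i j => K (x i) (x j)).det| ≤ √((m : ℝ) ^ m) * ∏ i, (u (x i) * v (x i)) := by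
  have h1 : (Matrix.of fun i j => K (x i) (x j)) = Matrix.of fun i j => u (x i) *
      (Matrix.of fun i j => v (x j) * (Matrix.of fun i j => K (x i) (x j) / (u (x i) * v (x j)))
        i j) i j := by
    ext i j
    have := (hu _ (hx i)).ne'
    have := (hv _ (hx j)).ne'
    simp only [Matrix.of_apply]
    field_simp
  rw [h1, Matrix.det_mul_column, Matrix.det_mul_row, abs_mul, abs_mul]
  have h2 := abs_det_le_sqrt_of_abs_le_one
    (Matrix.of fun i j => K (x i) (x j) / (u (x i) * v (x j))) (fun i j => by
      have h3 : 0 < u (x i) * v (x j) := mul_pos (hu _ (hx i)) (hv _ (hx j))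
      rw [Matrix.of_apply, abs_div, abs_of_pos h3, div_le_one h3]
      exact hK _ (hx i) _ (hx j))
  rw [abs_of_nonneg (Finset.prod_nonneg fun i _ => (hu _ (hx i)).le),
    abs_of_nonneg (Finset.prod_nonneg fun i _ => (hv _ (hx i)).le), ← mul_assoc, mul_comm,
    Finset.prod_mul_distrib]
  exact mul_le_mul_of_nonneg_right h2 (mul_nonneg
    (Finset.prod_nonneg fun i _ => (hu _ (hx i)).le)
    (Finset.prod_nonneg fun i _ => (hv _ (hx i)).le))

lemma summable_sqrt_pow_div_factorial (c : ℝ) (hc : 0 ≤ c) :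
    Summable fun m : ℕ => √((m : ℝ) ^ m) * c ^ m / (m.factorial : ℝ) := by
  have h1 : Summable fun m : ℕ => ((1 / 2 : ℝ) ^ m + (2 * (Real.exp 1 * c ^ 2)) ^ m / m.factorial) :=
    (summable_geometric_of_lt_one (by norm_num) (by norm_num)).add
      (Real.summable_pow_div_factorial _)
  refine Summable.of_nonneg_of_le (fun m => by positivity) (fun m => ?_) h1
  have hf : (0 : ℝ) < m.factorial := by positivity
  have h2 : (m : ℝ) ^ m / m.factorial ≤ Real.exp 1 ^ m := by
    have := Real.pow_div_factorial_le_exp (m : ℝ) (by positivity) m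
    rwa [← Real.exp_nat_mul, mul_one]
  set X : ℝ := (1 / 2 : ℝ) ^ m
  set Y : ℝ := (2 * (Real.exp 1 * c ^ 2)) ^ m / m.factorial
  have hX : 0 ≤ X := by positivity
  have hY : 0 ≤ Y := by positivity
  -- the square of the term is at most `X * Y`, hence the term is at most `X + Y`
  have hXY : (√((m : ℝ) ^ m) * c ^ m / (m.factorial : ℝ)) ^ 2 ≤ X * Y := by
    have h3 : X * Y = Real.exp 1 ^ m * (c ^ m) ^ 2 / m.factorial := by
      simp only [X, Y]
      rw [mul_pow, mul_pow, ← mul_div_assoc, ← mul_assoc, ← mul_pow]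
      ring_nf
    rw [h3, div_pow, mul_pow, Real.sq_sqrt (by positivity)]
    calc (m : ℝ) ^ m * (c ^ m) ^ 2 / (m.factorial : ℝ) ^ 2
        = (m : ℝ) ^ m / m.factorial * (c ^ m) ^ 2 / m.factorial := by field_simp
      _ ≤ Real.exp 1 ^ m * (c ^ m) ^ 2 / m.factorial := by gcongr
  have h4 : (√((m : ℝ) ^ m) * c ^ m / (m.factorial : ℝ)) ^ 2 ≤ (X + Y) ^ 2 := by nlinarith
  exact le_of_sq_le_sq h4 (by positivity)

section Limit

variable {K : ℝ → ℝ → ℝ} {u v : ℝ → ℝ} {s : Set ℝ}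

lemma ae_pi_restrict_mem (hs : MeasurableSet s) (m : ℕ) :
    ∀ᵐ x : Fin m → ℝ ∂(Measure.pi fun _ => volume.restrict s), ∀ i, x i ∈ s := by
  rw [← Measure.restrict_pi_pi]
  filter_upwards [ae_restrict_mem (MeasurableSet.univ_pi fun _ => hs)] with x hx i
  exact hx i (Set.mem_univ i)

lemma integrable_det_kernel (hs : MeasurableSet s) (hK : ∀ m : ℕ, AEStronglyMeasurable
      (fun x : Fin m → ℝ => (Matrix.of fun i j => K (x i) (x j)).det)
      (Measure.pi fun _ => volume.restrict s))
    (hu : ∀ x ∈ s, 0 < u x) (hv : ∀ x ∈ s, 0 < v x) (huv : IntegrableOn (fun x => u x * v x) s)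
    (hbd : ∀ x ∈ s, ∀ y ∈ s, |K x y| ≤ u x * v y) (m : ℕ) :
    Integrable (fun x : Fin m → ℝ => (Matrix.of fun i j => K (x i) (x j)).det)
      (Measure.pi fun _ => volume.restrict s) := by
  refine Integrable.mono' ((Integrable.fintype_prod (f := fun _ : Fin m => fun x => u x * v x)
    fun _ => huv).const_mul (√((m : ℝ) ^ m))) (hK m) ?_
  filter_upwards [ae_pi_restrict_mem hs m] with x hx
  exact abs_det_kernel_le hu hv hbd x hx

lemma abs_fredholmTerm_le (hs : MeasurableSet s)
    (hu : ∀ x ∈ s, 0 < u x) (hv : ∀ x ∈ s, 0 < v x) (huv : IntegrableOn (fun x => u x * v x) s)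
    (hbd : ∀ x ∈ s, ∀ y ∈ s, |K x y| ≤ u x * v y) (m : ℕ) :
    |fredholmTerm (volume.restrict s) K m| ≤
      √((m : ℝ) ^ m) * (∫ x in s, u x * v x) ^ m / (m.factorial : ℝ) := by
  have h1 : |∫ x : Fin m → ℝ, (Matrix.of fun i j => K (x i) (x j)).det
      ∂(Measure.pi fun _ => volume.restrict s)| ≤ √((m : ℝ) ^ m) * (∫ x in s, u x * v x) ^ m := by
    have h2 := integral_fintype_prod_eq_pow (ι := Fin m) (𝕜 := ℝ) (fun x => u x * v x)
      (μ := volume.restrict s)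
    rw [Fintype.card_fin] at h2
    rw [← h2, ← integral_const_mul, ← Real.norm_eq_abs]
    refine norm_integral_le_of_norm_le ((Integrable.fintype_prod
      (f := fun _ : Fin m => fun x => u x * v x) fun _ => huv).const_mul _) ?_
    filter_upwards [ae_pi_restrict_mem hs m] with x hx
    exact abs_det_kernel_le hu hv hbd x hx
  rw [fredholmTerm, abs_mul, abs_div, abs_pow, abs_neg, abs_one, one_pow, Nat.abs_cast, div_mul_eq_mul_div, one_mul]
  gcongr

/-- Convergence of Fredholm series: it suffices that the kernels converge pointwise and are
dominated by a product `u x * v y` with `u v` integrable.  Hadamard's bound makes the series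
converge uniformly. -/
lemma fredholm_limit {KN : ℕ → ℝ → ℝ → ℝ} (hs : MeasurableSet s)
    (hmeas : ∀ N, Measurable (Function.uncurry (KN N)))
    (hu : ∀ x ∈ s, 0 < u x) (hv : ∀ x ∈ s, 0 < v x) (huv : IntegrableOn (fun x => u x * v x) s)
    (hbd : ∀ N, ∀ x ∈ s, ∀ y ∈ s, |KN N x y| ≤ u x * v y)
    (hlim : ∀ x ∈ s, ∀ y ∈ s, Tendsto (fun N => KN N x y) atTop (𝓝 (K x y))) :
    (∀ m : ℕ, Integrable (fun x : Fin m → ℝ => (Matrix.of fun i j => K (x i) (x j)).det)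
      (Measure.pi fun _ => volume.restrict s)) ∧
    Summable (fredholmTerm (volume.restrict s) K) ∧
    Tendsto (fun N => ∑' m, fredholmTerm (volume.restrict s) (KN N) m) atTop
      (𝓝 (∑' m, fredholmTerm (volume.restrict s) K m)) := by
  have hmeas' : ∀ N m, Measurable
      (fun x : Fin m → ℝ => (Matrix.of fun i j => KN N (x i) (x j)).det) := by
    intro N m
    simp only [Matrix.det_apply, Matrix.of_apply]
    refine Finset.measurable_fun_sum _ fun σ _ => ?_
    refine Measurable.const_smul ?_ _
    refine Finset.measurable_fun_prod _ fun i _ => ?_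
    exact (hmeas N).comp (g := Function.uncurry (KN N))
      (f := fun x : Fin m → ℝ => (x (σ i), x i)) (by fun_prop)
  have hdet : ∀ m, ∀ x : Fin m → ℝ, (∀ i, x i ∈ s) →
      Tendsto (fun N => (Matrix.of fun i j => KN N (x i) (x j)).det) atTop
        (𝓝 (Matrix.of fun i j => K (x i) (x j)).det) := by
    intro m x hx
    simp only [Matrix.det_apply, Matrix.of_apply]
    refine tendsto_finsetSum _ fun σ _ => ?_
    refine Tendsto.const_smul ?_ _
    exact tendsto_finsetProd _ fun i _ => hlim _ (hx _) _ (hx _)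
  have hKm : ∀ m : ℕ, AEStronglyMeasurable
      (fun x : Fin m → ℝ => (Matrix.of fun i j => K (x i) (x j)).det)
      (Measure.pi fun _ => volume.restrict s) := by
    intro m
    refine aestronglyMeasurable_of_tendsto_ae atTop
      (fun N => (hmeas' N m).aestronglyMeasurable) ?_
    filter_upwards [ae_pi_restrict_mem hs m] with x hx
    exact hdet m x hx
  have hbdK : ∀ x ∈ s, ∀ y ∈ s, |K x y| ≤ u x * v y := fun x hx y hy =>
    le_of_tendsto (hlim x hx y hy).abs (Eventually.of_forall fun N => hbd N x hx y hy)
  have hJ : 0 ≤ ∫ x in s, u x * v x :=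
    setIntegral_nonneg hs fun x hx => (mul_pos (hu x hx) (hv x hx)).le
  refine ⟨integrable_det_kernel hs hKm hu hv huv hbdK, ?_, ?_⟩
  · exact Summable.of_norm_bounded (summable_sqrt_pow_div_factorial _ hJ)
      (abs_fredholmTerm_le hs hu hv huv hbdK)
  · refine tendsto_tsum_of_dominated_convergence (summable_sqrt_pow_div_factorial _ hJ)
      (fun m => ?_) (Eventually.of_forall fun N m => abs_fredholmTerm_le hs hu hv huv (hbd N) m)
    refine Tendsto.const_mul _ ?_
    refine tendsto_integral_of_dominated_convergence
      (fun x => √((m : ℝ) ^ m) * ∏ i, (u (x i) * v (x i)))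
      (fun N => (hmeas' N m).aestronglyMeasurable)
      ((Integrable.fintype_prod (f := fun _ : Fin m => fun x => u x * v x)
        fun _ => huv).const_mul _) (fun N => ?_) ?_
    · filter_upwards [ae_pi_restrict_mem hs m] with x hx
      exact abs_det_kernel_le hu hv (hbd N) x hx
    · filter_upwards [ae_pi_restrict_mem hs m] with x hx
      exact hdet m x hx

end Limit

/-! ### Marginal integrals over triangles of interlacing levels -/

section Marginal

variable {δ : Type*}

/-- Integrating out the coordinates `f i` is integrating over the vectors `y` that replace them. -/
lemma lmarginal_image_univ [DecidableEq δ] {ι : Type*} [Fintype ι] {f : ι → δ} (hf : Function.Injective f)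
    {F : (δ → ℝ) → ENNReal} (hF : Measurable F) (X : δ → ℝ) :
    (∫⋯∫⁻_Finset.univ.image f, F ∂fun _ => volume) X =
      ∫⁻ y : ι → ℝ, F (Function.extend f y X) := by
  classical
  have hext : Measurable fun y : ι → ℝ => Function.extend f y X := by
    refine measurable_pi_lambda _ fun d => ?_
    by_cases h : ∃ i, f i = d
    · obtain ⟨i, rfl⟩ := h
      simpa [hf.extend_apply] using measurable_pi_apply i
    · simp [Function.extend_apply' _ _ _ h]
  have h1 := lmarginal_image (X := fun _ => ℝ) (μ := fun _ => volume) hf Finset.univ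
    (hF.comp hext) X
  rw [lmarginal_univ] at h1
  rw [volume_pi]
  refine Eq.trans ?_ h1
  rw [lmarginal, lmarginal]
  refine lintegral_congr fun y => ?_
  simp only [Function.comp_apply]
  congr 1
  ext d
  by_cases h : ∃ i, f i = d
  · obtain ⟨i, rfl⟩ := h
    rw [hf.extend_apply]
  · rw [Function.extend_apply' _ _ _ h]
    exact dif_neg (by simpa using h)

/-- A factor that does not depend on the coordinates being integrated out can be pulled out. -/
lemma lmarginal_mul_left [DecidableEq δ] (T : Finset δ) {c g : (δ → ℝ) → ENNReal} (hg : Measurable g)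
    (hc : ∀ X Y : δ → ℝ, (∀ d ∉ T, X d = Y d) → c X = c Y) :
    ∫⋯∫⁻_T, (fun X => c X * g X) ∂(fun _ => volume) =
      fun X => c X * (∫⋯∫⁻_T, g ∂fun _ => volume) X := by
  ext X
  rw [lmarginal, lmarginal]
  have h1 : ∀ y : T → ℝ, c (Function.updateFinset X T y) = c X := fun y =>
    hc _ _ fun d hd => dif_neg hd
  simp only [h1]
  rw [lintegral_const_mul]
  exact hg.comp measurable_updateFinset

/-- The positions of the levels `1, …, n` above a base row of length `n + 1`: level `d` consists of
the positions `e d k` with `k < n + 1 - d`. -/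
def triSet [DecidableEq δ] : ℕ → (ℕ → ℕ → δ) → Finset δ
  | 0, _ => ∅
  | n + 1, e => (Finset.univ.image fun k : Fin (n + 1) => e 1 k) ∪ triSet n fun d => e (d + 1)

/-- The product of the weights `W d` over all entries of the levels `d = 1, …, n`, restricted to
interlacing configurations: every entry lies between its two neighbours on the previous level. -/
def triWeight : ℕ → (ℕ → ℕ → δ) → (ℕ → ℝ → ℝ) → (δ → ℝ) → ENNReal
  | 0, _, _, _ => 1
  | n + 1, e, W, X => (∏ k : Fin (n + 1), ENNReal.ofReal
      ((Set.Ioo (X (e 0 k)) (X (e 0 (k + 1)))).indicator (W 1) (X (e 1 k)))) *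
      triWeight n (fun d => e (d + 1)) (fun d => W (d + 1)) X

lemma mem_triSet [DecidableEq δ] {n : ℕ} {e : ℕ → ℕ → δ} {x : δ} :
    x ∈ triSet n e ↔ ∃ d k, d + k < n ∧ x = e (d + 1) k := by
  induction n generalizing e with
  | zero => simp [triSet]
  | succ n ih =>
    rw [triSet, Finset.mem_union, ih]
    simp only [Finset.mem_image, Finset.mem_univ, true_and]
    constructor
    · rintro (⟨k, rfl⟩ | ⟨d, k, h, rfl⟩)
      · exact ⟨0, k, by omega, rfl⟩
      · exact ⟨d + 1, k, by omega, rfl⟩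
    · rintro ⟨d, k, h, rfl⟩
      rcases d with _ | d
      · exact Or.inl ⟨⟨k, by omega⟩, rfl⟩
      · exact Or.inr ⟨d, k, by omega, rfl⟩

lemma measurable_triWeight (n : ℕ) (e : ℕ → ℕ → δ) {W : ℕ → ℝ → ℝ} (hW : ∀ d, Measurable (W d)) :
    Measurable (triWeight n e W) := by
  induction n generalizing e W with
  | zero => exact measurable_const
  | succ n ih =>
    refine Measurable.mul (Finset.measurable_fun_prod _ fun k _ => ?_) (ih _ fun d => hW _)
    refine ENNReal.measurable_ofReal.comp ?_
    have hset : MeasurableSet {X : δ → ℝ | X (e 1 k) ∈ Set.Ioo (X (e 0 k)) (X (e 0 (k + 1)))} :=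
      (measurableSet_lt (measurable_pi_apply (e 0 k)) (measurable_pi_apply (e 1 k))).inter
        (measurableSet_lt (measurable_pi_apply (e 1 k)) (measurable_pi_apply (e 0 (k + 1))))
    have : (fun X : δ → ℝ => (Set.Ioo (X (e 0 k)) (X (e 0 (k + 1)))).indicator (W 1) (X (e 1 k))) =
        {X : δ → ℝ | X (e 1 k) ∈ Set.Ioo (X (e 0 k)) (X (e 0 (k + 1)))}.indicator
          fun X => W 1 (X (e 1 k)) := rfl
    rw [this]
    exact ((hW 1).comp (measurable_pi_apply _)).indicator hset

lemma triWeight_congr {n : ℕ} {e : ℕ → ℕ → δ} {W : ℕ → ℝ → ℝ} {X Y : δ → ℝ}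
    (h : ∀ d k, X (e d k) = Y (e d k)) : triWeight n e W X = triWeight n e W Y := by
  induction n generalizing e W with
  | zero => rfl
  | succ n ih => simp only [triWeight, h, ih fun d k => h (d + 1) k]

/-- The family `ψ d i` of functions attached to level `d`: the zeroth one is constant, and the
others are antiderivatives of the functions on the next level times its weight. -/
structure IsLevelFamily (W : ℕ → ℝ → ℝ) (ψ : ℕ → ℕ → ℝ → ℝ) : Prop where
  one : ∀ d x, ψ d 0 x = 1
  integrableOn : ∀ d i a b, 0 < a → a < b → b < 1 →
    IntegrableOn (fun y => ψ (d + 1) i y * W (d + 1) y) (Set.Ioo a b)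
  sub_eq : ∀ d i a b, 0 < a → a < b → b < 1 →
    ψ d (i + 1) b - ψ d (i + 1) a = ∫ y in Set.Ioo a b, ψ (d + 1) i y * W (d + 1) y

lemma IsLevelFamily.shift {W : ℕ → ℝ → ℝ} {ψ : ℕ → ℕ → ℝ → ℝ} (h : IsLevelFamily W ψ) :
    IsLevelFamily (fun d => W (d + 1)) (fun d => ψ (d + 1)) :=
  ⟨fun _ => h.one _, fun _ => h.integrableOn _, fun _ => h.sub_eq _⟩

/-- A determinant whose first row is constant `1` is the determinant of the differences of
consecutive columns. -/
lemma det_sub_pred {n : ℕ} (M : Matrix (Fin (n + 2)) (Fin (n + 2)) ℝ) (h1 : ∀ j, M 0 j = 1) :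
    (Matrix.of fun i j : Fin (n + 1) => M i.succ j.succ - M i.succ j.castSucc).det = M.det := by
  let B : Matrix (Fin (n + 2)) (Fin (n + 2)) ℝ := Matrix.of fun i j =>
    Fin.cases (motive := fun _ => ℝ) (M i 0) (fun j => M i j.succ - M i j.castSucc) j
  have hB : M.det = B.det := Matrix.det_eq_of_forall_col_eq_smul_add_pred (fun _ => 1)
    (fun i => by simp [B]) (fun i j => by simp [B])
  have h0 : ∀ j : Fin (n + 1), B 0 j.succ = 0 := fun j => by simp [B, h1]
  have h00 : B 0 0 = 1 := h1 0
  rw [hB, B.det_succ_row_zero, Fin.sum_univ_succ,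
    Finset.sum_eq_zero fun j _ => by rw [h0, mul_zero, zero_mul], add_zero, h00, Fin.val_zero,
    pow_zero, one_mul, one_mul]
  rfl

lemma det_indicator_mul {m : ℕ} (S : Fin m → Set ℝ) (f : Fin m → ℝ → ℝ) (w : ℝ → ℝ)
    (y : Fin m → ℝ) (hy : ∀ k, y k ∈ S k) :
    (Matrix.of fun i j => (S j).indicator (fun y => f i y * w y) (y j)).det =
      (∏ k, w (y k)) * (Matrix.of fun i j => f i (y j)).det := by
  rw [← Matrix.det_mul_row]
  congr 1
  ext i j
  simp [Set.indicator_of_mem (hy j), mul_comm]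

/-- Integrating out all the levels above a base row gives the determinant of the functions of
level `0`, evaluated at the base row. -/
lemma lmarginal_triWeight [DecidableEq δ] (n : ℕ) (e : ℕ → ℕ → δ) (W : ℕ → ℝ → ℝ) (ψ : ℕ → ℕ → ℝ → ℝ)
    (he : ∀ d k d' k', e d k = e d' k' → d = d' ∧ k = k') (hWm : ∀ d, Measurable (W d))
    (hW0 : ∀ d, ∀ y ∈ Set.Ioo (0 : ℝ) 1, 0 ≤ W d y) (hψ : IsLevelFamily W ψ) (X : δ → ℝ)
    (hX : ∀ k ≤ n, X (e 0 k) ∈ Set.Ioo (0 : ℝ) 1) (hmono : ∀ k < n, X (e 0 k) < X (e 0 (k + 1))) :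
    0 ≤ (Matrix.of fun i j : Fin (n + 1) => ψ 0 i (X (e 0 j))).det ∧
    (∫⋯∫⁻_triSet n e, triWeight n e W ∂fun _ => volume) X =
      ENNReal.ofReal (Matrix.of fun i j : Fin (n + 1) => ψ 0 i (X (e 0 j))).det := by
  induction n generalizing e W ψ X with
  | zero => simp [triSet, triWeight, lmarginal_empty, hψ.one]
  | succ n ih =>
    let S : Fin (n + 1) → Set ℝ := fun k => Set.Ioo (X (e 0 k)) (X (e 0 (k + 1)))
    let g : Fin (n + 1) → Fin (n + 1) → ℝ → ℝ := fun i j =>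
      (S j).indicator fun y => ψ 1 i y * W 1 y
    have hS : ∀ k : Fin (n + 1), ∀ y ∈ S k, y ∈ Set.Ioo (0 : ℝ) 1 := fun k y hy =>
      ⟨(hX k (by omega)).1.trans hy.1, hy.2.trans (hX (k + 1) (by omega)).2⟩
    have hbox : ∀ y : Fin (n + 1) → ℝ, (∀ k, y k ∈ S k) →
        0 ≤ (Matrix.of fun i j : Fin (n + 1) => ψ 1 i (y j)).det ∧
        (∫⋯∫⁻_triSet n (fun d => e (d + 1)), triWeight n (fun d => e (d + 1)) (fun d => W (d + 1))
          ∂fun _ => volume) (Function.extend (fun k : Fin (n + 1) => e 1 k) y X) =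
          ENNReal.ofReal (Matrix.of fun i j : Fin (n + 1) => ψ 1 i (y j)).det := by
      intro y hy
      have hinj : Function.Injective fun k : Fin (n + 1) => e 1 k := fun k k' h =>
        Fin.ext (he _ _ _ _ h).2
      have hval : ∀ k : Fin (n + 1),
          Function.extend (fun k : Fin (n + 1) => e 1 k) y X (e 1 k) = y k := fun k =>
        hinj.extend_apply (f := fun k : Fin (n + 1) => e 1 k) y X k
      have hval' : ∀ k (hk : k < n + 1),
          Function.extend (fun k : Fin (n + 1) => e 1 k) y X (e 1 k) = y ⟨k, hk⟩ := fun k hk =>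
        hval ⟨k, hk⟩
      have := ih (fun d => e (d + 1)) (fun d => W (d + 1)) (fun d => ψ (d + 1))
        (fun d k d' k' h => by simpa using he _ _ _ _ h) (fun d => hWm _) (fun d => hW0 _) hψ.shift
        (Function.extend (fun k : Fin (n + 1) => e 1 k) y X)
        (fun k hk => by
          simp only [zero_add]
          rw [hval' k (by omega)]; exact hS _ _ (hy _))
        (fun k hk => by
          simp only [zero_add]
          rw [hval' k (by omega), hval' (k + 1) (by omega)]
          exact (hy ⟨k, by omega⟩).2.trans (hy ⟨k + 1, by omega⟩).1)
      simpa only [zero_add, hval] using this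
    have hgint : ∀ i j, Integrable (g i j) volume := by
      intro i j
      rw [integrable_indicator_iff measurableSet_Ioo]
      exact hψ.integrableOn 0 i _ _ (hX j (by omega)).1 (hmono j (by omega))
        (hX (j + 1) (by omega)).2
    -- nonnegativity is part of the induction, so that `ENNReal.ofReal` loses nothing
    have hg0 : ∀ y : Fin (n + 1) → ℝ, 0 ≤ (Matrix.of fun i j => g i j (y j)).det := by
      intro y
      by_cases hy : ∀ k, y k ∈ S k
      · rw [det_indicator_mul S (fun i => ψ 1 i) (W 1) y hy]
        exact mul_nonneg (Finset.prod_nonneg fun k _ => hW0 1 _ (hS k _ (hy k))) (hbox y hy).1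
      · push Not at hy
        obtain ⟨k, hk⟩ := hy
        rw [Matrix.det_eq_zero_of_column_eq_zero k fun i => by
          simp [g, Set.indicator_of_notMem hk]]
    have hdet : (Matrix.of fun i j => ∫ y, g i j y).det =
        (Matrix.of fun i j : Fin (n + 2) => ψ 0 i (X (e 0 j))).det := by
      rw [← det_sub_pred _ fun j => by simp [hψ.one]]
      congr 1
      ext i j
      simp only [Matrix.of_apply, g, Fin.val_succ, Fin.val_castSucc]
      rw [integral_indicator measurableSet_Ioo]
      exact (hψ.sub_eq 0 i _ _ (hX j (by omega)).1 (hmono j (by omega))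
        (hX (j + 1) (by omega)).2).symm
    rw [← hdet, ← integral_det hgint, ← volume_pi]
    refine ⟨integral_nonneg hg0, ?_⟩
    have hint := integrable_det hgint
    rw [← volume_pi] at hint
    rw [ofReal_integral_eq_lintegral_ofReal hint (Eventually.of_forall hg0), triSet,
      lmarginal_union _ _ (measurable_triWeight _ _ hWm)]
    · have hfac := lmarginal_mul_left (triSet n fun d => e (d + 1))
        (c := fun X => ∏ k : Fin (n + 1), ENNReal.ofReal
          ((Set.Ioo (X (e 0 k)) (X (e 0 (k + 1)))).indicator (W 1) (X (e 1 k))))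
        (measurable_triWeight n (fun d => e (d + 1)) (W := fun d => W (d + 1)) fun d => hWm _) (by
          intro X Y hXY
          have h0 : ∀ k, X (e 0 k) = Y (e 0 k) := fun k => hXY _ fun h => by
            obtain ⟨d, k', -, h⟩ := mem_triSet.mp h
            have := (he _ _ _ _ h).1
            omega
          have h1 : ∀ k, X (e 1 k) = Y (e 1 k) := fun k => hXY _ fun h => by
            obtain ⟨d, k', -, h⟩ := mem_triSet.mp h
            have := (he _ _ _ _ h).1
            omega
          simp only [h0, h1])
      have hinj : Function.Injective fun k : Fin (n + 1) => e 1 k := fun k k' h =>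
        Fin.ext (he _ _ _ _ h).2
      have heq : triWeight (n + 1) e W = fun X => (∏ k : Fin (n + 1), ENNReal.ofReal
          ((Set.Ioo (X (e 0 k)) (X (e 0 (k + 1)))).indicator (W 1) (X (e 1 k)))) *
          triWeight n (fun d => e (d + 1)) (fun d => W (d + 1)) X := rfl
      rw [lmarginal_image_univ hinj
        (Measurable.lmarginal _ (measurable_triWeight _ _ hWm)), heq, hfac]
      refine lintegral_congr fun y => ?_
      have hval : ∀ k : Fin (n + 1),
          Function.extend (fun k : Fin (n + 1) => e 1 k) y X (e 1 k) = y k := fun k =>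
        hinj.extend_apply (f := fun k : Fin (n + 1) => e 1 k) y X k
      have hval0 : ∀ k, Function.extend (fun k : Fin (n + 1) => e 1 k) y X (e 0 k) = X (e 0 k) := by
        intro k
        refine Function.extend_apply' _ _ _ ?_
        rintro ⟨k', h⟩
        have := (he _ _ _ _ h).1
        omega
      simp only [hval, hval0]
      by_cases hy : ∀ k, y k ∈ S k
      · rw [(hbox y hy).2, det_indicator_mul S (fun i => ψ 1 i) (W 1) y hy,
          ENNReal.ofReal_mul (Finset.prod_nonneg fun k _ => hW0 1 _ (hS k _ (hy k))),
          ENNReal.ofReal_prod_of_nonneg fun k _ => hW0 1 _ (hS k _ (hy k))]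
        congr 1
        exact Finset.prod_congr rfl fun k _ => by rw [Set.indicator_of_mem (hy k)]
      · push Not at hy
        obtain ⟨k, hk⟩ := hy
        rw [Matrix.det_eq_zero_of_column_eq_zero k fun i => by
          simp [g, Set.indicator_of_notMem hk], Finset.prod_eq_zero (Finset.mem_univ k) (by
            rw [Set.indicator_of_notMem hk, ENNReal.ofReal_zero]), zero_mul, ENNReal.ofReal_zero]
    · rw [Finset.disjoint_left]
      intro x hx hx'
      simp only [Finset.mem_image, Finset.mem_univ, true_and] at hx
      obtain ⟨k, rfl⟩ := hx
      obtain ⟨d, k', -, h⟩ := mem_triSet.mp hx'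
      have := (he _ _ _ _ h).1
      omega

/-- The interlacing relations between consecutive levels above a base row of length `n + 1`. -/
def Interlacing (n : ℕ) (e : ℕ → ℕ → δ) (X : δ → ℝ) : Prop :=
  ∀ d k, d + k < n → X (e (d + 1) k) ∈ Set.Ioo (X (e d k)) (X (e d (k + 1)))

lemma interlacing_succ {n : ℕ} {e : ℕ → ℕ → δ} {X : δ → ℝ} : Interlacing (n + 1) e X ↔
    (∀ k : Fin (n + 1), X (e 1 k) ∈ Set.Ioo (X (e 0 k)) (X (e 0 (k + 1)))) ∧
      Interlacing n (fun d => e (d + 1)) X := by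
  constructor
  · intro h
    exact ⟨fun k => h 0 k (by omega), fun d k hdk => h (d + 1) k (by omega)⟩
  · rintro ⟨h0, h1⟩ d k hdk
    rcases d with _ | d
    · exact h0 ⟨k, by omega⟩
    · exact h1 d k (by omega)

lemma triWeight_of_not_interlacing {n : ℕ} {e : ℕ → ℕ → δ} {W : ℕ → ℝ → ℝ} {X : δ → ℝ}
    (h : ¬ Interlacing n e X) : triWeight n e W X = 0 := by
  induction n generalizing e W with
  | zero => exact absurd (fun d k hdk => by omega) h
  | succ n ih =>
    rw [interlacing_succ, not_and_or] at h
    rcases h with h | h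
    · push Not at h
      obtain ⟨k, hk⟩ := h
      rw [triWeight, Finset.prod_eq_zero (Finset.mem_univ k) (by
            rw [Set.indicator_of_notMem hk, ENNReal.ofReal_zero]), zero_mul]
    · rw [triWeight, ih h, mul_zero]

lemma triWeight_of_interlacing [DecidableEq δ] {n : ℕ} {e : ℕ → ℕ → δ} {W : ℕ → ℝ → ℝ} {X : δ → ℝ}
    (he : ∀ d k d' k', e d k = e d' k' → d = d' ∧ k = k') (h : Interlacing n e X)
    {w : δ → ℝ → ℝ} (hw : ∀ d k, w (e (d + 1) k) = W (d + 1)) :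
    triWeight n e W X = ∏ x ∈ triSet n e, ENNReal.ofReal (w x (X x)) := by
  induction n generalizing e W with
  | zero => simp [triWeight, triSet]
  | succ n ih =>
    rw [interlacing_succ] at h
    rw [triWeight, triSet, Finset.prod_union, Finset.prod_image,
      ih (fun d k d' k' h => by simpa using he _ _ _ _ h) h.2 (fun d k => hw _ _)]
    · congr 1
      exact Finset.prod_congr rfl fun k _ => by rw [Set.indicator_of_mem (h.1 k), hw 0 k]
    · intro k _ k' _ h
      exact Fin.ext (he _ _ _ _ h).2
    · rw [Finset.disjoint_left]
      intro x hx hx'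
      simp only [Finset.mem_image, Finset.mem_univ, true_and] at hx
      obtain ⟨k, rfl⟩ := hx
      obtain ⟨d, k', -, h⟩ := mem_triSet.mp hx'
      have := (he _ _ _ _ h).1
      omega

end Marginal

/-! ### Andréief's identity on the Weyl chamber -/

section Andreief

variable {n : ℕ} {μ : Measure ℝ} [SigmaFinite μ] {φ ψ : ℕ → ℝ → ℝ} {w : ℝ → ℝ}

/-- The density of a biorthogonal ensemble. -/
def biorthDensity (n : ℕ) (φ ψ : ℕ → ℝ → ℝ) (w : ℝ → ℝ) (x : Fin n → ℝ) : ℝ :=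
  (Matrix.of fun i j : Fin n => φ i (x j)).det * (Matrix.of fun i j : Fin n => ψ i (x j)).det *
    ∏ j, w (x j)

lemma biorthDensity_eq_sum (x : Fin n → ℝ) : biorthDensity n φ ψ w x =
    ∑ σ : Equiv.Perm (Fin n), (Equiv.Perm.sign σ : ℝ) *
      (Matrix.of fun i j : Fin n => φ (σ j) (x j) * ψ i (x j) * w (x j)).det := by
  rw [biorthDensity, Matrix.det_apply' (Matrix.of fun i j : Fin n => φ i (x j)), Finset.sum_mul,
    Finset.sum_mul]
  refine Finset.sum_congr rfl fun σ _ => ?_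
  have h := Matrix.det_mul_row (fun j => φ (σ j) (x j) * w (x j))
    (Matrix.of fun i j : Fin n => ψ i (x j))
  have h2 : (Matrix.of fun i j : Fin n => φ (σ j) (x j) * ψ i (x j) * w (x j)) =
      Matrix.of fun i j : Fin n => (φ (σ j) (x j) * w (x j)) *
        (Matrix.of fun i j : Fin n => ψ i (x j)) i j := by
    ext i j; simp only [Matrix.of_apply]; ring
  rw [h2, h, Finset.prod_mul_distrib]
  simp only [Matrix.of_apply]
  ring

lemma integrable_biorthDensity (hint : ∀ i j, Integrable (fun x => φ i x * ψ j x * w x) μ) :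
    Integrable (biorthDensity n φ ψ w) (Measure.pi fun _ => μ) := by
  have : biorthDensity n φ ψ w = fun x => _ := funext biorthDensity_eq_sum
  rw [this]
  refine integrable_finsetSum _ fun σ _ => ?_
  exact (integrable_det (g := fun i j y => φ (σ j) y * ψ i y * w y) fun i j => hint _ _).const_mul _

lemma integral_biorthDensity (hint : ∀ i j, Integrable (fun x => φ i x * ψ j x * w x) μ) :
    ∫ x, biorthDensity n φ ψ w x ∂(Measure.pi fun _ => μ) =
      n.factorial * (Matrix.of fun i j : Fin n => ∫ x, φ i x * ψ j x * w x ∂μ).det := by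
  simp only [biorthDensity_eq_sum]
  rw [integral_finsetSum]
  · have hterm : ∀ σ : Equiv.Perm (Fin n), ∫ x : Fin n → ℝ, (Equiv.Perm.sign σ : ℝ) *
        (Matrix.of fun i j : Fin n => φ (σ j) (x j) * ψ i (x j) * w (x j)).det
          ∂(Measure.pi fun _ => μ) =
        (Matrix.of fun i j : Fin n => ∫ x, φ i x * ψ j x * w x ∂μ).det := by
      intro σ
      rw [integral_const_mul,
        integral_det (g := fun i j y => φ (σ j) y * ψ i y * w y) fun i j => hint _ _]
      have h1 : (Matrix.of fun i j : Fin n => ∫ x, φ (σ j) x * ψ i x * w x ∂μ) =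
          (Matrix.of fun i j : Fin n => ∫ x, φ i x * ψ j x * w x ∂μ).transpose.submatrix id σ := by
        ext i j; rfl
      rw [h1, Matrix.det_permute', Matrix.det_transpose, ← mul_assoc, ← Int.cast_mul,
        ← Units.val_mul, Int.units_mul_self, Units.val_one, Int.cast_one, one_mul]
    simp only [hterm, Finset.sum_const, Finset.card_univ, Fintype.card_perm, Fintype.card_fin,
      nsmul_eq_mul]
  · intro σ _
    exact (integrable_det (g := fun i j y => φ (σ j) y * ψ i y * w y)
      fun i j => hint _ _).const_mul _

lemma measurableSet_strictMono : MeasurableSet {x : Fin n → ℝ | StrictMono x} := by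
  have : {x : Fin n → ℝ | StrictMono x} =
      ⋂ i : Fin n, ⋂ j : Fin n, {x | i < j → x i < x j} := by
    ext x; simp [StrictMono]
  rw [this]
  refine MeasurableSet.iInter fun i => MeasurableSet.iInter fun j => ?_
  by_cases h : i < j
  · simpa [h] using measurableSet_lt (measurable_pi_apply i) (measurable_pi_apply j)
  · simp [h]

lemma biorthDensity_comp_perm (x : Fin n → ℝ) (σ : Equiv.Perm (Fin n)) :
    biorthDensity n φ ψ w (x ∘ σ) = biorthDensity n φ ψ w x := by
  have h : ∀ f : ℕ → ℝ → ℝ, (Matrix.of fun i j : Fin n => f i ((x ∘ σ) j)).det =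
      Equiv.Perm.sign σ * (Matrix.of fun i j : Fin n => f i (x j)).det := by
    intro f
    rw [← Matrix.det_permute']
    rfl
  rw [biorthDensity, biorthDensity, h, h]
  have h2 : ((Equiv.Perm.sign σ : ℤ) : ℝ) * ((Equiv.Perm.sign σ : ℤ) : ℝ) = 1 := by
    rw [← Int.cast_mul, ← Units.val_mul, Int.units_mul_self, Units.val_one, Int.cast_one]
  have h3 : ∏ j, w ((x ∘ σ) j) = ∏ j, w (x j) := Equiv.prod_comp σ fun j => w (x j)
  rw [h3]
  linear_combination ((Matrix.of fun i j : Fin n => φ i (x j)).det *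
    (Matrix.of fun i j : Fin n => ψ i (x j)).det * ∏ j, w (x j)) * h2

/-- **Andréief's identity**: the integral of the density over the ordered configurations.  The
density is symmetric and vanishes on configurations with coinciding points, so each of the `n!`
orderings contributes the same amount. -/
lemma setIntegral_strictMono_biorthDensity
    (hint : ∀ i j, Integrable (fun x => φ i x * ψ j x * w x) μ) :
    ∫ x in {x | StrictMono x}, biorthDensity n φ ψ w x ∂(Measure.pi fun _ => μ) =
      (Matrix.of fun i j : Fin n => ∫ x, φ i x * ψ j x * w x ∂μ).det := by
  set g := biorthDensity n φ ψ w with hg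
  set A : Set (Fin n → ℝ) := {x | StrictMono x} with hA
  -- a configuration without coinciding points is sorted by exactly one permutation
  have hpt : ∀ x, g x = ∑ σ : Equiv.Perm (Fin n), A.indicator g (x ∘ σ) := by
    intro x
    by_cases hx : Function.Injective x
    · have hsort : x ∘ Tuple.sort x ∈ A :=
        (Tuple.monotone_sort x).strictMono_of_injective (hx.comp (Tuple.sort x).injective)
      rw [Finset.sum_eq_single (Tuple.sort x)]
      · rw [Set.indicator_of_mem hsort, hg, biorthDensity_comp_perm]
      · intro σ _ hσ
        refine Set.indicator_of_notMem (fun h => hσ ?_) _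
        have h1 : StrictMono (x ∘ σ) := h
        have h2 := Tuple.unique_monotone h1.monotone (Tuple.monotone_sort x)
        ext i
        exact congrArg Fin.val (hx (congrFun h2 i))
      · simp
    · have h0 : g x = 0 := by
        rw [Function.Injective] at hx
        push Not at hx
        obtain ⟨i, j, hij, hne⟩ := hx
        rw [hg, biorthDensity, Matrix.det_zero_of_column_eq hne fun k => by simp [hij], zero_mul,
          zero_mul]
      rw [h0, eq_comm]
      refine Finset.sum_eq_zero fun σ _ => Set.indicator_of_notMem (fun h => hx ?_) _
      have h1 : Function.Injective (x ∘ σ) := StrictMono.injective h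
      simpa using h1
  have hgi : Integrable g (Measure.pi fun _ => μ) := integrable_biorthDensity hint
  have hAm : MeasurableSet A := measurableSet_strictMono
  have hmp : ∀ σ : Equiv.Perm (Fin n), MeasurePreserving
      (MeasurableEquiv.piCongrLeft (fun _ : Fin n => ℝ) σ.symm)
      (Measure.pi fun _ => μ) (Measure.pi fun _ => μ) := fun σ =>
    measurePreserving_piCongrLeft (fun _ => μ) σ.symm
  have hfun : ∀ (σ : Equiv.Perm (Fin n)) (x : Fin n → ℝ),
      MeasurableEquiv.piCongrLeft (fun _ : Fin n => ℝ) σ.symm x = x ∘ σ := by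
    intro σ x
    ext i
    have := Equiv.piCongrLeft_apply_apply (fun _ : Fin n => ℝ) σ.symm x (σ i)
    rw [Equiv.symm_apply_apply] at this
    exact this
  have hσ : ∀ σ : Equiv.Perm (Fin n), ∫ x, A.indicator g (x ∘ σ) ∂(Measure.pi fun _ => μ) =
      ∫ x in A, g x ∂(Measure.pi fun _ => μ) := by
    intro σ
    rw [← integral_indicator hAm, ← (hmp σ).integral_comp' (A.indicator g)]
    simp only [hfun]
  have hσi : ∀ σ : Equiv.Perm (Fin n),
      Integrable (fun x => A.indicator g (x ∘ σ)) (Measure.pi fun _ => μ) := by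
    intro σ
    have := (hmp σ).integrable_comp_emb (MeasurableEquiv.measurableEmbedding _)
      (g := A.indicator g)
    have h2 := this.mpr (hgi.indicator hAm)
    simpa only [Function.comp_def, hfun] using h2
  have h1 := integral_biorthDensity (n := n) hint
  rw [← hg, integral_congr_ae (Eventually.of_forall hpt), integral_finsetSum _ fun σ _ => hσi σ,
    Finset.sum_congr rfl fun σ _ => hσ σ, Finset.sum_const, Finset.card_univ, Fintype.card_perm,
    Fintype.card_fin, nsmul_eq_mul] at h1
  exact mul_left_cancel₀ (by positivity) h1

end Andreief

/-! ### The total weight of the interlacing arrays -/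

/-- Levels of the upper triangle: level `d` is the diagonal `j - i = d`. -/
def upLevel (d k : ℕ) : ℕ × ℕ := (k, k + d)

/-- Levels of the lower triangle: level `d` is the diagonal `i - j = d`. -/
def lowLevel (d k : ℕ) : ℕ × ℕ := (k + d, k)

lemma upLevel_injective (d k d' k' : ℕ) (h : upLevel d k = upLevel d' k') : d = d' ∧ k = k' := by
  simp only [upLevel, Prod.mk.injEq] at h; omega

lemma lowLevel_injective (d k d' k' : ℕ) (h : lowLevel d k = lowLevel d' k') :
    d = d' ∧ k = k' := by
  simp only [lowLevel, Prod.mk.injEq] at h; omega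

/-- The weight of the entry in position `(i, j)`, depending on its diagonal only. -/
def entryWeight (WL WU : ℕ → ℝ → ℝ) (W0 : ℝ → ℝ) (p : ℕ × ℕ) : ℝ → ℝ :=
  if p.2 < p.1 then WL (p.1 - p.2) else if p.1 < p.2 then WU (p.2 - p.1) else W0

/-- The ordered configurations in `(0, 1)`. -/
def chamber (n : ℕ) : Set (Fin n → ℝ) := {x | StrictMono x ∧ ∀ k, x k ∈ Set.Ioo (0 : ℝ) 1}

lemma mem_mbArrays_iff {n : ℕ} (X : ℕ × ℕ → ℝ) :
    (fun i j : Fin (n + 1) => X (i, j)) ∈ mbArrays (n + 1) (n + 1) ↔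
      (fun k : Fin (n + 1) => X (k, k)) ∈ chamber (n + 1) ∧ Interlacing n upLevel X ∧
        Interlacing n lowLevel X := by
  constructor
  · rintro ⟨h01, hrow, hcol⟩
    refine ⟨⟨fun k l hkl => (hrow k hkl).trans (hcol l hkl), fun k => h01 k k⟩, ?_, ?_⟩
    · intro d k hdk
      have h1 := @hrow ⟨k, by omega⟩ ⟨k + d, by omega⟩ ⟨k + d + 1, by omega⟩ (by simp)
      have h2 := @hcol ⟨k + d + 1, by omega⟩ ⟨k, by omega⟩ ⟨k + 1, by omega⟩ (by simp)
      simp only [upLevel]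
      rw [← add_assoc, show k + 1 + d = k + d + 1 by ring]
      exact ⟨h1, h2⟩
    · intro d k hdk
      have h1 := @hcol ⟨k, by omega⟩ ⟨k + d, by omega⟩ ⟨k + d + 1, by omega⟩ (by simp)
      have h2 := @hrow ⟨k + d + 1, by omega⟩ ⟨k, by omega⟩ ⟨k + 1, by omega⟩ (by simp)
      simp only [lowLevel]
      rw [← add_assoc, show k + 1 + d = k + d + 1 by ring]
      exact ⟨h1, h2⟩
  · rintro ⟨⟨-, h01⟩, hup, hlow⟩
    have hrow : ∀ i : Fin (n + 1), StrictMono fun j : Fin (n + 1) => X (i, j) := by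
      intro i
      rw [Fin.strictMono_iff_lt_succ]
      intro j
      simp only [Fin.val_castSucc, Fin.val_succ]
      by_cases hij : (i : ℕ) ≤ j
      · have := (hup (j - i) i (by omega)).1
        simp only [upLevel] at this
        rwa [show (i : ℕ) + (j - i) = j by omega, show (i : ℕ) + (j - i + 1) = j + 1 by omega]
          at this
      · have := (hlow (i - j - 1) j (by omega)).2
        simp only [lowLevel] at this
        rwa [show (j : ℕ) + (i - j - 1 + 1) = i by omega,
          show (j : ℕ) + 1 + (i - j - 1) = i by omega] at this
    have hcol : ∀ j : Fin (n + 1), StrictMono fun i : Fin (n + 1) => X (i, j) := by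
      intro i
      rw [Fin.strictMono_iff_lt_succ]
      intro j
      simp only [Fin.val_castSucc, Fin.val_succ]
      by_cases hij : (i : ℕ) ≤ j
      · have := (hlow (j - i) i (by omega)).1
        simp only [lowLevel] at this
        rwa [show (i : ℕ) + (j - i) = j by omega, show (i : ℕ) + (j - i + 1) = j + 1 by omega]
          at this
      · have := (hup (i - j - 1) j (by omega)).2
        simp only [upLevel] at this
        rwa [show (j : ℕ) + (i - j - 1 + 1) = i by omega,
          show (j : ℕ) + 1 + (i - j - 1) = i by omega] at this
    refine ⟨fun i j => ⟨?_, ?_⟩, hrow, hcol⟩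
    · exact (h01 0).1.trans_le (((hcol 0).monotone (Fin.zero_le i)).trans
        ((hrow i).monotone (Fin.zero_le j)))
    · exact (((hrow i).monotone (Fin.le_last j)).trans
        ((hcol (Fin.last n)).monotone (Fin.le_last i))).trans_lt (h01 (Fin.last n)).2

/-- The diagonal factor of the weight of an array. -/
def diagWeight (n : ℕ) (W0 : ℝ → ℝ) (X : ℕ × ℕ → ℝ) : ENNReal :=
  (chamber (n + 1)).indicator (fun x => ∏ k, ENNReal.ofReal (W0 (x k)))
    fun k : Fin (n + 1) => X (k, k)

lemma measurableSet_chamber (n : ℕ) : MeasurableSet (chamber n) := by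
  have : chamber n = {x | StrictMono x} ∩ Set.univ.pi fun _ => Set.Ioo 0 1 := by
    ext x; simp [chamber, Set.mem_pi]
  rw [this]
  exact measurableSet_strictMono.inter (MeasurableSet.univ_pi fun _ => measurableSet_Ioo)

lemma measurable_diagWeight (n : ℕ) {W0 : ℝ → ℝ} (h : Measurable W0) :
    Measurable (diagWeight n W0) := by
  refine Measurable.comp (g := (chamber (n + 1)).indicator
    (fun x => ∏ k, ENNReal.ofReal (W0 (x k)))) (Measurable.indicator ?_ (measurableSet_chamber _))
    (measurable_pi_lambda _ fun k => measurable_pi_apply _)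
  exact Finset.measurable_fun_prod _ fun k _ =>
    ENNReal.measurable_ofReal.comp (h.comp (measurable_pi_apply k))

/-- All positions of the array. -/
def gridSet (n : ℕ) : Finset (ℕ × ℕ) :=
  (Finset.univ.image fun p : Fin (n + 1) × Fin (n + 1) => ((p.1 : ℕ), (p.2 : ℕ)))

/-- The positions on the main diagonal of the array. -/
def diagSet (n : ℕ) : Finset (ℕ × ℕ) :=
  Finset.univ.image fun k : Fin (n + 1) => ((k : ℕ), (k : ℕ))

lemma gridSet_eq (n : ℕ) :
    gridSet n = diagSet n ∪ (triSet n upLevel ∪ triSet n lowLevel) := by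
  ext ⟨i, j⟩
  simp only [gridSet, diagSet, Finset.mem_union, Finset.mem_image, Finset.mem_univ, true_and,
    mem_triSet, upLevel, lowLevel, Prod.mk.injEq, Prod.exists]
  constructor
  · rintro ⟨a, b, rfl, rfl⟩
    rcases lt_trichotomy (a : ℕ) b with h | h | h
    · exact Or.inr (Or.inl ⟨b - a - 1, a, by omega, rfl, by omega⟩)
    · exact Or.inl ⟨a, rfl, h⟩
    · exact Or.inr (Or.inr ⟨a - b - 1, b, by omega, by omega, rfl⟩)
  · rintro (⟨k, rfl, rfl⟩ | ⟨d, k, h, rfl, rfl⟩ | ⟨d, k, h, rfl, rfl⟩)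
    · exact ⟨k, k, rfl, rfl⟩
    · exact ⟨⟨i, by omega⟩, ⟨i + (d + 1), by omega⟩, rfl, rfl⟩
    · exact ⟨⟨j + (d + 1), by omega⟩, ⟨j, by omega⟩, rfl, rfl⟩

lemma disjoint_upper_lower (n : ℕ) : Disjoint (triSet n upLevel) (triSet n lowLevel) := by
  rw [Finset.disjoint_left]
  rintro ⟨i, j⟩ h h'
  simp only [mem_triSet, upLevel, lowLevel, Prod.mk.injEq] at h h'
  obtain ⟨d, k, -, h1, h2⟩ := h
  obtain ⟨d', k', -, h3, h4⟩ := h'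
  omega

lemma disjoint_diag (n : ℕ) : Disjoint (diagSet n) (triSet n upLevel ∪ triSet n lowLevel) := by
  rw [Finset.disjoint_left]
  rintro ⟨i, j⟩ h h'
  simp only [diagSet, Finset.mem_image, Finset.mem_univ, true_and, Finset.mem_union, mem_triSet,
    upLevel, lowLevel, Prod.mk.injEq] at h h'
  obtain ⟨k, h1, h2⟩ := h
  rcases h' with ⟨d, k', -, h3, h4⟩ | ⟨d, k', -, h3, h4⟩ <;> omega

lemma array_weight_eq (n : ℕ) (WL WU : ℕ → ℝ → ℝ) (W0 : ℝ → ℝ) (X : ℕ × ℕ → ℝ) :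
    (mbArrays (n + 1) (n + 1)).indicator
      (fun Y => ∏ i : Fin (n + 1), ∏ j : Fin (n + 1), ENNReal.ofReal (entryWeight WL WU W0 (i, j) (Y i j)))
        (fun i j => X (i, j)) =
      diagWeight n W0 X * (triWeight n upLevel WU X * triWeight n lowLevel WL X) := by
  by_cases hX : (fun i j : Fin (n + 1) => X (i, j)) ∈ mbArrays (n + 1) (n + 1)
  · rw [Set.indicator_of_mem hX]
    obtain ⟨h0, hU, hL⟩ := (mem_mbArrays_iff X).mp hX
    rw [diagWeight, Set.indicator_of_mem h0,
      triWeight_of_interlacing upLevel_injective hU (w := entryWeight WL WU W0),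
      triWeight_of_interlacing lowLevel_injective hL (w := entryWeight WL WU W0),
      ← Finset.prod_union (disjoint_upper_lower n)]
    · have hd : ∏ k : Fin (n + 1), ENNReal.ofReal (W0 (X (k, k))) =
          ∏ p ∈ diagSet n, ENNReal.ofReal (entryWeight WL WU W0 p (X p)) := by
        rw [diagSet, Finset.prod_image]
        · simp [entryWeight]
        · intro k _ l _ h
          exact Fin.ext (Prod.mk.inj h).1
      rw [hd, ← Finset.prod_union (disjoint_diag n), ← gridSet_eq, gridSet, Finset.prod_image,
        ← Finset.univ_product_univ, Finset.prod_product]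
      rintro ⟨a, b⟩ _ ⟨c, d⟩ _ h
      simp only [Prod.mk.injEq] at h
      exact Prod.ext (Fin.ext h.1) (Fin.ext h.2)
    · intro d k
      simp [entryWeight, lowLevel]
    · intro d k
      simp [entryWeight, upLevel]
  · rw [Set.indicator_of_notMem hX]
    rw [mem_mbArrays_iff, not_and_or, not_and_or] at hX
    rcases hX with h | h | h
    · rw [diagWeight, Set.indicator_of_notMem h, zero_mul]
    · rw [triWeight_of_not_interlacing h, zero_mul, mul_zero]
    · rw [triWeight_of_not_interlacing h, mul_zero, mul_zero]

lemma measurePreserving_uncurry (ι κ : Type*) [Fintype ι] [Fintype κ] :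
    MeasurePreserving (MeasurableEquiv.curry ι κ ℝ).symm := by
  refine ⟨(MeasurableEquiv.curry ι κ ℝ).symm.measurable, ?_⟩
  rw [volume_pi (ι := ι × κ)]
  refine (Measure.pi_eq fun s hs => ?_).symm
  rw [MeasurableEquiv.map_apply]
  have : (MeasurableEquiv.curry ι κ ℝ).symm ⁻¹' (Set.univ.pi s) =
      Set.univ.pi fun i => Set.univ.pi fun j => s (i, j) := by
    ext f
    simp [MeasurableEquiv.coe_curry_symm, Set.mem_pi, Function.uncurry]
  rw [this, volume_pi_pi]
  simp only [volume_pi_pi]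
  rw [← Finset.univ_product_univ, Finset.prod_product]

/-- The total weight of the interlacing arrays is a determinant: integrate out the two triangles,
then the diagonal. -/
theorem lintegral_mbArrays (n : ℕ) {WL WU : ℕ → ℝ → ℝ} {W0 : ℝ → ℝ} {φ ψ : ℕ → ℕ → ℝ → ℝ}
    (hWLm : ∀ d, Measurable (WL d)) (hWUm : ∀ d, Measurable (WU d)) (hW0m : Measurable W0)
    (hWL : ∀ d, ∀ y ∈ Set.Ioo (0 : ℝ) 1, 0 ≤ WL d y)
    (hWU : ∀ d, ∀ y ∈ Set.Ioo (0 : ℝ) 1, 0 ≤ WU d y) (hW0 : ∀ y ∈ Set.Ioo (0 : ℝ) 1, 0 ≤ W0 y)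
    (hφ : IsLevelFamily WL φ) (hψ : IsLevelFamily WU ψ)
    (hint : ∀ i j, IntegrableOn (fun x => φ 0 i x * ψ 0 j x * W0 x) (Set.Ioo 0 1)) :
    0 ≤ (Matrix.of fun i j : Fin (n + 1) => ∫ x in Set.Ioo 0 1, φ 0 i x * ψ 0 j x * W0 x).det ∧
    ∫⁻ Y in mbArrays (n + 1) (n + 1),
        ∏ i : Fin (n + 1), ∏ j : Fin (n + 1),
          ENNReal.ofReal (entryWeight WL WU W0 (i, j) (Y i j)) =
      ENNReal.ofReal (Matrix.of fun i j : Fin (n + 1) =>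
        ∫ x in Set.Ioo 0 1, φ 0 i x * ψ 0 j x * W0 x).det := by
  have hentry : ∀ p, Measurable (entryWeight WL WU W0 p) := by
    intro p
    unfold entryWeight
    split_ifs
    · exact hWLm _
    · exact hWUm _
    · exact hW0m
  have harr : MeasurableSet (mbArrays (n + 1) (n + 1)) := by
    have : mbArrays (n + 1) (n + 1) = (⋂ i, ⋂ j, (fun X : Fin (n + 1) → Fin (n + 1) → ℝ => X i j)
        ⁻¹' Set.Ioo 0 1) ∩ ((⋂ i, (fun X => X i) ⁻¹' {x | StrictMono x}) ∩
        (⋂ j, (fun X i => X i j) ⁻¹' {x | StrictMono x})) := by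
      ext X; simp [mbArrays]
    rw [this]
    refine (MeasurableSet.iInter fun i => MeasurableSet.iInter fun j => ?_).inter
      ((MeasurableSet.iInter fun i => ?_).inter (MeasurableSet.iInter fun j => ?_))
    · exact measurableSet_Ioo.preimage ((measurable_pi_apply j).comp (measurable_pi_apply i))
    · exact measurableSet_strictMono.preimage (measurable_pi_apply i)
    · exact measurableSet_strictMono.preimage (measurable_pi_lambda _ fun i =>
        (measurable_pi_apply j).comp (measurable_pi_apply i))
  -- the weight of an array, seen as a function on all positions `ℕ × ℕ`
  let F : (ℕ × ℕ → ℝ) → ENNReal := fun X =>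
    diagWeight n W0 X * (triWeight n upLevel WU X * triWeight n lowLevel WL X)
  have hFm : Measurable F := (measurable_diagWeight n hW0m).mul
    ((measurable_triWeight n _ hWUm).mul (measurable_triWeight n _ hWLm))
  have hgrid : Function.Injective
      fun p : Fin (n + 1) × Fin (n + 1) => ((p.1 : ℕ), (p.2 : ℕ)) := by
    rintro ⟨a, b⟩ ⟨c, d⟩ h
    simp only [Prod.mk.injEq] at h
    exact Prod.ext (Fin.ext h.1) (Fin.ext h.2)
  have hdiag : Function.Injective fun k : Fin (n + 1) => ((k : ℕ), (k : ℕ)) := fun k l h =>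
    Fin.ext (Prod.mk.inj h).1
  have hstep1 : ∫⁻ Y in mbArrays (n + 1) (n + 1),
        ∏ i : Fin (n + 1), ∏ j : Fin (n + 1),
          ENNReal.ofReal (entryWeight WL WU W0 (i, j) (Y i j)) =
      (∫⋯∫⁻_gridSet n, F ∂fun _ => volume) 0 := by
    rw [gridSet, lmarginal_image_univ hgrid hFm, ← lintegral_indicator harr,
      (measurePreserving_uncurry (Fin (n + 1)) (Fin (n + 1))).lintegral_map_equiv
        (fun y => F (Function.extend _ y 0))]
    refine lintegral_congr fun Y => ?_
    simp only [F]
    rw [← array_weight_eq]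
    congr 1
    ext i j
    exact (hgrid.extend_apply ((MeasurableEquiv.curry _ _ ℝ).symm Y) 0 (i, j)).symm
  have hlow : ∀ (X : ℕ × ℕ → ℝ), (∫⋯∫⁻_(triSet n upLevel ∪ triSet n lowLevel),
      (fun X => triWeight n upLevel WU X * triWeight n lowLevel WL X) ∂fun _ => volume) X =
      (∫⋯∫⁻_triSet n lowLevel, triWeight n lowLevel WL ∂fun _ => volume) X *
      (∫⋯∫⁻_triSet n upLevel, triWeight n upLevel WU ∂fun _ => volume) X := by
    intro X
    rw [lmarginal_union _ (fun X => triWeight n upLevel WU X * triWeight n lowLevel WL X)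
      ((measurable_triWeight n _ hWUm).mul (measurable_triWeight n _ hWLm))
      (disjoint_upper_lower n)]
    have h1 := lmarginal_mul_left (triSet n lowLevel) (c := triWeight n upLevel WU)
      (measurable_triWeight n lowLevel hWLm) (fun X Y hXY => triWeight_congr fun d k => hXY _ (by
        intro h
        obtain ⟨d', k', -, h⟩ := mem_triSet.mp h
        simp only [upLevel, lowLevel, Prod.mk.injEq] at h
        omega))
    rw [h1]
    simp only [mul_comm (triWeight n upLevel WU _)]
    have h2 := lmarginal_mul_left (triSet n upLevel)
      (c := ∫⋯∫⁻_triSet n lowLevel, triWeight n lowLevel WL ∂fun _ => volume)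
      (measurable_triWeight n upLevel hWUm) (by
        intro X Y hXY
        rw [lmarginal, lmarginal]
        refine lintegral_congr fun y => triWeight_congr fun d k => ?_
        by_cases h : lowLevel d k ∈ triSet n lowLevel
        · simp only [Function.updateFinset_def, dif_pos h]
        · simp only [Function.updateFinset_def, dif_neg h]
          refine hXY _ fun h => ?_
          obtain ⟨d', k', -, h⟩ := mem_triSet.mp h
          simp only [upLevel, lowLevel, Prod.mk.injEq] at h
          omega)
    rw [h2]
  have hstep2 : (∫⋯∫⁻_gridSet n, F ∂fun _ => volume) 0 = ∫⁻ x : Fin (n + 1) → ℝ,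
      ENNReal.ofReal ((chamber (n + 1)).indicator (biorthDensity (n + 1) (φ 0) (ψ 0) W0) x) := by
    rw [gridSet_eq, lmarginal_union _ _ hFm (disjoint_diag n), diagSet,
      lmarginal_image_univ hdiag (Measurable.lmarginal _ hFm)]
    have h1 := lmarginal_mul_left (triSet n upLevel ∪ triSet n lowLevel) (c := diagWeight n W0)
      ((measurable_triWeight n upLevel hWUm).mul (measurable_triWeight n lowLevel hWLm)) (by
        intro X Y hXY
        unfold diagWeight
        congr 1
        ext k
        exact hXY _ (Finset.disjoint_left.mp (disjoint_diag n) (by simp [diagSet])))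
    refine lintegral_congr fun x => ?_
    refine (congrFun h1 _).trans ?_
    simp only [Pi.mul_def]
    rw [hlow]
    set X := Function.extend (fun k : Fin (n + 1) => ((k : ℕ), (k : ℕ))) x 0 with hX
    have hval : ∀ k : Fin (n + 1), X (k, k) = x k := fun k => hdiag.extend_apply x 0 k
    rw [diagWeight]
    simp only [hval]
    by_cases hx : x ∈ chamber (n + 1)
    · have hval' : ∀ k (hk : k < n + 1), X (k, k) = x ⟨k, hk⟩ := fun k hk => hval ⟨k, hk⟩
      have hu : ∀ k, upLevel 0 k = (k, k) := fun k => rfl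
      have hl : ∀ k, lowLevel 0 k = (k, k) := fun k => rfl
      have h01 : ∀ k ≤ n, X (k, k) ∈ Set.Ioo (0 : ℝ) 1 := fun k hk => by
        rw [hval' k (by omega)]; exact hx.2 _
      have hmo : ∀ k < n, X (k, k) < X (k + 1, k + 1) := fun k hk => by
        rw [hval' k (by omega), hval' (k + 1) (by omega)]; exact hx.1 (by simp)
      have hU := lmarginal_triWeight n upLevel WU ψ upLevel_injective hWUm hWU hψ X
        (by simpa only [hu] using h01) (by simpa only [hu] using hmo)
      have hL := lmarginal_triWeight n lowLevel WL φ lowLevel_injective hWLm hWL hφ X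
        (by simpa only [hl] using h01) (by simpa only [hl] using hmo)
      simp only [hu, hl, hval] at hU hL
      rw [hU.2, hL.2, Set.indicator_of_mem hx, Set.indicator_of_mem hx, biorthDensity,
        ENNReal.ofReal_mul (mul_nonneg hL.1 hU.1), ENNReal.ofReal_mul hL.1,
        ENNReal.ofReal_prod_of_nonneg fun k _ => hW0 _ (hx.2 k), mul_comm]
    · rw [Set.indicator_of_notMem hx, Set.indicator_of_notMem hx, zero_mul, ENNReal.ofReal_zero]
  have hnn : ∀ x ∈ chamber (n + 1), 0 ≤ biorthDensity (n + 1) (φ 0) (ψ 0) W0 x := by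
    intro x hx
    -- extend the configuration to the diagonal of an array to reuse the positivity of determinants
    set X := Function.extend (fun k : Fin (n + 1) => ((k : ℕ), (k : ℕ))) x 0 with hX
    have hval : ∀ k : Fin (n + 1), X (k, k) = x k := fun k => hdiag.extend_apply x 0 k
    have hval' : ∀ k (hk : k < n + 1), X (k, k) = x ⟨k, hk⟩ := fun k hk => hval ⟨k, hk⟩
    have hu : ∀ k, upLevel 0 k = (k, k) := fun k => rfl
    have hl : ∀ k, lowLevel 0 k = (k, k) := fun k => rfl
    have h01 : ∀ k ≤ n, X (k, k) ∈ Set.Ioo (0 : ℝ) 1 := fun k hk => by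
      rw [hval' k (by omega)]; exact hx.2 _
    have hmo : ∀ k < n, X (k, k) < X (k + 1, k + 1) := fun k hk => by
      rw [hval' k (by omega), hval' (k + 1) (by omega)]; exact hx.1 (by simp)
    have hU := (lmarginal_triWeight n upLevel WU ψ upLevel_injective hWUm hWU hψ X
      (by simpa only [hu] using h01) (by simpa only [hu] using hmo)).1
    have hL := (lmarginal_triWeight n lowLevel WL φ lowLevel_injective hWLm hWL hφ X
      (by simpa only [hl] using h01) (by simpa only [hl] using hmo)).1
    simp only [hu, hl, hval] at hU hL
    exact mul_nonneg (mul_nonneg hL hU) (Finset.prod_nonneg fun k _ => hW0 _ (hx.2 k))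
  have hA := setIntegral_strictMono_biorthDensity (n := n + 1) (μ := volume.restrict (Set.Ioo 0 1))
    (φ := φ 0) (ψ := ψ 0) (w := W0) hint
  have hI := integrable_biorthDensity (n := n + 1) (μ := volume.restrict (Set.Ioo 0 1))
    (φ := φ 0) (ψ := ψ 0) (w := W0) hint
  have hch : chamber (n + 1) = {x | StrictMono x} ∩ Set.univ.pi fun _ => Set.Ioo 0 1 := by
    ext x; simp [chamber, Set.mem_pi]
  have hA' : ∫ x in chamber (n + 1), biorthDensity (n + 1) (φ 0) (ψ 0) W0 x =
      (Matrix.of fun i j : Fin (n + 1) => ∫ x in Set.Ioo 0 1, φ 0 i x * ψ 0 j x * W0 x).det := by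
    rw [← hA, ← Measure.restrict_pi_pi, ← volume_pi,
      Measure.restrict_restrict measurableSet_strictMono, ← hch]
  have hI' : IntegrableOn (biorthDensity (n + 1) (φ 0) (ψ 0) W0) (chamber (n + 1)) := by
    rw [← Measure.restrict_pi_pi, ← volume_pi] at hI
    rw [hch, Set.inter_comm]
    exact hI.mono_measure (Measure.restrict_mono Set.inter_subset_left le_rfl)
  rw [← hA']
  refine ⟨setIntegral_nonneg (measurableSet_chamber _) hnn, ?_⟩
  rw [hstep1, hstep2, ← integral_indicator (measurableSet_chamber _),
    ofReal_integral_eq_lintegral_ofReal]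
  · exact (integrable_indicator_iff (measurableSet_chamber _)).mpr hI'
  · exact Eventually.of_forall fun x => Set.indicator_nonneg hnn x

/-! ### Power weights with a cut-off, and their moments -/

open Classical in
/-- The power `y ^ c`, set to zero for `y ≤ s` if `cut` holds. -/
def cutPow (cut : Prop) (s c y : ℝ) : ℝ :=
  if cut then (Set.Ioi s).indicator (fun y => y ^ c) y else y ^ c

lemma measurable_cutPow (cut : Prop) (s c : ℝ) : Measurable (cutPow cut s c) := by
  unfold cutPow
  split_ifs
  · exact (by fun_prop : Measurable fun y : ℝ => y ^ c).indicator measurableSet_Ioi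
  · fun_prop

lemma cutPow_nonneg (cut : Prop) (s c : ℝ) {y : ℝ} (hy : 0 < y) : 0 ≤ cutPow cut s c y := by
  unfold cutPow
  split_ifs
  · by_cases hs : y ∈ Set.Ioi s
    · rw [Set.indicator_of_mem hs]; positivity
    · rw [Set.indicator_of_notMem hs]
  · positivity

lemma cutPow_le (cut : Prop) (s c : ℝ) {y : ℝ} (hy : 0 < y) : cutPow cut s c y ≤ y ^ c := by
  unfold cutPow
  split_ifs
  · by_cases hs : y ∈ Set.Ioi s
    · rw [Set.indicator_of_mem hs]
    · rw [Set.indicator_of_notMem hs]; positivity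
  · rfl

lemma cutPow_mul_rpow (cut : Prop) (s c c' : ℝ) {y : ℝ} (hy : 0 < y) :
    cutPow cut s c y * y ^ c' = cutPow cut s (c + c') y := by
  unfold cutPow
  split_ifs
  · by_cases hs : y ∈ Set.Ioi s
    · rw [Set.indicator_of_mem hs, Set.indicator_of_mem hs, Real.rpow_add hy]
    · rw [Set.indicator_of_notMem hs, Set.indicator_of_notMem hs, zero_mul]
  · rw [Real.rpow_add hy]

lemma integrableOn_cutPow (cut : Prop) (s : ℝ) {c : ℝ} (hc : -1 < c) :
    IntegrableOn (cutPow cut s c) (Set.Ioo 0 1) := by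
  have h := (intervalIntegral.integrableOn_Ioo_rpow_iff (s := c) (t := 1) one_pos).mpr hc
  refine Integrable.mono' h (measurable_cutPow _ _ _).aestronglyMeasurable ?_
  filter_upwards [ae_restrict_mem measurableSet_Ioo] with y hy
  rw [Real.norm_of_nonneg (cutPow_nonneg _ _ _ hy.1)]
  exact cutPow_le _ _ _ hy.1

/-- The functions obtained from the powers `x ^ (θ i) / (θ ^ i i!)`, cut off at `s`, by `m`-fold
integration against `y ^ (θ - 1)`.  The antiderivatives are normalised to vanish at `1`, which
makes their moments products. -/
def cutFamily (θ s : ℝ) : ℕ → ℕ → ℝ → ℝ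
  | 0, i, x => x ^ (θ * i) / (θ ^ i * i.factorial)
  | _ + 1, 0, _ => 1
  | m + 1, i + 1, x => -∫ y in Set.Ioo x 1, cutFamily θ s m i y * cutPow (m = 0) s (θ - 1) y

lemma measurable_cutFamily (θ s : ℝ) (m i : ℕ) : Measurable (cutFamily θ s m i) := by
  induction m generalizing i with
  | zero =>
    have : cutFamily θ s 0 i = fun x => x ^ (θ * i) / (θ ^ i * i.factorial) := rfl
    rw [this]; fun_prop
  | succ m ih =>
    rcases i with _ | i
    · exact measurable_const (a := (1 : ℝ))
    · have hf : Measurable fun y => cutFamily θ s m i y * cutPow (m = 0) s (θ - 1) y :=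
        (ih i).mul (measurable_cutPow _ _ _)
      have h1 : cutFamily θ s (m + 1) (i + 1) = fun x => -∫ y,
          {p : ℝ × ℝ | p.2 ∈ Set.Ioo p.1 1}.indicator
            (fun p => cutFamily θ s m i p.2 * cutPow (m = 0) s (θ - 1) p.2) (x, y) := by
        funext x
        rw [cutFamily, ← integral_indicator measurableSet_Ioo]
        rfl
      rw [h1]
      refine Measurable.neg ?_
      refine StronglyMeasurable.measurable (StronglyMeasurable.integral_prod_right' (ν := volume)
        (Measurable.stronglyMeasurable ?_))
      refine (hf.comp measurable_snd).indicator ?_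
      exact (measurableSet_lt measurable_fst measurable_snd).inter
        (measurableSet_lt measurable_snd measurable_const)

lemma exists_abs_cutFamily_le {θ : ℝ} (hθ : 0 < θ) (s : ℝ) (m i : ℕ) :
    ∃ C, ∀ x ∈ Set.Ioo (0 : ℝ) 1, |cutFamily θ s m i x| ≤ C := by
  induction m generalizing i with
  | zero =>
    refine ⟨1 / (θ ^ i * i.factorial), fun x hx => ?_⟩
    rw [cutFamily, abs_of_nonneg (by have := hx.1; positivity)]
    gcongr
    exact Real.rpow_le_one hx.1.le hx.2.le (by positivity)
  | succ m ih =>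
    rcases i with _ | i
    · exact ⟨1, fun x _ => by simp [cutFamily]⟩
    · obtain ⟨C, hC⟩ := ih i
      refine ⟨∫ y in Set.Ioo 0 1, C * cutPow (m = 0) s (θ - 1) y, fun x hx => ?_⟩
      have hI : IntegrableOn (fun y => C * cutPow (m = 0) s (θ - 1) y) (Set.Ioo 0 1) :=
        (integrableOn_cutPow (m = 0) s (c := θ - 1) (by linarith)).const_mul C
      have hsub : Set.Ioo x 1 ⊆ Set.Ioo 0 1 := Set.Ioo_subset_Ioo_left hx.1.le
      have hC0 : 0 ≤ C := (abs_nonneg _).trans (hC x hx)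
      rw [cutFamily, abs_neg]
      refine (norm_integral_le_of_norm_le (f := fun y => cutFamily θ s m i y *
        cutPow (m = 0) s (θ - 1) y) (hI.mono_set hsub) ?_).trans ?_
      · filter_upwards [ae_restrict_mem measurableSet_Ioo] with y hy
        rw [norm_mul, Real.norm_of_nonneg (cutPow_nonneg _ _ _ (hsub hy).1)]
        exact mul_le_mul_of_nonneg_right (hC y (hsub hy)) (cutPow_nonneg _ _ _ (hsub hy).1)
      · refine setIntegral_mono_set hI ?_ hsub.eventuallyLE
        filter_upwards [ae_restrict_mem measurableSet_Ioo] with y hy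
        exact mul_nonneg hC0 (cutPow_nonneg _ _ _ hy.1)

lemma integrableOn_cutFamily {θ : ℝ} (hθ : 0 < θ) (s : ℝ) (m i : ℕ) (cut : Prop) {c : ℝ}
    (hc : -1 < c) :
    IntegrableOn (fun y => cutFamily θ s m i y * cutPow cut s c y) (Set.Ioo 0 1) := by
  obtain ⟨C, hC⟩ := exists_abs_cutFamily_le hθ s m i
  refine Integrable.bdd_mul (c := C) (integrableOn_cutPow cut s hc)
    (measurable_cutFamily _ _ _ _).aestronglyMeasurable ?_
  filter_upwards [ae_restrict_mem measurableSet_Ioo] with y hy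
  exact hC y hy

lemma setIntegral_Ioo_rpow {c a b : ℝ} (hc : 0 < c) (hab : a ≤ b) :
    ∫ x in Set.Ioo a b, x ^ (c - 1) = (b ^ c - a ^ c) / c := by
  rw [← integral_Ioc_eq_integral_Ioo, ← intervalIntegral.integral_of_le hab,
    integral_rpow (Or.inl (by linarith)), sub_add_cancel]

lemma moment_cutFamily_zero {θ s c : ℝ} (hθ : 0 < θ) (hs : 0 ≤ s) (hs1 : s < 1) (hc : 0 < c)
    (i : ℕ) : ∫ y in Set.Ioo 0 1, cutFamily θ s 0 i y * cutPow (0 = 0) s (c - 1) y =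
      (1 - s ^ (c + θ * i)) / ((c + θ * i) * (θ ^ i * i.factorial)) := by
  have h1 : ∫ y in Set.Ioo 0 1, cutFamily θ s 0 i y * cutPow (0 = 0) s (c - 1) y =
      ∫ y in Set.Ioo 0 1, (Set.Ioi s).indicator
        (fun y => (θ ^ i * i.factorial)⁻¹ * y ^ (c + θ * i - 1)) y := by
    refine setIntegral_congr_fun measurableSet_Ioo fun y hy => ?_
    simp only [cutFamily, cutPow, if_true]
    by_cases h : y ∈ Set.Ioi s
    · rw [Set.indicator_of_mem h, Set.indicator_of_mem h, div_eq_inv_mul, mul_assoc,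
        ← Real.rpow_add hy.1]
      ring_nf
    · rw [Set.indicator_of_notMem h, Set.indicator_of_notMem h, mul_zero]
  rw [h1, setIntegral_indicator measurableSet_Ioi]
  have h2 : Set.Ioo (0 : ℝ) 1 ∩ Set.Ioi s = Set.Ioo s 1 := by
    ext y; simp only [Set.mem_inter_iff, Set.mem_Ioo, Set.mem_Ioi]
    exact ⟨fun h => ⟨h.2, h.1.2⟩, fun h => ⟨⟨hs.trans_lt h.1, h.2⟩, h.1⟩⟩
  rw [h2, integral_const_mul, setIntegral_Ioo_rpow (by positivity) hs1.le, Real.one_rpow]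
  have : c + θ * i ≠ 0 := by positivity
  field_simp

lemma moment_cutFamily_succ_zero {θ s c : ℝ} (hc : 0 < c) (m : ℕ) :
    ∫ y in Set.Ioo 0 1, cutFamily θ s (m + 1) 0 y * cutPow (m + 1 = 0) s (c - 1) y = 1 / c := by
  simp only [cutFamily, cutPow, if_neg (Nat.succ_ne_zero m), one_mul]
  rw [setIntegral_Ioo_rpow hc zero_le_one, Real.one_rpow, Real.zero_rpow hc.ne', sub_zero]

/-- The recursion for the moments, by Fubini's theorem on the triangle `x < y < 1`.  As an
integration by parts it has no boundary terms, since the antiderivatives vanish at `1`. -/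
lemma moment_cutFamily_succ_succ {θ s c : ℝ} (hθ : 0 < θ) (hc : 0 < c) (m i : ℕ) :
    ∫ y in Set.Ioo 0 1, cutFamily θ s (m + 1) (i + 1) y * cutPow (m + 1 = 0) s (c - 1) y =
      -(1 / c) * ∫ y in Set.Ioo 0 1, cutFamily θ s m i y * cutPow (m = 0) s (c + θ - 1) y := by
  set f : ℝ → ℝ := fun y => cutFamily θ s m i y * cutPow (m = 0) s (θ - 1) y with hf
  set μ := volume.restrict (Set.Ioo (0 : ℝ) 1) with hμ
  have hfI : Integrable f μ := integrableOn_cutFamily hθ s m i _ (by linarith)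
  have hpI : Integrable (fun x : ℝ => x ^ (c - 1)) μ :=
    (intervalIntegral.integrableOn_Ioo_rpow_iff one_pos).mpr (by linarith)
  let T : Set (ℝ × ℝ) := {p | p.1 < p.2}
  have hT : MeasurableSet T := measurableSet_lt measurable_fst measurable_snd
  have hgI : Integrable (T.indicator fun p : ℝ × ℝ => p.1 ^ (c - 1) * f p.2) (μ.prod μ) :=
    (hpI.mul_prod hfI).indicator hT
  have hL : ∫ y in Set.Ioo 0 1, cutFamily θ s (m + 1) (i + 1) y * cutPow (m + 1 = 0) s (c - 1) y =
      -∫ x, ∫ y, T.indicator (fun p : ℝ × ℝ => p.1 ^ (c - 1) * f p.2) (x, y) ∂μ ∂μ := by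
    rw [← integral_neg]
    refine setIntegral_congr_fun measurableSet_Ioo fun x hx => ?_
    have h1 : ∀ y, T.indicator (fun p : ℝ × ℝ => p.1 ^ (c - 1) * f p.2) (x, y) =
        (Set.Ioi x).indicator (fun y => x ^ (c - 1) * f y) y := fun y => rfl
    simp only [h1]
    rw [hμ, setIntegral_indicator measurableSet_Ioi]
    have h2 : Set.Ioo (0 : ℝ) 1 ∩ Set.Ioi x = Set.Ioo x 1 := by
      ext y; simp only [Set.mem_inter_iff, Set.mem_Ioo, Set.mem_Ioi]
      exact ⟨fun h => ⟨h.2, h.1.2⟩, fun h => ⟨⟨hx.1.trans h.1, h.2⟩, h.1⟩⟩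
    rw [h2, integral_const_mul, cutFamily, cutPow, if_neg (Nat.succ_ne_zero m)]
    ring
  have hR : ∫ y, ∫ x, T.indicator (fun p : ℝ × ℝ => p.1 ^ (c - 1) * f p.2) (x, y) ∂μ ∂μ =
      (1 / c) * ∫ y in Set.Ioo 0 1,
        cutFamily θ s m i y * cutPow (m = 0) s (c + θ - 1) y := by
    rw [← integral_const_mul]
    refine setIntegral_congr_fun measurableSet_Ioo fun y hy => ?_
    have h1 : ∀ x, T.indicator (fun p : ℝ × ℝ => p.1 ^ (c - 1) * f p.2) (x, y) =
        (Set.Iio y).indicator (fun x => x ^ (c - 1) * f y) x := fun x => rfl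
    simp only [h1]
    rw [hμ, setIntegral_indicator measurableSet_Iio]
    have h2 : Set.Ioo (0 : ℝ) 1 ∩ Set.Iio y = Set.Ioo 0 y := by
      ext x; simp only [Set.mem_inter_iff, Set.mem_Ioo, Set.mem_Iio]
      exact ⟨fun h => ⟨h.1.1, h.2⟩, fun h => ⟨⟨h.1, h.2.trans hy.2⟩, h.2⟩⟩
    rw [h2, integral_mul_const, setIntegral_Ioo_rpow hc hy.1.le, Real.zero_rpow hc.ne', sub_zero,
      hf]
    simp only
    rw [show c + θ - 1 = (θ - 1) + c by ring, ← cutPow_mul_rpow _ _ _ _ hy.1]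
    ring
  rw [hL, integral_integral_swap (f := fun x y => T.indicator
    (fun p : ℝ × ℝ => p.1 ^ (c - 1) * f p.2) (x, y)) hgI, hR]
  ring

/-- The moments of `cutFamily`, up to the factors `∏ k < t, (c + θ k)` and the normalisation
`momentScale`. -/
def momentEntry (θ s c : ℝ) (t j : ℕ) : ℝ :=
  if j < t then ∏ k ∈ Finset.Ioo j t, (c + θ * k) else (1 - s ^ (c + θ * j)) / (c + θ * j)

/-- The factor by which the `j`-th moments of `cutFamily` differ from `momentEntry`; it depends
neither on the cut-off `s` nor on the exponent `c`. -/
def momentScale (θ : ℝ) (t j : ℕ) : ℝ :=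
  if j < t then (-1) ^ j else (-1) ^ t / (θ ^ (j - t) * (j - t).factorial)

lemma momentScale_ne_zero {θ : ℝ} (hθ : 0 < θ) (t j : ℕ) : momentScale θ t j ≠ 0 := by
  unfold momentScale
  split_ifs
  · exact pow_ne_zero _ (by norm_num)
  · exact div_ne_zero (pow_ne_zero _ (by norm_num)) (by positivity)

lemma moment_cutFamily {θ s : ℝ} (hθ : 0 < θ) (hs : 0 ≤ s) (hs1 : s < 1) (t j : ℕ) {c : ℝ}
    (hc : 0 < c) :
    ∫ y in Set.Ioo 0 1, cutFamily θ s t j y * cutPow (t = 0) s (c - 1) y =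
      (∏ k ∈ Finset.range t, (c + θ * k))⁻¹ * (momentScale θ t j * momentEntry θ s c t j) := by
  induction t generalizing j c with
  | zero =>
    rw [moment_cutFamily_zero hθ hs hs1 hc]
    simp only [Finset.range_zero, Finset.prod_empty, momentScale, momentEntry, Nat.not_lt_zero,
      if_false, pow_zero, Nat.sub_zero, inv_one, one_mul]
    rw [div_mul_div_comm, one_mul, mul_comm (c + θ * j)]
  | succ t ih =>
    have hprod : ∏ k ∈ Finset.range t, (c + θ + θ * k) = ∏ k ∈ Finset.range t,
        (c + θ * (k + 1 : ℕ)) := Finset.prod_congr rfl fun k _ => by push_cast; ring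
    have hne : ∏ k ∈ Finset.range t, (c + θ * (k + 1 : ℕ)) ≠ 0 :=
      Finset.prod_ne_zero_iff.mpr fun k _ => by positivity
    rcases j with _ | j
    · rw [moment_cutFamily_succ_zero hc]
      simp only [momentScale, momentEntry, Nat.succ_pos, if_true, pow_zero, one_mul]
      have h1 : ∏ k ∈ Finset.Ioo 0 (t + 1), (c + θ * k) = ∏ k ∈ Finset.range t,
          (c + θ * (k + 1 : ℕ)) := by
        rw [Finset.range_eq_Ico, Finset.prod_Ico_add' (fun k : ℕ => c + θ * k) 0 t 1]
        rfl
      rw [Finset.prod_range_succ', h1]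
      push_cast at hne ⊢
      field_simp
      simp
    · rw [moment_cutFamily_succ_succ hθ hc, ih j (by positivity), Finset.prod_range_succ', hprod]
      have h2 : momentScale θ (t + 1) (j + 1) = -momentScale θ t j := by
        unfold momentScale
        simp only [add_lt_add_iff_right, Nat.add_sub_add_right, pow_succ]
        split_ifs <;> ring
      have h3 : momentEntry θ s c (t + 1) (j + 1) = momentEntry θ s (c + θ) t j := by
        unfold momentEntry
        simp only [add_lt_add_iff_right]
        have h4 : c + θ + θ * j = c + θ * (j + 1 : ℕ) := by push_cast; ring
        rw [h4]
        split_ifs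
        · have h5 := Finset.prod_Ico_add' (fun k : ℕ => c + θ * k) (j + 1) t 1
          refine Eq.trans h5.symm (Finset.prod_congr rfl fun k _ => ?_)
          push_cast; ring
        · rfl
      rw [h2, h3]
      simp only [Nat.cast_zero, mul_zero, add_zero]
      field_simp

/-! ### The gap probability as a ratio of determinants -/

lemma isLevelFamily_cutFamily {θ : ℝ} (hθ : 0 < θ) (s : ℝ) (t : ℕ) {W : ℕ → ℝ → ℝ}
    (hW : ∀ d, W (d + 1) = cutPow (d + 1 = t) s (θ - 1)) :
    IsLevelFamily W fun d => cutFamily θ s (t - d) := by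
  have hint : ∀ d i a b, 0 < a → a < b → b < 1 → IntegrableOn
      (fun y => cutFamily θ s (t - (d + 1)) i y * W (d + 1) y) (Set.Ioo a b) := by
    intro d i a b ha hab hb
    rw [hW]
    exact (integrableOn_cutFamily hθ s _ i _ (by linarith)).mono_set
      (Set.Ioo_subset_Ioo ha.le hb.le)
  refine ⟨fun d x => ?_, hint, fun d i a b ha hab hb => ?_⟩
  · rcases t - d with _ | m <;> simp [cutFamily]
  · rcases Nat.lt_or_ge d t with h | h
    · obtain ⟨m, rfl⟩ : ∃ m, t = d + 1 + m := ⟨t - (d + 1), by omega⟩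
      have hcut : W (d + 1) = cutPow (m = 0) s (θ - 1) := by
        rw [hW]; congr 1; simp
      have hI : IntegrableOn (fun y => cutFamily θ s m i y * cutPow (m = 0) s (θ - 1) y)
          (Set.Ioo a 1) := (integrableOn_cutFamily hθ s _ i _ (by linarith)).mono_set
        (Set.Ioo_subset_Ioo_left ha.le)
      rw [show d + 1 + m - d = m + 1 by omega, show d + 1 + m - (d + 1) = m by omega, hcut]
      simp only [cutFamily]
      have hu : Set.Ioc a b ∪ Set.Ioo b 1 = Set.Ioo a 1 := Set.Ioc_union_Ioo_eq_Ioo hab.le hb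
      have h1 := setIntegral_union (μ := volume) (f := fun y => cutFamily θ s m i y *
        cutPow (m = 0) s (θ - 1) y) (s := Set.Ioc a b) (t := Set.Ioo b 1) (by
          rw [Set.disjoint_left]; intro x hx hx'; exact absurd hx'.1 (not_lt.mpr hx.2))
        measurableSet_Ioo (hI.mono_set (hu ▸ Set.subset_union_left))
        (hI.mono_set (hu ▸ Set.subset_union_right))
      rw [hu, integral_Ioc_eq_integral_Ioo] at h1
      rw [h1]
      ring
    · have hcut : W (d + 1) = fun y => y ^ (θ - 1) := by
        rw [hW]; funext y
        rw [cutPow, if_neg (by omega)]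
      rw [show t - d = 0 by omega, show t - (d + 1) = 0 by omega, hcut]
      simp only [cutFamily]
      have h1 : ∫ y in Set.Ioo a b, y ^ (θ * i) / (θ ^ i * i.factorial) * y ^ (θ - 1) =
          ∫ y in Set.Ioo a b, (θ ^ i * i.factorial)⁻¹ * y ^ (θ * (i + 1 : ℕ) - 1) := by
        refine setIntegral_congr_fun measurableSet_Ioo fun y hy => ?_
        have hy0 : 0 < y := ha.trans hy.1
        simp only [div_eq_inv_mul, mul_assoc]
        rw [← Real.rpow_add hy0]
        push_cast
        ring_nf
      rw [h1, integral_const_mul, setIntegral_Ioo_rpow (by positivity) hab.le]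
      rw [Nat.factorial_succ, pow_succ]
      push_cast
      field_simp

/-- The weight of the entry `(i, j)` of the array when the diagonal `t` is cut off at `s`. -/
lemma entryWeight_cutPow (α η θ s : ℝ) (t : ℤ) (i j : ℕ) :
    entryWeight (fun d => cutPow (-(d : ℤ) = t) s (η - 1)) (fun d => cutPow ((d : ℤ) = t) s (θ - 1))
      (cutPow (t = 0) s (α + (η + θ) / 2 - 1)) (i, j) =
      cutPow ((j : ℤ) - i = t) s (mbExponent α η θ i j - 1) := by
  unfold entryWeight mbExponent
  simp only
  split_ifs with h1 h2
  · congr 1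
    rw [Nat.cast_sub h1.le, neg_sub]
  · congr 1
    rw [Nat.cast_sub h2.le]
  · have : i = j := by omega
    subst this
    congr 1
    simp [eq_comm]

lemma prod_cutPow_eq {n : ℕ} (α η θ s : ℝ) (t : ℤ) (ht : t.natAbs ≤ n)
    {X : Fin (n + 1) → Fin (n + 1) → ℝ} (hX : X ∈ mbArrays (n + 1) (n + 1)) :
    ∏ i : Fin (n + 1), ∏ j : Fin (n + 1), ENNReal.ofReal
      (cutPow (((j : ℕ) : ℤ) - (i : ℕ) = t) s (mbExponent α η θ i j - 1) (X i j)) =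
    {X : Fin (n + 1) → Fin (n + 1) → ℝ | s < mbParticle X t 0}.indicator
      (fun X => ENNReal.ofReal (∏ i, ∏ j, X i j ^ (mbExponent α η θ i j - 1))) X := by
  obtain ⟨h01, hrow, hcol⟩ := hX
  have hpart : mbParticle X t 0 = X ⟨(-t).toNat, by omega⟩ ⟨t.toNat, by omega⟩ := by
    rw [mbParticle, dif_pos ⟨by omega, by omega⟩]
    congr <;> simp
  by_cases hs : s < mbParticle X t 0
  · rw [Set.indicator_of_mem (by exact hs), ENNReal.ofReal_prod_of_nonneg fun i _ =>
      Finset.prod_nonneg fun j _ => Real.rpow_nonneg (h01 i j).1.le _]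
    refine Finset.prod_congr rfl fun i _ => ?_
    rw [ENNReal.ofReal_prod_of_nonneg fun j _ => Real.rpow_nonneg (h01 i j).1.le _]
    refine Finset.prod_congr rfl fun j _ => ?_
    congr 1
    unfold cutPow
    split_ifs with h
    · rw [Set.indicator_of_mem]
      rw [hpart] at hs
      exact hs.trans_le (((hcol _).monotone (a := ⟨(-t).toNat, by omega⟩) (b := i)
        (Fin.mk_le_of_le_val (by omega))).trans
        ((hrow _).monotone (Fin.mk_le_of_le_val (by omega))))
    · rfl
  · rw [Set.indicator_of_notMem (by exact hs)]
    refine Finset.prod_eq_zero (Finset.mem_univ (⟨(-t).toNat, by omega⟩ : Fin (n + 1)))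
      (Finset.prod_eq_zero (Finset.mem_univ (⟨t.toNat, by omega⟩ : Fin (n + 1))) ?_)
    rw [cutPow, if_pos (by simp only; omega), Set.indicator_of_notMem (by
      rw [← hpart]; exact hs), ENNReal.ofReal_zero]

lemma measurable_mbParticle {M N : ℕ} (t : ℤ) (k : ℕ) :
    Measurable fun X : Fin M → Fin N → ℝ => mbParticle X t k := by
  unfold mbParticle
  split_ifs
  · exact (measurable_pi_apply _).comp (measurable_pi_apply _)
  · exact measurable_const

lemma isOpen_mbArrays (M N : ℕ) : IsOpen (mbArrays M N) := by
  have : mbArrays M N = (⋂ i, ⋂ j, {X | X i j ∈ Set.Ioo (0 : ℝ) 1}) ∩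
      ((⋂ i, ⋂ j, ⋂ j', {X | j < j' → X i j < X i j'}) ∩
      (⋂ j, ⋂ i, ⋂ i', {X | i < i' → X i j < X i' j})) := by
    ext X; simp [mbArrays, StrictMono]
  rw [this]
  refine (isOpen_iInter_of_finite fun i => isOpen_iInter_of_finite fun j =>
    isOpen_Ioo.preimage (by fun_prop)).inter ((isOpen_iInter_of_finite fun i =>
    isOpen_iInter_of_finite fun j => isOpen_iInter_of_finite fun j' => ?_).inter
    (isOpen_iInter_of_finite fun i =>
    isOpen_iInter_of_finite fun j => isOpen_iInter_of_finite fun j' => ?_))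
  · by_cases h : j < j'
    · simpa [h] using isOpen_lt (by fun_prop) (by fun_prop)
    · simp [h]
  · by_cases h : j < j'
    · simpa [h] using isOpen_lt (by fun_prop) (by fun_prop)
    · simp [h]

lemma nonempty_mbArrays (n : ℕ) : (mbArrays (n + 1) (n + 1)).Nonempty := by
  refine ⟨fun i j => ((i : ℕ) + (j : ℕ) + 1) / (2 * n + 2), fun i j => ⟨by positivity, ?_⟩,
    fun i j j' h => ?_, fun j i i' h => ?_⟩
  · rw [div_lt_one (by positivity)]
    have hi : ((i : ℕ) : ℝ) ≤ n := by exact_mod_cast Nat.lt_succ_iff.mp i.2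
    have hj : ((j : ℕ) : ℝ) ≤ n := by exact_mod_cast Nat.lt_succ_iff.mp j.2
    linarith
  · have : ((j : ℕ) : ℝ) < ((j' : ℕ) : ℝ) := by exact_mod_cast h
    simp only
    gcongr
  · have : ((i : ℕ) : ℝ) < ((i' : ℕ) : ℝ) := by exact_mod_cast h
    simp only
    gcongr

/-- If the weight of the arrays with all particles of the diagonal `t` above `s` is `D s`, then the
gap probability is `D s / D 0`.  The denominator is positive since the arrays form a
nonempty open set. -/
lemma real_mbProcess_of_lintegral (α η θ : ℝ) (n : ℕ) (t : ℤ) (ht : t.natAbs ≤ n) {D : ℝ → ℝ}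
    (hD : ∀ s, 0 ≤ s → s < 1 → 0 ≤ D s ∧ ∫⁻ Y in mbArrays (n + 1) (n + 1),
      ∏ i : Fin (n + 1), ∏ j : Fin (n + 1), ENNReal.ofReal (cutPow (((j : ℕ) : ℤ) - (i : ℕ) = t) s
        (mbExponent α η θ i j - 1) (Y i j)) = ENNReal.ofReal (D s)) :
    D 0 ≠ 0 ∧ ∀ s, 0 ≤ s → s < 1 →
      (mbProcess (n + 1) (n + 1) α η θ).real {X | s < mbParticle X t 0} = D s / D 0 := by
  set f : (Fin (n + 1) → Fin (n + 1) → ℝ) → ENNReal := fun X =>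
    ENNReal.ofReal (∏ i, ∏ j, X i j ^ (mbExponent α η θ i j - 1)) with hf
  have hopen := isOpen_mbArrays (n + 1) (n + 1)
  have hfm : Measurable f := by
    refine ENNReal.measurable_ofReal.comp (Finset.measurable_fun_prod _ fun i _ =>
      Finset.measurable_fun_prod _ fun j _ => Measurable.pow_const ?_ _)
    exact (measurable_pi_apply j).comp (measurable_pi_apply i)
  have hset : ∀ s, MeasurableSet {X : Fin (n + 1) → Fin (n + 1) → ℝ | s < mbParticle X t 0} :=
    fun s => measurableSet_lt measurable_const (measurable_mbParticle t 0)
  have hw : ∀ s, 0 ≤ s → s < 1 → mbWeight (n + 1) (n + 1) α η θ {X | s < mbParticle X t 0} =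
      ENNReal.ofReal (D s) := by
    intro s hs hs1
    rw [mbWeight, withDensity_apply _ (hset s), ← lintegral_indicator (hset s), ← (hD s hs hs1).2]
    exact setLIntegral_congr_fun hopen.measurableSet fun X hX =>
      (prod_cutPow_eq α η θ s t ht hX).symm
  have huniv : mbWeight (n + 1) (n + 1) α η θ Set.univ = ENNReal.ofReal (D 0) := by
    rw [← hw 0 le_rfl one_pos, mbWeight, withDensity_apply _ (hset 0),
      withDensity_apply _ MeasurableSet.univ, ← lintegral_indicator (hset 0), setLIntegral_univ]
    refine setLIntegral_congr_fun hopen.measurableSet fun X hX => ?_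
    rw [Set.indicator_of_mem]
    simp only [Set.mem_ofPred_eq, mbParticle]
    split_ifs
    · exact (hX.1 _ _).1
    · exact one_pos
  have hpos : 0 < D 0 := by
    rw [← ENNReal.ofReal_pos, ← huniv, mbWeight, withDensity_apply _ MeasurableSet.univ,
      setLIntegral_univ, setLIntegral_pos_iff hfm]
    have : Function.support f ∩ mbArrays (n + 1) (n + 1) = mbArrays (n + 1) (n + 1) := by
      refine Set.inter_eq_right.mpr fun X hX => ?_
      rw [Function.mem_support, hf]
      refine (ENNReal.ofReal_pos.mpr ?_).ne'
      exact Finset.prod_pos fun i _ => Finset.prod_pos fun j _ =>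
        Real.rpow_pos_of_pos (hX.1 i j).1 _
    rw [this]
    exact hopen.measure_pos _ (nonempty_mbArrays n)
  refine ⟨hpos.ne', fun s hs hs1 => ?_⟩
  rw [Measure.real, mbProcess, Measure.smul_apply, hw s hs hs1, huniv, smul_eq_mul,
    ENNReal.toReal_mul, ENNReal.toReal_inv, ENNReal.toReal_ofReal hpos.le,
    ENNReal.toReal_ofReal (hD s hs hs1).1, div_eq_inv_mul]

/-- The matrix whose determinant is proportional to the weight of the arrays whose particles on the
diagonal `t` all lie above `s`; here `c = α + (η + θ) / 2`. -/
def gapMatrix (η θ c : ℝ) (t n : ℕ) (s : ℝ) : Matrix (Fin n) (Fin n) ℝ :=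
  Matrix.of fun i j => momentEntry θ s (c + η * (i : ℕ)) t j

/-- The determinant of the moments is that of `gapMatrix`, up to a constant that does not depend
on the cut-off. -/
lemma det_moments {η θ c : ℝ} (hη : 0 < η) (hθ : 0 < θ) (hc : 0 < c) (t n : ℕ) :
    ∃ C : ℝ, C ≠ 0 ∧ ∀ s, 0 ≤ s → s < 1 →
      (Matrix.of fun i j : Fin n => ∫ x in Set.Ioo 0 1,
        cutFamily η s 0 i x * cutFamily θ s t j x * cutPow (t = 0) s (c - 1) x).det =
      C * (gapMatrix η θ c t n s).det := by
  refine ⟨(∏ i : Fin n, (η ^ (i : ℕ) * (i : ℕ).factorial)⁻¹ *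
    (∏ k ∈ Finset.range t, (c + η * (i : ℕ) + θ * k))⁻¹) * ∏ j : Fin n, momentScale θ t j,
    mul_ne_zero (Finset.prod_ne_zero_iff.mpr fun i _ => mul_ne_zero (by positivity)
      (inv_ne_zero (Finset.prod_ne_zero_iff.mpr fun k _ => by positivity)))
      (Finset.prod_ne_zero_iff.mpr fun j _ => momentScale_ne_zero hθ t j), fun s hs hs1 => ?_⟩
  rw [mul_assoc, ← Matrix.det_mul_row, ← Matrix.det_mul_column]
  congr 1
  ext i j
  simp only [Matrix.of_apply, gapMatrix]
  rw [mul_assoc, ← moment_cutFamily hθ hs hs1 t j (by positivity), ← integral_const_mul]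
  refine setIntegral_congr_fun measurableSet_Ioo fun x hx => ?_
  simp only [cutFamily]
  rw [show c + η * (i : ℕ) - 1 = (c - 1) + η * (i : ℕ) by ring, ← cutPow_mul_rpow _ _ _ _ hx.1]
  ring

lemma integrableOn_cutFamily_mul {η θ c : ℝ} (hη : 0 < η) (hθ : 0 < θ) (hc : 0 < c) (s : ℝ)
    (t i j : ℕ) (cut : Prop) : IntegrableOn (fun x => cutFamily η s 0 i x * cutFamily θ s t j x *
      cutPow cut s (c - 1) x) (Set.Ioo 0 1) := by
  obtain ⟨C, hC⟩ := exists_abs_cutFamily_le hη s 0 i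
  simp only [mul_assoc]
  refine Integrable.bdd_mul (c := C) (integrableOn_cutFamily hθ s t j cut (by linarith))
    (measurable_cutFamily _ _ _ _).aestronglyMeasurable ?_
  filter_upwards [ae_restrict_mem measurableSet_Ioo] with y hy
  exact hC y hy

lemma cutPow_congr {p q : Prop} (h : p ↔ q) : cutPow p = cutPow q := by rw [propext h]

/-- The gap probability on a diagonal on or above the main one. -/
theorem real_mbProcess_upper {α η θ : ℝ} (hα : 0 ≤ α) (hη : 0 < η) (hθ : 0 < θ) {n t : ℕ}
    (ht : t ≤ n) :
    (gapMatrix η θ (α + (η + θ) / 2) t (n + 1) 0).det ≠ 0 ∧ ∀ s, 0 ≤ s → s < 1 →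
      (mbProcess (n + 1) (n + 1) α η θ).real {X | s < mbParticle X (t : ℤ) 0} =
        (gapMatrix η θ (α + (η + θ) / 2) t (n + 1) s).det /
          (gapMatrix η θ (α + (η + θ) / 2) t (n + 1) 0).det := by
  have hc : 0 < α + (η + θ) / 2 := by positivity
  obtain ⟨C, hC, hdet⟩ := det_moments hη hθ hc t (n + 1)
  have key := real_mbProcess_of_lintegral α η θ n (t : ℤ) (by simpa using ht)
    (D := fun s => C * (gapMatrix η θ (α + (η + θ) / 2) t (n + 1) s).det) (fun s hs hs1 => by
      have h := lintegral_mbArrays n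
        (WL := fun d => cutPow (-(d : ℤ) = t) s (η - 1))
        (WU := fun d => cutPow ((d : ℤ) = t) s (θ - 1))
        (W0 := cutPow ((t : ℤ) = 0) s (α + (η + θ) / 2 - 1))
        (fun d => measurable_cutPow _ _ _) (fun d => measurable_cutPow _ _ _)
        (measurable_cutPow _ _ _) (fun d y hy => cutPow_nonneg _ _ _ hy.1)
        (fun d y hy => cutPow_nonneg _ _ _ hy.1) (fun y hy => cutPow_nonneg _ _ _ hy.1)
        (isLevelFamily_cutFamily hη s 0 fun d => by
          rw [cutPow_congr (show (-((d + 1 : ℕ) : ℤ) = t) ↔ (d + 1 = 0) by omega)])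
        (isLevelFamily_cutFamily hθ s t fun d => by
          rw [cutPow_congr (show (((d + 1 : ℕ) : ℤ) = t) ↔ (d + 1 = t) by omega)])
        (fun i j => integrableOn_cutFamily_mul hη hθ hc s _ i j _)
      simp only [entryWeight_cutPow, Nat.sub_zero] at h
      rw [cutPow_congr (show ((t : ℤ) = 0) ↔ (t = 0) by omega)] at h
      rwa [hdet s hs hs1] at h)
  refine ⟨right_ne_zero_of_mul key.1, fun s hs hs1 => ?_⟩
  rw [key.2 s hs hs1, mul_div_mul_left _ _ hC]

/-- The gap probability on a diagonal on or below the main one. -/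
theorem real_mbProcess_lower {α η θ : ℝ} (hα : 0 ≤ α) (hη : 0 < η) (hθ : 0 < θ) {n t : ℕ}
    (ht : t ≤ n) :
    (gapMatrix θ η (α + (θ + η) / 2) t (n + 1) 0).det ≠ 0 ∧ ∀ s, 0 ≤ s → s < 1 →
      (mbProcess (n + 1) (n + 1) α η θ).real {X | s < mbParticle X (-t : ℤ) 0} =
        (gapMatrix θ η (α + (θ + η) / 2) t (n + 1) s).det /
          (gapMatrix θ η (α + (θ + η) / 2) t (n + 1) 0).det := by
  have hc : 0 < α + (θ + η) / 2 := by positivity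
  obtain ⟨C, hC, hdet⟩ := det_moments hθ hη hc t (n + 1)
  have key := real_mbProcess_of_lintegral α η θ n (-t : ℤ) (by simpa using ht)
    (D := fun s => C * (gapMatrix θ η (α + (θ + η) / 2) t (n + 1) s).det) (fun s hs hs1 => by
      have hcomm : ∀ i j x, cutFamily η s t i x * cutFamily θ s 0 j x *
          cutPow (t = 0) s (α + (θ + η) / 2 - 1) x = cutFamily θ s 0 j x * cutFamily η s t i x *
          cutPow (t = 0) s (α + (θ + η) / 2 - 1) x := fun i j x => by ring
      have h := lintegral_mbArrays n
        (WL := fun d => cutPow (-(d : ℤ) = -t) s (η - 1))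
        (WU := fun d => cutPow ((d : ℤ) = -t) s (θ - 1))
        (W0 := cutPow ((-t : ℤ) = 0) s (α + (η + θ) / 2 - 1))
        (fun d => measurable_cutPow _ _ _) (fun d => measurable_cutPow _ _ _)
        (measurable_cutPow _ _ _) (fun d y hy => cutPow_nonneg _ _ _ hy.1)
        (fun d y hy => cutPow_nonneg _ _ _ hy.1) (fun y hy => cutPow_nonneg _ _ _ hy.1)
        (isLevelFamily_cutFamily hη s t fun d => by
          rw [cutPow_congr (show (-((d + 1 : ℕ) : ℤ) = -t) ↔ (d + 1 = t) by omega)])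
        (isLevelFamily_cutFamily hθ s 0 fun d => by
          rw [cutPow_congr (show (((d + 1 : ℕ) : ℤ) = -t) ↔ (d + 1 = 0) by omega)])
        (fun i j => by
          rw [cutPow_congr (show ((-t : ℤ) = 0) ↔ (t = 0) by omega), add_comm η θ]
          simp only [Nat.sub_zero, hcomm]
          exact integrableOn_cutFamily_mul hθ hη hc s _ j i _)
      simp only [entryWeight_cutPow, Nat.sub_zero] at h
      rw [cutPow_congr (show ((-t : ℤ) = 0) ↔ (t = 0) by omega), add_comm η θ] at h
      simp only [hcomm] at h
      have htr : (Matrix.of fun i j : Fin (n + 1) => ∫ x in Set.Ioo 0 1,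
          cutFamily θ s 0 j x * cutFamily η s t i x * cutPow (t = 0) s (α + (θ + η) / 2 - 1) x) =
          (Matrix.of fun i j : Fin (n + 1) => ∫ x in Set.Ioo 0 1, cutFamily θ s 0 i x *
            cutFamily η s t j x * cutPow (t = 0) s (α + (θ + η) / 2 - 1) x).transpose := rfl
      rw [htr, Matrix.det_transpose, hdet s hs hs1] at h
      exact h)
  refine ⟨right_ne_zero_of_mul key.1, fun s hs hs1 => ?_⟩
  rw [key.2 s hs hs1, mul_div_mul_left _ _ hC]

/-! ### The correlation kernel at finite size -/

section FiniteKernel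

variable (η θ a b : ℝ)

/-- The residue at `z = a + η i` of
`∏ k < n, (z + b + θ k) / ∏ l < N, (a + η l - z)`, up to sign. -/
def leftCoeff (N n i : ℕ) : ℝ :=
  (∏ k ∈ Finset.range n, (a + η * i + (b + θ * k))) /
    ∏ l ∈ (Finset.range N).erase i, (η * l - η * i)

/-- The residue at `z = b + θ k` of
`∏ l < N, (a + η l + z) / ∏ m < n, (b + θ m - z)`, up to sign. -/
def rightCoeff (N n k : ℕ) : ℝ :=
  (∏ l ∈ Finset.range N, (a + η * l + (b + θ * k))) /
    ∏ m ∈ (Finset.range n).erase k, (θ * m - θ * k)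

variable {η θ a b}

open Polynomial in
/-- Lagrange interpolation of `∏ m ≠ k, (b + θ m - X)` at the nodes `-(a + η i)`, evaluated at the
node `b + θ l`. -/
lemma sum_leftCoeff_mul_rightCoeff (hη : 0 < η) (hθ : 0 < θ) (ha : 0 < a) (hb : 0 < b)
    {N n k l : ℕ} (hn : n ≤ N) (hk : k < n) (hl : l < n) :
    ∑ i ∈ Finset.range N, leftCoeff η θ a b N n i * rightCoeff η θ a b N n k /
        (a + η * i + (b + θ * k)) * (1 / (a + η * i + (b + θ * l))) = if l = k then 1 else 0 := by
  set v : ℕ → ℝ := fun i => -(a + η * i) with hv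
  have hvinj : Set.InjOn v (Finset.range N) := by
    intro i _ j _ h
    simp only [hv, neg_inj, add_right_inj] at h
    exact_mod_cast mul_left_cancel₀ hη.ne' h
  set Q : ℝ[X] := ∏ m ∈ (Finset.range n).erase k, (C (b + θ * m) - X) with hQ
  have hQe : ∀ x, Q.eval x = ∏ m ∈ (Finset.range n).erase k, (b + θ * m - x) := by
    intro x; rw [hQ, eval_prod]; simp
  have hQd : Q.degree < (Finset.range N).card := by
    refine lt_of_le_of_lt (degree_prod_le _ _) ?_
    have h1 : ∀ m ∈ (Finset.range n).erase k, (C (b + θ * m) - X : ℝ[X]).degree ≤ 1 := by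
      intro m _
      compute_degree
    refine (Finset.sum_le_sum h1).trans_lt ?_
    rw [Finset.sum_const, Finset.card_erase_of_mem (Finset.mem_range.mpr hk), Finset.card_range,
      Finset.card_range, nsmul_eq_mul, mul_one]
    exact_mod_cast (by omega : n - 1 < N)
  have hne : ∀ i ∈ Finset.range N, b + θ * l ≠ v i := by
    intro i _
    have : 0 < b + θ * l + (a + η * i) := by positivity
    intro h
    rw [h, hv] at this
    simp at this
  have h1 := Lagrange.eval_interpolate_not_at_node (s := Finset.range N) (v := v)
    (fun i => Q.eval (v i)) hne
  rw [← Lagrange.eq_interpolate hvinj hQd, Lagrange.eval_nodal] at h1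
  have hnod : ∏ i ∈ Finset.range N, (b + θ * l - v i) =
      ∏ i ∈ Finset.range N, (a + η * i + (b + θ * l)) :=
    Finset.prod_congr rfl fun i _ => by simp only [hv]; ring
  rw [hnod] at h1
  have hP : ∏ i ∈ Finset.range N, (a + η * i + (b + θ * l)) ≠ 0 :=
    Finset.prod_ne_zero_iff.mpr fun i _ => by positivity
  have hsum : ∑ i ∈ Finset.range N, leftCoeff η θ a b N n i * rightCoeff η θ a b N n k /
        (a + η * i + (b + θ * k)) * (1 / (a + η * i + (b + θ * l))) =
      rightCoeff η θ a b N n k * (Q.eval (b + θ * l) /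
        ∏ i ∈ Finset.range N, (a + η * i + (b + θ * l))) := by
    rw [h1, mul_div_cancel_left₀ _ hP, Finset.mul_sum]
    refine Finset.sum_congr rfl fun i _ => ?_
    have h2 : Q.eval (v i) * (a + η * i + (b + θ * k)) =
        ∏ k ∈ Finset.range n, (a + η * i + (b + θ * k)) := by
      rw [hQe, ← Finset.prod_erase_mul _ _ (Finset.mem_range.mpr hk)]
      congr 1
      exact Finset.prod_congr rfl fun m _ => by simp only [hv]; ring
    have h3 : Lagrange.nodalWeight (Finset.range N) v i =
        (∏ l ∈ (Finset.range N).erase i, (η * l - η * i))⁻¹ := by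
      rw [Lagrange.nodalWeight, Finset.prod_inv_distrib]
      congr 1
      exact Finset.prod_congr rfl fun m _ => by simp only [hv]; ring
    have h4 : b + θ * l - v i = a + η * i + (b + θ * l) := by simp only [hv]; ring
    have h5 : a + η * i + (b + θ * k) ≠ 0 := by positivity
    rw [leftCoeff, ← h2, h3, h4]
    field_simp
  rw [hsum, hQe]
  split_ifs with h
  · subst h
    rw [rightCoeff]
    have h6 : ∏ m ∈ (Finset.range n).erase l, (b + θ * m - (b + θ * l)) =
        ∏ m ∈ (Finset.range n).erase l, (θ * m - θ * l) :=
      Finset.prod_congr rfl fun m _ => by ring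
    have h7 : ∏ m ∈ (Finset.range n).erase l, (θ * m - θ * l) ≠ 0 := by
      refine Finset.prod_ne_zero_iff.mpr fun m hm => ?_
      rw [← mul_sub]
      refine mul_ne_zero hθ.ne' (sub_ne_zero.mpr ?_)
      exact_mod_cast (Finset.mem_erase.mp hm).1
    rw [h6, div_mul_div_comm, mul_comm, div_self (mul_ne_zero h7 hP)]
  · rw [Finset.prod_eq_zero (Finset.mem_erase.mpr ⟨h, Finset.mem_range.mpr hl⟩) (by ring), zero_div,
      mul_zero]

open Polynomial in
/-- The same coefficients annihilate polynomials of low degree: the corresponding sum is the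
leading coefficient of an interpolation polynomial. -/
lemma sum_leftCoeff_mul_eval (hη : 0 < η) (hθ : 0 < θ) (ha : 0 < a) (hb : 0 < b)
    {N n k : ℕ} (hk : k < n) (p : ℝ[X]) (hp : p.natDegree + n < N) :
    ∑ i ∈ Finset.range N, leftCoeff η θ a b N n i * rightCoeff η θ a b N n k /
        (a + η * i + (b + θ * k)) * p.eval (-(a + η * i)) = 0 := by
  set v : ℕ → ℝ := fun i => -(a + η * i) with hv
  have hvinj : Set.InjOn v (Finset.range N) := by
    intro i _ j _ h
    simp only [hv, neg_inj, add_right_inj] at h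
    exact_mod_cast mul_left_cancel₀ hη.ne' h
  set Q : ℝ[X] := ∏ m ∈ (Finset.range n).erase k, (C (b + θ * m) - X) with hQ
  have hQe : ∀ x, Q.eval x = ∏ m ∈ (Finset.range n).erase k, (b + θ * m - x) := by
    intro x; rw [hQ, eval_prod]; simp
  have hQd : Q.natDegree ≤ n - 1 := by
    refine (natDegree_prod_le _ _).trans ?_
    have h1 : ∀ m ∈ (Finset.range n).erase k, (C (b + θ * m) - X : ℝ[X]).natDegree ≤ 1 := by
      intro m _
      compute_degree
    refine (Finset.sum_le_sum h1).trans ?_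
    rw [Finset.sum_const, Finset.card_erase_of_mem (Finset.mem_range.mpr hk), Finset.card_range,
      smul_eq_mul, mul_one]
  have hPd : (Q * p).natDegree < N - 1 := by
    have := natDegree_mul_le (p := Q) (q := p)
    omega
  have h1 := Lagrange.coeff_eq_sum (s := Finset.range N) (v := v) hvinj (P := Q * p) (by
    refine lt_of_le_of_lt degree_le_natDegree ?_
    rw [Finset.card_range]
    exact_mod_cast (by omega : (Q * p).natDegree < N))
  rw [Finset.card_range, coeff_eq_zero_of_natDegree_lt hPd] at h1
  have hsum : ∑ i ∈ Finset.range N, leftCoeff η θ a b N n i * rightCoeff η θ a b N n k /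
        (a + η * i + (b + θ * k)) * p.eval (-(a + η * i)) =
      rightCoeff η θ a b N n k * ∑ i ∈ Finset.range N, (Q * p).eval (v i) /
        ∏ j ∈ (Finset.range N).erase i, (v i - v j) := by
    rw [Finset.mul_sum]
    refine Finset.sum_congr rfl fun i _ => ?_
    have h2 : Q.eval (v i) * (a + η * i + (b + θ * k)) =
        ∏ k ∈ Finset.range n, (a + η * i + (b + θ * k)) := by
      rw [hQe, ← Finset.prod_erase_mul _ _ (Finset.mem_range.mpr hk)]
      congr 1
      exact Finset.prod_congr rfl fun m _ => by simp only [hv]; ring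
    have h3 : ∏ j ∈ (Finset.range N).erase i, (v i - v j) =
        (∏ l ∈ (Finset.range N).erase i, (η * l - η * i)) :=
      Finset.prod_congr rfl fun m _ => by simp only [hv]; ring
    have h5 : a + η * i + (b + θ * k) ≠ 0 := by positivity
    rw [leftCoeff, ← h2, h3, eval_mul]
    field_simp
    rfl
  rw [hsum, ← h1, mul_zero]

/-- The kernel whose Fredholm determinant on `(0, r)` is the probability that the `n` particles of
a diagonal all lie above `r ν`. -/
def finiteKernel (η θ a b ν : ℝ) (N n : ℕ) (x y : ℝ) : ℝ :=
  ∑ k ∈ Finset.range n, (∑ i ∈ Finset.range N,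
    leftCoeff η θ a b N n i * ν ^ (a + η * i) * (rightCoeff η θ a b N n k * ν ^ (b + θ * k)) /
      (a + η * i + (b + θ * k)) * x ^ (a + η * i - 1 / 2)) * y ^ (b + θ * k - 1 / 2)

/-- The ratio of determinants in the gap probability is `det (1 - B)` for a matrix of the size of
the diagonal: the coefficients above form the relevant rows of the inverse of `gapMatrix` at
`s = 0`. -/
lemma det_gapMatrix_div (hη : 0 < η) (hθ : 0 < θ) (ha : 0 < a) (hb : 0 < b) {t n : ℕ}
    {c s : ℝ} (hc : c + θ * t = a + b)
    (h0 : (gapMatrix η θ c t (t + n) 0).det ≠ 0) :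
    (gapMatrix η θ c t (t + n) s).det / (gapMatrix η θ c t (t + n) 0).det =
      (1 - Matrix.of fun k l : Fin n => ∑ i ∈ Finset.range (t + n),
        leftCoeff η θ a b (t + n) n i * rightCoeff η θ a b (t + n) n k /
          (a + η * i + (b + θ * (k : ℕ))) * (s ^ (a + η * i + (b + θ * (l : ℕ))) /
          (a + η * i + (b + θ * (l : ℕ))))).det := by
  set G := gapMatrix η θ c t (t + n) 0 with hG
  let H : Matrix (Fin n) (Fin (t + n)) ℝ := Matrix.of fun k i =>
    leftCoeff η θ a b (t + n) n i * rightCoeff η θ a b (t + n) n k /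
      (a + η * (i : ℕ) + (b + θ * (k : ℕ)))
  let A : Matrix (Fin (t + n)) (Fin n) ℝ := Matrix.of fun i l =>
    s ^ (a + η * (i : ℕ) + (b + θ * (l : ℕ))) / (a + η * (i : ℕ) + (b + θ * (l : ℕ)))
  let E : Matrix (Fin n) (Fin (t + n)) ℝ := Matrix.of fun k j =>
    if (j : ℕ) = t + k then 1 else 0
  have hidx : ∀ i l : ℕ, c + η * i + θ * (t + l : ℕ) = a + η * i + (b + θ * l) := by
    intro i l; push_cast; linear_combination hc
  have hHG : H * G = E := by
    ext k j
    rw [Matrix.mul_apply]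
    simp only [H, E, G, gapMatrix, Matrix.of_apply, momentEntry]
    rw [Fin.sum_univ_eq_sum_range (fun i => leftCoeff η θ a b (t + n) n i *
      rightCoeff η θ a b (t + n) n k / (a + η * i + (b + θ * (k : ℕ))) *
      if (j : ℕ) < t then ∏ m ∈ Finset.Ioo (j : ℕ) t, (c + η * i + θ * m) else
        (1 - (0 : ℝ) ^ (c + η * i + θ * (j : ℕ))) / (c + η * i + θ * (j : ℕ))) (t + n)]
    rcases Nat.lt_or_ge j t with hj | hj
    · simp only [if_pos hj]
      rw [if_neg (by omega)]
      have h := sum_leftCoeff_mul_eval hη hθ ha hb (N := t + n) k.2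
        (∏ m ∈ Finset.Ioo (j : ℕ) t,
          (Polynomial.C (c - a + θ * m) - Polynomial.X : Polynomial ℝ)) (by
          have h1 : ∀ m ∈ Finset.Ioo (j : ℕ) t,
              (Polynomial.C (c - a + θ * m) - Polynomial.X : Polynomial ℝ).natDegree ≤ 1 := by
            intro m _
            compute_degree
          have h2 := (Polynomial.natDegree_prod_le (Finset.Ioo (j : ℕ) t) fun m : ℕ =>
            (Polynomial.C (c - a + θ * m) - Polynomial.X : Polynomial ℝ)).trans
            (Finset.sum_le_sum h1)
          rw [Finset.sum_const, Nat.card_Ioo, smul_eq_mul, mul_one] at h2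
          omega)
      rw [← h]
      refine Finset.sum_congr rfl fun i _ => ?_
      rw [Polynomial.eval_prod]
      congr 1
      refine Finset.prod_congr rfl fun m _ => ?_
      simp only [Polynomial.eval_sub, Polynomial.eval_C, Polynomial.eval_X]
      ring
    · obtain ⟨l, hl⟩ : ∃ l, (j : ℕ) = t + l := ⟨j - t, by omega⟩
      have h := sum_leftCoeff_mul_rightCoeff hη hθ ha hb (N := t + n) (l := l) (by omega) k.2
        (by omega)
      simp only [hl, add_right_inj, hidx, if_neg (show ¬ t + l < t by omega)]
      rw [← h]
      refine Finset.sum_congr rfl fun i _ => ?_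
      rw [Real.zero_rpow (by positivity), sub_zero]
  have hGs : gapMatrix η θ c t (t + n) s = G - A * E := by
    ext i j
    rw [Matrix.sub_apply, Matrix.mul_apply]
    simp only [A, E, G, gapMatrix, Matrix.of_apply, momentEntry]
    rcases Nat.lt_or_ge j t with hj | hj
    · simp only [if_pos hj]
      rw [Finset.sum_eq_zero fun k _ => by rw [if_neg (by omega), mul_zero], sub_zero]
    · obtain ⟨l, hl⟩ : ∃ l, (j : ℕ) = t + l := ⟨j - t, by omega⟩
      rw [Finset.sum_eq_single (⟨l, by omega⟩ : Fin n)]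
      · simp only [hl, hidx, if_neg (show ¬ t + l < t by omega), if_true, mul_one]
        rw [Real.zero_rpow (by positivity)]
        ring
      · intro k _ hk
        rw [if_neg (fun h => hk (Fin.ext (by simp only; omega))), mul_zero]
      · simp
  have hunit : IsUnit G.det := isUnit_iff_ne_zero.mpr h0
  have hH : H = E * G⁻¹ := by rw [← hHG, Matrix.mul_nonsing_inv_cancel_right _ _ hunit]
  -- Sylvester's identity reduces `det (1 - (G⁻¹ A) E)` to size `n`, where `E G⁻¹ = H` appears
  have hfac : G - A * E = G * (1 - (G⁻¹ * A) * E) := by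
    rw [mul_sub, mul_one, ← Matrix.mul_assoc, ← Matrix.mul_assoc, Matrix.mul_nonsing_inv _ hunit,
      Matrix.one_mul]
  rw [hGs, hfac, Matrix.det_mul, mul_div_cancel_left₀ _ h0, Matrix.det_one_sub_mul_comm,
    ← Matrix.mul_assoc, ← hH]
  congr 2
  ext k l
  rw [Matrix.mul_apply]
  simp only [H, A, Matrix.of_apply]
  exact Fin.sum_univ_eq_sum_range (fun i => leftCoeff η θ a b (t + n) n i *
    rightCoeff η θ a b (t + n) n k / (a + η * i + (b + θ * (k : ℕ))) *
    (s ^ (a + η * i + (b + θ * (l : ℕ))) / (a + η * i + (b + θ * (l : ℕ))))) (t + n)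

/-- The gap probability is the Fredholm series of the rescaled kernel. -/
theorem hasSum_finiteKernel (hη : 0 < η) (hθ : 0 < θ) (ha : 0 < a) (hb : 0 < b) {t n : ℕ}
    {c r ν : ℝ} (hr : 0 < r) (hν : 0 < ν) (hc : c + θ * t = a + b)
    (h0 : (gapMatrix η θ c t (t + n) 0).det ≠ 0) :
    HasSum (fredholmTerm (volume.restrict (Set.Ioo 0 r)) (finiteKernel η θ a b ν (t + n) n))
      ((gapMatrix η θ c t (t + n) (r * ν)).det / (gapMatrix η θ c t (t + n) 0).det) := by
  let φ : Fin n → ℝ → ℝ := fun k x => ∑ i ∈ Finset.range (t + n),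
    leftCoeff η θ a b (t + n) n i * ν ^ (a + η * i) *
      (rightCoeff η θ a b (t + n) n k * ν ^ (b + θ * (k : ℕ))) /
      (a + η * i + (b + θ * (k : ℕ))) * x ^ (a + η * i - 1 / 2)
  let ψ : Fin n → ℝ → ℝ := fun k y => y ^ (b + θ * (k : ℕ) - 1 / 2)
  have hK : finiteKernel η θ a b ν (t + n) n = fun x y => ∑ k, φ k x * ψ k y := by
    funext x y
    rw [finiteKernel, Finset.sum_range]
  have hpow : ∀ i l : ℕ, ∀ x ∈ Set.Ioo 0 r, x ^ (a + η * i - 1 / 2) * x ^ (b + θ * l - 1 / 2) =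
      x ^ (a + η * i + (b + θ * l) - 1) := by
    intro i l x hx
    rw [← Real.rpow_add hx.1]
    ring_nf
  have hφψ : ∀ k l, ∀ x ∈ Set.Ioo 0 r, φ k x * ψ l x = ∑ i ∈ Finset.range (t + n),
      leftCoeff η θ a b (t + n) n i * ν ^ (a + η * i) *
      (rightCoeff η θ a b (t + n) n k * ν ^ (b + θ * (k : ℕ))) /
      (a + η * i + (b + θ * (k : ℕ))) * x ^ (a + η * i + (b + θ * (l : ℕ)) - 1) := by
    intro k l x hx
    simp only [φ, ψ]
    rw [Finset.sum_mul]
    exact Finset.sum_congr rfl fun i _ => by rw [mul_assoc, hpow i l x hx]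
  have hterm : ∀ (C : ℝ) (i l : ℕ), IntegrableOn
      (fun x => C * x ^ (a + η * i + (b + θ * l) - 1)) (Set.Ioo 0 r) := by
    intro C i l
    refine Integrable.const_mul ((intervalIntegral.integrableOn_Ioo_rpow_iff hr).mpr ?_) C
    have : 0 < a + η * i + (b + θ * l) := by positivity
    linarith
  have hint : ∀ k l, IntegrableOn (fun x => φ k x * ψ l x) (Set.Ioo 0 r) := by
    intro k l
    refine IntegrableOn.congr_fun (integrable_finsetSum _ fun i _ => hterm _ i l)
      (fun x hx => (hφψ k l x hx).symm) measurableSet_Ioo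
  have hval : ∀ k l : Fin n, ∫ x in Set.Ioo 0 r, φ k x * ψ l x =
      ν ^ (b + θ * (k : ℕ)) * (ν ^ (-(b + θ * (l : ℕ))) * ∑ i ∈ Finset.range (t + n),
        leftCoeff η θ a b (t + n) n i * rightCoeff η θ a b (t + n) n k /
          (a + η * i + (b + θ * (k : ℕ))) * ((r * ν) ^ (a + η * i + (b + θ * (l : ℕ))) /
          (a + η * i + (b + θ * (l : ℕ))))) := by
    intro k l
    rw [setIntegral_congr_fun measurableSet_Ioo (hφψ k l),
      integral_finsetSum _ fun i _ => hterm _ i l, Finset.mul_sum, Finset.mul_sum]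
    refine Finset.sum_congr rfl fun i _ => ?_
    have hpos : 0 < a + η * i + (b + θ * (l : ℕ)) := by positivity
    rw [integral_const_mul, setIntegral_Ioo_rpow hpos hr.le, Real.zero_rpow hpos.ne', sub_zero,
      Real.mul_rpow hr.le hν.le, Real.rpow_add hν (a + η * i) (b + θ * (l : ℕ)),
      Real.rpow_neg hν.le]
    have := (Real.rpow_pos_of_pos hν (b + θ * (l : ℕ))).ne'
    field_simp
  have h := hasSum_fredholmTerm_finite_rank φ ψ hint
  rw [← hK] at h
  convert h using 1
  rw [det_gapMatrix_div hη hθ ha hb hc h0]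
  set B : Matrix (Fin n) (Fin n) ℝ := Matrix.of fun k l : Fin n => ∑ i ∈ Finset.range (t + n),
        leftCoeff η θ a b (t + n) n i * rightCoeff η θ a b (t + n) n k /
          (a + η * i + (b + θ * (k : ℕ))) * ((r * ν) ^ (a + η * i + (b + θ * (l : ℕ))) /
          (a + η * i + (b + θ * (l : ℕ)))) with hB
  -- the two matrices are conjugate by the diagonal matrix with entries `ν ^ (b + θ k)`
  have hconj : (1 - Matrix.of fun k l => ∫ x in Set.Ioo 0 r, φ k x * ψ l x) =
      Matrix.of fun k l => ν ^ (b + θ * ((k : Fin n) : ℕ)) *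
        (Matrix.of fun k l => ν ^ (-(b + θ * ((l : Fin n) : ℕ))) * (1 - B) k l) k l := by
    ext k l
    simp only [Matrix.of_apply, Matrix.sub_apply]
    rw [hval]
    by_cases hkl : k = l
    · subst hkl
      have h1 : ν ^ (b + θ * (k : ℕ)) * ν ^ (-(b + θ * (k : ℕ))) = 1 := by
        rw [← Real.rpow_add hν, add_neg_cancel, Real.rpow_zero]
      simp only [Matrix.one_apply_eq, hB, Matrix.of_apply]
      linear_combination -h1
    · simp only [Matrix.one_apply_ne hkl, hB, Matrix.of_apply]
      ring
  rw [hconj, Matrix.det_mul_column, Matrix.det_mul_row, ← mul_assoc, ← Finset.prod_mul_distrib,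
    Finset.prod_eq_one, one_mul]
  intro k _
  rw [← Real.rpow_add hν, add_neg_cancel, Real.rpow_zero]

end FiniteKernel

/-! ### Asymptotics of the coefficients and of the kernel -/

lemma prod_range_sub_self (i : ℕ) :
    ∏ l ∈ Finset.range i, ((l : ℝ) - i) = (-1) ^ i * i.factorial := by
  rw [← Finset.prod_range_reflect, ← Finset.prod_range_add_one_eq_factorial]
  push_cast
  rw [← Finset.card_range i, ← Finset.prod_const, Finset.card_range, ← Finset.prod_mul_distrib]
  refine Finset.prod_congr rfl fun l hl => ?_
  have : l + 1 ≤ i := Finset.mem_range.mp hl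
  rw [show i - 1 - l = i - (l + 1) by omega, Nat.cast_sub this]
  push_cast
  ring

lemma prod_erase_sub (c : ℝ) {N i : ℕ} (hi : i < N) :
    ∏ l ∈ (Finset.range N).erase i, (c * l - c * i) =
      c ^ (N - 1) * ((-1) ^ i * i.factorial * (N - 1 - i).factorial) := by
  obtain ⟨m, rfl⟩ : ∃ m, N = i + 1 + m := ⟨N - (i + 1), by omega⟩
  have h1 : ∀ l ∈ (Finset.range (i + 1 + m)).erase i, c * (l : ℝ) - c * i = c * ((l : ℝ) - i) :=
    fun l _ => by ring
  rw [Finset.prod_congr rfl h1, Finset.prod_mul_distrib, Finset.prod_const,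
    Finset.card_erase_of_mem (Finset.mem_range.mpr hi), Finset.card_range]
  congr 1
  rw [show i + 1 + m - 1 - i = m by omega]
  clear h1 hi
  induction m with
  | zero =>
    rw [add_zero, Finset.range_add_one, Finset.erase_insert Finset.notMem_range_self,
      prod_range_sub_self]
    simp
  | succ m ih =>
    rw [← add_assoc, Finset.range_add_one, Finset.erase_insert_of_ne (by omega),
      Finset.prod_insert (by simp), ih, Nat.factorial_succ]
    push_cast
    ring

/-- The ratio `Γ(y + N) / (Γ(y) (N - 1 - q)! N ^ (y + q))`, written without Gamma functions.  The
subtraction `N - 1 - q` is truncated, so only the values at `q < N` are meaningful. -/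
def gammaRatio (y : ℝ) (q N : ℕ) : ℝ :=
  (∏ s ∈ Finset.range N, (y + s)) / ((N - 1 - q).factorial * (N : ℝ) ^ (y + q))

lemma gammaRatio_nonneg {y : ℝ} (hy : 0 < y) (q N : ℕ) : 0 ≤ gammaRatio y q N :=
  div_nonneg (Finset.prod_nonneg fun s _ => by positivity) (by positivity)

lemma tendsto_descFactorial_div (q : ℕ) :
    Tendsto (fun n : ℕ => (n.descFactorial q : ℝ) / ((n : ℝ) + 1) ^ q) atTop (𝓝 1) := by
  induction q with
  | zero => simp
  | succ q ih =>
    have h1 : Tendsto (fun n : ℕ => 1 - ((q : ℝ) + 1) / ((n : ℝ) + 1)) atTop (𝓝 (1 - 0)) := by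
      refine tendsto_const_nhds.sub (Tendsto.div_atTop tendsto_const_nhds ?_)
      exact tendsto_atTop_add_const_right _ _ tendsto_natCast_atTop_atTop
    have h2 := h1.mul ih
    rw [sub_zero, one_mul] at h2
    refine h2.congr' ?_
    filter_upwards [eventually_ge_atTop q] with n hn
    rw [Nat.descFactorial_succ, pow_succ]
    push_cast [Nat.cast_sub hn]
    have : (n : ℝ) + 1 ≠ 0 := by positivity
    field_simp
    ring

/-- Euler's limit formula. -/
lemma tendsto_gammaRatio {y : ℝ} (hy : 0 < y) (q : ℕ) :
    Tendsto (fun N => gammaRatio y q N) atTop (𝓝 (Real.Gamma y)⁻¹) := by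
  rw [← tendsto_add_atTop_iff_nat 1]
  have h1 : Tendsto (fun n : ℕ => (n : ℝ) / ((n : ℝ) + 1)) atTop (𝓝 1) :=
    tendsto_natCast_div_add_atTop 1
  have h2 := ((Real.GammaSeq_tendsto_Gamma y).inv₀ (Real.Gamma_pos_of_pos hy).ne').mul
    ((h1.rpow_const (p := y) (Or.inl one_ne_zero)).mul (tendsto_descFactorial_div q))
  rw [Real.one_rpow, one_mul, mul_one] at h2
  refine h2.congr' ?_
  filter_upwards [eventually_ge_atTop (q + 1)] with n hn
  have hn0 : (0 : ℝ) < n := by exact_mod_cast (by omega : 0 < n)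
  have hf : ((n - q).factorial : ℝ) * n.descFactorial q = n.factorial := by
    exact_mod_cast Nat.factorial_mul_descFactorial (by omega : q ≤ n)
  have hP : ∏ s ∈ Finset.range (n + 1), (y + s) ≠ 0 :=
    Finset.prod_ne_zero_iff.mpr fun s _ => by positivity
  rw [Real.GammaSeq, gammaRatio, Nat.add_sub_cancel, ← hf, Real.div_rpow hn0.le (by positivity)]
  push_cast
  rw [Real.rpow_add (by positivity), Real.rpow_natCast]
  have h3 : (n : ℝ) ^ y ≠ 0 := by positivity
  have h4 : ((n : ℝ) + 1) ^ y ≠ 0 := by positivity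
  have h5 : (n.descFactorial q : ℝ) ≠ 0 := by
    intro h
    rw [h, mul_zero] at hf
    exact (Nat.cast_ne_zero.mpr n.factorial_ne_zero) hf.symm
  field_simp

/-- A bound that is uniform in `N`, from `1 + x ≤ exp x` and the growth of the harmonic numbers. -/
lemma gammaRatio_le {y : ℝ} (hy : 0 < y) {q N : ℕ} (hq : q < N) :
    gammaRatio y q N ≤ Real.exp (2 * y) := by
  obtain ⟨n, rfl⟩ : ∃ n, N = n + 1 := ⟨N - 1, by omega⟩
  have hprod : ∏ s ∈ Finset.range (n + 1), (y + s) ≤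
      y * (n.factorial * (Real.exp y * ((n : ℝ) + 1) ^ y)) := by
    rw [Finset.prod_range_succ', Nat.cast_zero, add_zero, mul_comm]
    refine mul_le_mul_of_nonneg_left ?_ hy.le
    have h1 : ∏ s ∈ Finset.range n, (y + (s + 1 : ℕ)) =
        n.factorial * ∏ s ∈ Finset.range n, (1 + y / ((s : ℝ) + 1)) := by
      rw [← Finset.prod_range_add_one_eq_factorial]
      push_cast
      rw [← Finset.prod_mul_distrib]
      refine Finset.prod_congr rfl fun s _ => ?_
      have : (s : ℝ) + 1 ≠ 0 := by positivity
      field_simp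
      ring
    rw [h1]
    refine mul_le_mul_of_nonneg_left ?_ (by positivity)
    calc ∏ s ∈ Finset.range n, (1 + y / ((s : ℝ) + 1))
        ≤ ∏ s ∈ Finset.range n, Real.exp (y / ((s : ℝ) + 1)) :=
          Finset.prod_le_prod (fun s _ => by positivity) fun s _ => by
            rw [add_comm]; exact Real.add_one_le_exp _
      _ = Real.exp (y * (harmonic n : ℚ)) := by
          rw [← Real.exp_sum, harmonic]
          push_cast
          rw [Finset.mul_sum]
          rfl
      _ ≤ Real.exp (y * (1 + Real.log ((n : ℝ) + 1))) := by
          refine Real.exp_le_exp.mpr (mul_le_mul_of_nonneg_left ?_ hy.le)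
          refine (harmonic_le_one_add_log n).trans ?_
          rcases Nat.eq_zero_or_pos n with rfl | hn
          · simp
          · have : (0 : ℝ) < n := by exact_mod_cast hn
            gcongr
            linarith
      _ = Real.exp y * ((n : ℝ) + 1) ^ y := by
          rw [Real.rpow_def_of_pos (by positivity), ← Real.exp_add]
          ring_nf
  have hf : ((n - q).factorial : ℝ) * n.descFactorial q = n.factorial := by
    exact_mod_cast Nat.factorial_mul_descFactorial (by omega : q ≤ n)
  have hd : (n.descFactorial q : ℝ) ≤ ((n : ℝ) + 1) ^ q := by
    calc (n.descFactorial q : ℝ) ≤ (n : ℝ) ^ q := by exact_mod_cast Nat.descFactorial_le_pow n q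
      _ ≤ ((n : ℝ) + 1) ^ q := by gcongr; linarith
  have hye : y ≤ Real.exp y := by linarith [Real.add_one_le_exp y]
  rw [gammaRatio, Nat.add_sub_cancel, div_le_iff₀ (by positivity)]
  refine hprod.trans ?_
  rw [← hf]
  push_cast
  rw [Real.rpow_add (by positivity), Real.rpow_natCast, two_mul, Real.exp_add]
  calc y * (((n - q).factorial : ℝ) * n.descFactorial q * (Real.exp y * ((n : ℝ) + 1) ^ y))
      ≤ Real.exp y * (((n - q).factorial : ℝ) * ((n : ℝ) + 1) ^ q *
        (Real.exp y * ((n : ℝ) + 1) ^ y)) := by gcongr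
    _ = _ := by ring

lemma Gamma_add_nat {y : ℝ} (hy : 0 < y) (t : ℕ) :
    Real.Gamma (y + t) = (∏ s ∈ Finset.range t, (y + s)) * Real.Gamma y := by
  induction t with
  | zero => simp
  | succ t ih =>
    rw [Nat.cast_succ, ← add_assoc, Real.Gamma_add_one (by positivity), ih,
      Finset.prod_range_succ]
    ring

section Kernel

variable (η θ a b : ℝ)

/-- A term of the double series for the hard-edge kernel. -/
def hardEdgeTerm (x y : ℝ) (p : ℕ × ℕ) : ℝ :=
  (-1) ^ (p.1 + p.2) * (η * θ) / (p.1.factorial * p.2.factorial) *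
    ((Real.Gamma ((a + η * p.1 + b) / θ))⁻¹ * (Real.Gamma ((a + (b + θ * p.2)) / η))⁻¹) /
    (a + η * p.1 + (b + θ * p.2)) * (x ^ (a + η * p.1 - 1 / 2) * y ^ (b + θ * p.2 - 1 / 2))

/-- The double series over the poles `a + η i` and `-(b + θ k)` to which the contour integrals for
the hard-edge kernel reduce. -/
def hardEdgeSeries (x y : ℝ) : ℝ := ∑' p : ℕ × ℕ, hardEdgeTerm η θ a b x y p

lemma hardEdgeSeries_swap (x y : ℝ) : hardEdgeSeries η θ a b x y = hardEdgeSeries θ η b a y x := by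
  rw [hardEdgeSeries, hardEdgeSeries, ← (Equiv.prodComm ℕ ℕ).tsum_eq]
  refine tsum_congr fun p => ?_
  simp only [hardEdgeTerm, Equiv.prodComm_apply, Prod.fst_swap, Prod.snd_swap]
  rw [add_comm p.2 p.1, show a + η * p.2 + (b + θ * p.1) = b + θ * p.1 + (a + η * p.2) by ring,
    show (a + η * p.2 + b) = b + (a + η * p.2) by ring, show a + (b + θ * p.1) = b + θ * p.1 + a by
    ring, mul_comm η θ, mul_comm (p.2.factorial : ℝ)]
  ring

variable {η θ a b}

/-- The rescaled coefficients in terms of `gammaRatio`: all powers of `N` cancel for the scaling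
exponent `1 / η + 1 / θ`. -/
lemma leftCoeff_mul_rightCoeff (hη : 0 < η) (hθ : 0 < θ) {c : ℝ}
    (hc0 : 0 < c) {t n i k : ℕ} (hc : c + θ * t = a + b) (hi : i < t + n) (hk : k < n) :
    leftCoeff η θ a b (t + n) n i * ((t + n : ℕ) : ℝ) ^ (-(1 / η + 1 / θ) * (a + η * i)) *
      (rightCoeff η θ a b (t + n) n k * ((t + n : ℕ) : ℝ) ^ (-(1 / η + 1 / θ) * (b + θ * k))) =
    (-1) ^ (i + k) * (η * θ) / (i.factorial * k.factorial) *
      (gammaRatio ((c + η * i) / θ) i (t + n) /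
        (∏ s ∈ Finset.range t, ((c + η * i) / θ + s)) *
        gammaRatio ((a + (b + θ * k)) / η) (t + k) (t + n)) := by
  have hN : (0 : ℝ) < (t + n : ℕ) := by exact_mod_cast (by omega : 0 < t + n)
  set y := (c + η * i) / θ with hy
  set w := (a + (b + θ * k)) / η with hw
  have hP1 : ∏ m ∈ Finset.range n, (a + η * i + (b + θ * m)) =
      θ ^ n * ∏ m ∈ Finset.range n, (y + (t + m : ℕ)) := by
    rw [← Finset.card_range n, ← Finset.prod_const, Finset.card_range, ← Finset.prod_mul_distrib]
    refine Finset.prod_congr rfl fun m _ => ?_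
    rw [hy]; push_cast
    field_simp
    linear_combination -hc
  have hP2 : ∏ l ∈ Finset.range (t + n), (a + η * l + (b + θ * k)) =
      η ^ (t + n) * ∏ l ∈ Finset.range (t + n), (w + l) := by
    rw [← Finset.card_range (t + n), ← Finset.prod_const, Finset.card_range,
      ← Finset.prod_mul_distrib]
    refine Finset.prod_congr rfl fun m _ => ?_
    rw [hw]
    field_simp
    ring
  have hP3 : ∏ s ∈ Finset.range (t + n), (y + s) =
      (∏ s ∈ Finset.range t, (y + s)) * ∏ m ∈ Finset.range n, (y + (t + m : ℕ)) :=
    Finset.prod_range_add _ _ _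
  have hPt : ∏ s ∈ Finset.range t, (y + s) ≠ 0 :=
    Finset.prod_ne_zero_iff.mpr fun s _ => by positivity
  have hpow : ((t + n : ℕ) : ℝ) ^ (-(1 / η + 1 / θ) * (a + η * i)) *
      ((t + n : ℕ) : ℝ) ^ (-(1 / η + 1 / θ) * (b + θ * k)) =
      (((t + n : ℕ) : ℝ) ^ (y + i) * ((t + n : ℕ) : ℝ) ^ (w + (t + k : ℕ)))⁻¹ := by
    rw [← Real.rpow_add hN, ← Real.rpow_add hN, ← Real.rpow_neg hN.le]
    congr 1
    rw [hy, hw]; push_cast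
    field_simp
    linear_combination η * hc
  have hs : ((-1 : ℝ) ^ i) * (-1) ^ i = 1 := by rw [← mul_pow]; norm_num
  have hs' : ((-1 : ℝ) ^ k) * (-1) ^ k = 1 := by rw [← mul_pow]; norm_num
  have hsn : ((-1 : ℝ) ^ i) ≠ 0 := pow_ne_zero _ (by norm_num)
  have hsn' : ((-1 : ℝ) ^ k) ≠ 0 := pow_ne_zero _ (by norm_num)
  rw [mul_mul_mul_comm, hpow, leftCoeff, rightCoeff, hP1, hP2, prod_erase_sub η hi,
    prod_erase_sub θ hk, gammaRatio, gammaRatio, hP3, pow_add (-1 : ℝ) i k,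
    show t + n - 1 - (t + k) = n - 1 - k by omega]
  obtain ⟨n', rfl⟩ : ∃ n', n = n' + 1 := ⟨n - 1, by omega⟩
  rw [Nat.add_sub_cancel, show t + (n' + 1) - 1 = t + n' by omega, pow_succ θ n',
    show t + (n' + 1) = t + n' + 1 by omega, pow_succ η (t + n')]
  generalize ∏ m ∈ Finset.range (n' + 1), (y + (t + m : ℕ)) = P1
  generalize ∏ l ∈ Finset.range (t + n' + 1), (w + l) = P2
  rw [show t + (n' + 1) = t + n' + 1 by omega] at hN
  have hq1 : ((t + n' + 1 : ℕ) : ℝ) ^ (y + i) ≠ 0 := (Real.rpow_pos_of_pos hN _).ne'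
  have hq2 : ((t + n' + 1 : ℕ) : ℝ) ^ (w + (t + k : ℕ)) ≠ 0 := (Real.rpow_pos_of_pos hN _).ne'
  generalize ((t + n' + 1 : ℕ) : ℝ) ^ (y + i) = q1 at *
  generalize ((t + n' + 1 : ℕ) : ℝ) ^ (w + (t + k : ℕ)) = q2 at *
  generalize ∏ s ∈ Finset.range t, (y + s) = P3 at *
  generalize (-1 : ℝ) ^ i = s1 at *
  generalize (-1 : ℝ) ^ k = s2 at *
  have h1 : ((t + n' - i).factorial : ℝ) ≠ 0 := by positivity
  have h2 : ((n' - k).factorial : ℝ) ≠ 0 := by positivity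
  have h3 : (i.factorial : ℝ) ≠ 0 := by positivity
  have h4 : (k.factorial : ℝ) ≠ 0 := by positivity
  field_simp
  linear_combination -P1 * P2 * s2 ^ 2 * hs - P1 * P2 * hs'

/-- The majorant, up to the factor `x ^ (a - 1 / 2) * y ^ (b - 1 / 2)`, of the terms of the double
series for the kernels, for arguments in `(0, r)`. -/
def hardEdgeMajorant (η θ a b c r : ℝ) (t : ℕ) (p : ℕ × ℕ) : ℝ :=
  η * θ / ((∏ s ∈ Finset.range t, (c / θ + s)) * (a + b)) *
    ((Real.exp (2 * c / θ) * ((Real.exp (2 * η / θ) * r ^ η) ^ p.1 / p.1.factorial)) *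
      (Real.exp (2 * (a + b) / η) * ((Real.exp (2 * θ / η) * r ^ θ) ^ p.2 / p.2.factorial)))

lemma summable_hardEdgeMajorant {c r : ℝ} (hr : 0 < r) (t : ℕ) :
    Summable (hardEdgeMajorant η θ a b c r t) := by
  refine Summable.mul_left _ (Summable.mul_of_nonneg
    (f := fun i : ℕ => Real.exp (2 * c / θ) * ((Real.exp (2 * η / θ) * r ^ η) ^ i / i.factorial))
    (g := fun k : ℕ => Real.exp (2 * (a + b) / η) *
      ((Real.exp (2 * θ / η) * r ^ θ) ^ k / k.factorial)) ?_ ?_ ?_ ?_)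
  · exact (Real.summable_pow_div_factorial _).mul_left _
  · exact (Real.summable_pow_div_factorial _).mul_left _
  · intro i; positivity
  · intro i; positivity

/-- The terms of `finiteKernel` after rescaling, extended by zero. -/
def finiteTerm (η θ a b c : ℝ) (t n : ℕ) (x y : ℝ) (p : ℕ × ℕ) : ℝ :=
  if p.1 < t + n ∧ p.2 < n then
    (-1) ^ (p.1 + p.2) * (η * θ) / (p.1.factorial * p.2.factorial) *
      (gammaRatio ((c + η * p.1) / θ) p.1 (t + n) /
        (∏ s ∈ Finset.range t, ((c + η * p.1) / θ + s)) *
        gammaRatio ((a + (b + θ * p.2)) / η) (t + p.2) (t + n)) /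
      (a + η * p.1 + (b + θ * p.2)) * (x ^ (a + η * p.1 - 1 / 2) * y ^ (b + θ * p.2 - 1 / 2))
  else 0

lemma finiteKernel_eq_tsum (hη : 0 < η) (hθ : 0 < θ) {c : ℝ}
    (hc0 : 0 < c) {t : ℕ} (hc : c + θ * t = a + b) (n : ℕ) (x y : ℝ) :
    finiteKernel η θ a b (((t + n : ℕ) : ℝ) ^ (-(1 / η + 1 / θ))) (t + n) n x y =
      ∑' p, finiteTerm η θ a b c t n x y p := by
  rw [tsum_eq_sum (s := Finset.range (t + n) ×ˢ Finset.range n), Finset.sum_product_right,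
    finiteKernel]
  · refine Finset.sum_congr rfl fun k hk => ?_
    rw [Finset.sum_mul]
    refine Finset.sum_congr rfl fun i hi => ?_
    rw [Finset.mem_range] at hk hi
    rw [finiteTerm, if_pos ⟨hi, hk⟩, ← leftCoeff_mul_rightCoeff hη hθ hc0 hc hi hk,
      ← Real.rpow_mul (Nat.cast_nonneg _), ← Real.rpow_mul (Nat.cast_nonneg _)]
    ring
  · intro p hp
    rw [Finset.mem_product, Finset.mem_range, Finset.mem_range] at hp
    exact if_neg hp

lemma abs_finiteTerm_le (hη : 0 < η) (hθ : 0 < θ) (ha : 0 < a) (hb : 0 < b) {c r : ℝ}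
    (hc0 : 0 < c) (t n : ℕ) {x y : ℝ} (hx : x ∈ Set.Ioo 0 r) (hy : y ∈ Set.Ioo 0 r) (p : ℕ × ℕ) :
    |finiteTerm η θ a b c t n x y p| ≤
      hardEdgeMajorant η θ a b c r t p * (x ^ (a - 1 / 2) * y ^ (b - 1 / 2)) := by
  obtain ⟨i, k⟩ := p
  have hr : 0 < r := hx.1.trans hx.2
  have hx0 := hx.1
  have hy0 := hy.1
  have hP : 0 < ∏ s ∈ Finset.range t, (c / θ + s) := Finset.prod_pos fun s _ => by positivity
  have hP' : 0 < ∏ s ∈ Finset.range t, ((c + η * i) / θ + s) :=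
    Finset.prod_pos fun s _ => by positivity
  rw [finiteTerm]
  split_ifs with h
  · have hg1 := gammaRatio_nonneg (y := (c + η * i) / θ) (by positivity) i (t + n)
    have hg2 := gammaRatio_nonneg (y := (a + (b + θ * k)) / η) (by positivity) (t + k) (t + n)
    have hb1 := gammaRatio_le (y := (c + η * i) / θ) (by positivity) h.1
    have hb2 := gammaRatio_le (y := (a + (b + θ * k)) / η) (by positivity)
      (by have := h.2; dsimp only at this; omega : t + k < t + n)
    have hPP : ∏ s ∈ Finset.range t, (c / θ + s) ≤ ∏ s ∈ Finset.range t, ((c + η * i) / θ + s) := by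
      refine Finset.prod_le_prod (fun s _ => by positivity) fun s _ => ?_
      gcongr
      exact le_add_of_nonneg_right (by positivity)
    have hxp : x ^ (a + η * i - 1 / 2) ≤ x ^ (a - 1 / 2) * (r ^ η) ^ i := by
      rw [show a + η * i - 1 / 2 = a - 1 / 2 + η * i by ring, Real.rpow_add hx0, ← Real.rpow_natCast,
        ← Real.rpow_mul hr.le]
      have := hx.2.le
      gcongr
    have hyp : y ^ (b + θ * k - 1 / 2) ≤ y ^ (b - 1 / 2) * (r ^ θ) ^ k := by
      rw [show b + θ * k - 1 / 2 = b - 1 / 2 + θ * k by ring, Real.rpow_add hy0, ← Real.rpow_natCast,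
        ← Real.rpow_mul hr.le]
      have := hy.2.le
      gcongr
    rw [abs_mul, abs_div, abs_mul, abs_div, abs_mul, abs_pow, abs_neg, abs_one, one_pow, one_mul,
      abs_of_pos (mul_pos hη hθ), abs_of_pos (by positivity :
        (0 : ℝ) < (i.factorial : ℝ) * k.factorial),
      abs_of_nonneg (mul_nonneg (div_nonneg hg1 hP'.le) hg2),
      abs_of_pos (by positivity : 0 < a + η * i + (b + θ * k)),
      abs_of_pos (by positivity : 0 < x ^ (a + η * i - 1 / 2) * y ^ (b + θ * k - 1 / 2))]
    calc _ ≤ η * θ / (i.factorial * k.factorial) *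
        (Real.exp (2 * ((c + η * i) / θ)) / (∏ s ∈ Finset.range t, (c / θ + s)) *
          Real.exp (2 * ((a + (b + θ * k)) / η))) / (a + b) *
        ((x ^ (a - 1 / 2) * (r ^ η) ^ i) * (y ^ (b - 1 / 2) * (r ^ θ) ^ k)) := by
          have : a + b ≤ a + η * i + (b + θ * k) := by
            have h1 : 0 ≤ η * i := by positivity
            have h2 : 0 ≤ θ * k := by positivity
            linarith
          gcongr
      _ = _ := by
          rw [hardEdgeMajorant, mul_pow, mul_pow, ← Real.exp_nat_mul, ← Real.exp_nat_mul,
            show 2 * ((c + η * i) / θ) = 2 * c / θ + i * (2 * η / θ) by ring,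
            show 2 * ((a + (b + θ * k)) / η) = 2 * (a + b) / η + k * (2 * θ / η) by ring,
            Real.exp_add, Real.exp_add]
          have : a + b ≠ 0 := by positivity
          field_simp
  · rw [abs_zero, hardEdgeMajorant]
    positivity

lemma tendsto_finiteTerm (hη : 0 < η) (hθ : 0 < θ) (ha : 0 < a) (hb : 0 < b) {c : ℝ}
    (hc0 : 0 < c) {t : ℕ} (hc : c + θ * t = a + b) (x y : ℝ) (p : ℕ × ℕ) :
    Tendsto (fun n => finiteTerm η θ a b c t n x y p) atTop (𝓝 (hardEdgeTerm η θ a b x y p)) := by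
  obtain ⟨i, k⟩ := p
  have htn : Tendsto (fun n => t + n) atTop atTop := tendsto_atTop_mono (fun n => Nat.le_add_left n t) tendsto_id
  have h1 := (tendsto_gammaRatio (y := (c + η * i) / θ) (by positivity) i).comp htn
  have h2 := (tendsto_gammaRatio (y := (a + (b + θ * k)) / η) (by positivity) (t + k)).comp htn
  have hG : Real.Gamma ((a + η * i + b) / θ) =
      (∏ s ∈ Finset.range t, ((c + η * i) / θ + s)) * Real.Gamma ((c + η * i) / θ) := by
    rw [← Gamma_add_nat (by positivity)]
    congr 1
    field_simp
    linear_combination -hc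
  have h3 := ((((h1.div_const (∏ s ∈ Finset.range t, ((c + η * i) / θ + s))).mul h2).const_mul
    ((-1) ^ (i + k) * (η * θ) / ((i.factorial : ℝ) * k.factorial))).div_const
    (a + η * i + (b + θ * k))).mul_const (x ^ (a + η * i - 1 / 2) * y ^ (b + θ * k - 1 / 2))
  rw [hardEdgeTerm, hG, mul_inv, mul_comm (∏ s ∈ Finset.range t, ((c + η * i) / θ + s))⁻¹,
    ← div_eq_mul_inv]
  refine h3.congr' ?_
  filter_upwards [eventually_gt_atTop (max i k)] with n hn
  rw [finiteTerm, if_pos ⟨by dsimp only; omega, by dsimp only; omega⟩]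
  rfl

/-- The Fredholm series of the rescaled finite kernels converge to that of the hard-edge series. -/
theorem tendsto_fredholm_finiteKernel (hη : 0 < η) (hθ : 0 < θ) (ha : 0 < a) (hb : 0 < b) {c r : ℝ}
    (hc0 : 0 < c) {t : ℕ} (hc : c + θ * t = a + b) (hr : 0 < r) :
    (∀ m, Integrable (fun x : Fin m → ℝ =>
        (Matrix.of fun i j => hardEdgeSeries η θ a b (x i) (x j)).det)
        (Measure.pi fun _ => volume.restrict (Set.Ioo 0 r))) ∧
      Summable (fredholmTerm (volume.restrict (Set.Ioo 0 r)) (hardEdgeSeries η θ a b)) ∧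
      Tendsto (fun n => ∑' m, fredholmTerm (volume.restrict (Set.Ioo 0 r))
        (finiteKernel η θ a b (((t + n : ℕ) : ℝ) ^ (-(1 / η + 1 / θ))) (t + n) n) m) atTop
        (𝓝 (∑' m, fredholmTerm (volume.restrict (Set.Ioo 0 r)) (hardEdgeSeries η θ a b) m)) := by
  have hM := summable_hardEdgeMajorant (η := η) (θ := θ) (a := a) (b := b) (c := c) hr t
  have hM0 : ∀ p, 0 ≤ hardEdgeMajorant η θ a b c r t p := by
    intro p
    have hP : 0 < ∏ s ∈ Finset.range t, (c / θ + s) := Finset.prod_pos fun s _ => by positivity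
    rw [hardEdgeMajorant]
    positivity
  set C := ∑' p, hardEdgeMajorant η θ a b c r t p with hC
  have hC0 : 0 ≤ C := tsum_nonneg hM0
  refine fredholm_limit (u := fun x => (C + 1) * x ^ (a - 1 / 2)) (v := fun y => y ^ (b - 1 / 2))
    measurableSet_Ioo ?_ ?_ ?_ ?_ ?_ ?_
  · intro n
    unfold finiteKernel Function.uncurry
    fun_prop
  · intro x hx
    have := hx.1
    positivity
  · intro x hx
    exact Real.rpow_pos_of_pos hx.1 _
  · have h1 : IntegrableOn (fun x : ℝ => (C + 1) * x ^ (a + b - 1)) (Set.Ioo 0 r) :=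
      Integrable.const_mul ((intervalIntegral.integrableOn_Ioo_rpow_iff hr).mpr (by linarith)) _
    refine h1.congr_fun (fun x hx => ?_) measurableSet_Ioo
    dsimp only
    rw [mul_assoc, ← Real.rpow_add hx.1]
    ring_nf
  · intro n x hx y hy
    rw [finiteKernel_eq_tsum hη hθ hc0 hc]
    have hx0 := hx.1
    have hy0 := hy.1
    have h1 := tsum_of_norm_bounded (f := finiteTerm η θ a b c t n x y)
      (hM.mul_right (x ^ (a - 1 / 2) * y ^ (b - 1 / 2))).hasSum
      (fun p => abs_finiteTerm_le hη hθ ha hb hc0 t n hx hy p)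
    rw [tsum_mul_right, Real.norm_eq_abs] at h1
    refine h1.trans ?_
    rw [← hC, ← mul_assoc]
    gcongr
    linarith
  · intro x hx y hy
    have h1 := tendsto_tsum_of_dominated_convergence
      (hM.mul_right (x ^ (a - 1 / 2) * y ^ (b - 1 / 2)))
      (fun p => tendsto_finiteTerm hη hθ ha hb hc0 hc x y p)
      (Eventually.of_forall fun n p => abs_finiteTerm_le hη hθ ha hb hc0 t n hx hy p)
    simp only [finiteKernel_eq_tsum hη hθ hc0 hc]
    exact h1

end Kernel

/-! ### The Gamma function as a sum over its poles plus an entire function -/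

/-- The upper incomplete Gamma function `Γ(s, 1)`. -/
def upperGamma (s : ℂ) : ℂ := ∫ t : ℝ in Set.Ioi 1, (Real.exp (-t) : ℂ) * (t : ℂ) ^ (s - 1)

lemma norm_upperGamma_integrand (s : ℂ) {t : ℝ} (ht : 0 < t) :
    ‖(Real.exp (-t) : ℂ) * (t : ℂ) ^ (s - 1)‖ = Real.exp (-t) * t ^ (s.re - 1) := by
  rw [norm_mul, Complex.norm_real, Real.norm_of_nonneg (Real.exp_pos _).le,
    Complex.norm_cpow_eq_rpow_re_of_pos ht]
  simp

lemma integrableOn_exp_neg_mul_rpow (σ : ℝ) :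
    IntegrableOn (fun t : ℝ => Real.exp (-t) * t ^ σ) (Set.Ioi 1) := by
  refine integrable_of_isBigO_exp_neg (b := 1 / 2) (by norm_num) ?_
    (Real.Gamma_integrand_isLittleO σ).isBigO
  refine ContinuousOn.mul (by fun_prop) ?_
  exact continuousOn_id.rpow_const fun t ht =>
    Or.inl (zero_lt_one.trans_le (Set.mem_Ici.mp ht)).ne'

lemma integrableOn_upperGamma (s : ℂ) :
    IntegrableOn (fun t : ℝ => (Real.exp (-t) : ℂ) * (t : ℂ) ^ (s - 1)) (Set.Ioi 1) := by
  refine Integrable.mono' (integrableOn_exp_neg_mul_rpow (s.re - 1)) ?_ ?_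
  · refine ContinuousOn.aestronglyMeasurable ?_ measurableSet_Ioi
    refine ContinuousOn.mul (by fun_prop) ?_
    refine ContinuousOn.cpow_const (by fun_prop) fun t ht => ?_
    exact Or.inl (by simpa using zero_lt_one.trans (Set.mem_Ioi.mp ht))
  · filter_upwards [ae_restrict_mem measurableSet_Ioi] with t ht
    exact (norm_upperGamma_integrand s (zero_lt_one.trans ht)).le

lemma norm_upperGamma_le {s : ℂ} {σ : ℝ} (hs : s.re ≤ σ) :
    ‖upperGamma s‖ ≤ ∫ t : ℝ in Set.Ioi 1, Real.exp (-t) * t ^ (σ - 1) := by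
  refine norm_integral_le_of_norm_le (integrableOn_exp_neg_mul_rpow (σ - 1)) ?_
  filter_upwards [ae_restrict_mem measurableSet_Ioi] with t ht
  have ht' : (1 : ℝ) < t := ht
  rw [norm_upperGamma_integrand s (by linarith)]
  gcongr
  exact ht'.le

lemma differentiable_upperGamma : Differentiable ℂ upperGamma := by
  set f : ℝ → ℂ := (Set.Ioi 1).indicator fun t : ℝ => (Real.exp (-t) : ℂ) with hf
  have h1 : upperGamma = mellin f := by
    ext s
    rw [upperGamma, mellin, ← integral_indicator measurableSet_Ioi,
      ← integral_indicator measurableSet_Ioi]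
    congr 1
    ext t
    by_cases ht : t ∈ Set.Ioi (1 : ℝ)
    · have ht0 : t ∈ Set.Ioi (0 : ℝ) := zero_lt_one.trans (Set.mem_Ioi.mp ht)
      rw [Set.indicator_of_mem ht, Set.indicator_of_mem ht0, hf, Set.indicator_of_mem ht,
        smul_eq_mul, mul_comm]
    · rw [Set.indicator_of_notMem ht, hf]
      by_cases ht0 : t ∈ Set.Ioi (0 : ℝ)
      · rw [Set.indicator_of_mem ht0, Set.indicator_of_notMem ht, smul_zero]
      · rw [Set.indicator_of_notMem ht0]
  rw [h1]
  intro s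
  refine mellin_differentiableAt_of_isBigO_rpow (a := s.re + 1) (b := s.re - 1) ?_ ?_ (by linarith)
    ?_ (by linarith)
  · have : LocallyIntegrable f := by
      refine Continuous.locallyIntegrable (f := fun t : ℝ => (Real.exp (-t) : ℂ)) (by fun_prop)
        |>.indicator measurableSet_Ioi
    exact this.locallyIntegrableOn _
  · have h2 : f =O[atTop] fun t : ℝ => Real.exp (-1 * t) := by
      refine Asymptotics.IsBigO.of_bound 1 (Eventually.of_forall fun t => ?_)
      rw [hf, one_mul, neg_one_mul]
      refine (norm_indicator_le_norm_self _ _).trans ?_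
      rw [Complex.norm_real]
    exact h2.trans (isLittleO_exp_neg_mul_rpow_atTop one_pos _).isBigO
  · refine Asymptotics.IsBigO.of_bound 1 ?_
    filter_upwards [Ioo_mem_nhdsGT (zero_lt_one (α := ℝ))] with t ht
    rw [hf, Set.indicator_of_notMem (fun h => lt_asymm ht.2 (Set.mem_Ioi.mp h)), norm_zero, one_mul]
    exact norm_nonneg _

lemma upperGamma_add_one (s : ℂ) :
    upperGamma (s + 1) = s * upperGamma s + (Real.exp (-1) : ℂ) := by
  have hder : ∀ t ∈ Set.Ici (1 : ℝ), HasDerivAt (fun t : ℝ => -((Real.exp (-t) : ℂ) * (t : ℂ) ^ s))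
      ((Real.exp (-t) : ℂ) * (t : ℂ) ^ (s + 1 - 1) -
        s * ((Real.exp (-t) : ℂ) * (t : ℂ) ^ (s - 1))) t := by
    intro t ht
    have ht0 : (0 : ℝ) < t := zero_lt_one.trans_le ht
    have h1 : HasDerivAt (fun t : ℝ => (Real.exp (-t) : ℂ)) (-(Real.exp (-t)) : ℂ) t := by
      have h2 : HasDerivAt (fun t : ℝ => Real.exp (-t)) (-(Real.exp (-t))) t := by
        simpa using (hasDerivAt_neg t).exp
      simpa using h2.ofReal_comp
    have h3 : HasDerivAt (fun t : ℝ => (t : ℂ) ^ s) (s * (t : ℂ) ^ (s - 1)) t := by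
      have h4 := (hasDerivAt_id (t : ℂ)).cpow_const (c := s) (Or.inl (by simpa using ht0))
      simpa using h4.comp_ofReal
    refine ((h1.mul h3).neg).congr_deriv ?_
    rw [add_sub_cancel_right]
    ring
  have hint1 := integrableOn_upperGamma (s + 1)
  have hint2 := (integrableOn_upperGamma s).const_mul s
  have hlim : Tendsto (fun t : ℝ => -((Real.exp (-t) : ℂ) * (t : ℂ) ^ s)) atTop (𝓝 0) := by
    rw [tendsto_zero_iff_norm_tendsto_zero]
    have h1 : Tendsto (fun t : ℝ => Real.exp (-t) * t ^ s.re) atTop (𝓝 0) := by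
      refine (Real.Gamma_integrand_isLittleO s.re).trans_tendsto ?_
      refine Real.tendsto_exp_atBot.comp ?_
      exact tendsto_id.const_mul_atTop_of_neg (by norm_num)
    refine h1.congr' ?_
    filter_upwards [eventually_gt_atTop 0] with t ht
    rw [norm_neg, norm_mul, Complex.norm_real, Real.norm_of_nonneg (Real.exp_pos _).le,
      Complex.norm_cpow_eq_rpow_re_of_pos ht]
  have h := integral_Ioi_of_hasDerivAt_of_tendsto' hder (hint1.sub hint2) hlim
  rw [integral_sub hint1 hint2, integral_const_mul] at h
  rw [upperGamma, upperGamma]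
  rw [sub_eq_iff_eq_add] at h
  rw [h]
  simp
  ring

lemma hasSum_Gamma_sub_upperGamma_of_re_pos {s : ℂ} (hs : 0 < s.re) :
    HasSum (fun j : ℕ => (-1) ^ j / ((j.factorial : ℂ) * (s + j)))
      (Complex.Gamma s - upperGamma s) := by
  have h1 : Complex.Gamma s - upperGamma s =
      ∫ t : ℝ in Set.Ioc 0 1, (Real.exp (-t) : ℂ) * (t : ℂ) ^ (s - 1) := by
    have hc := Complex.GammaIntegral_convergent hs
    have hc' : IntegrableOn (fun t : ℝ => (Real.exp (-t) : ℂ) * (t : ℂ) ^ (s - 1)) (Set.Ioi 0) := by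
      simpa using hc
    rw [Complex.Gamma_eq_integral hs, Complex.GammaIntegral, upperGamma,
      ← Set.Ioc_union_Ioi_eq_Ioi (zero_le_one (α := ℝ)), setIntegral_union
        Set.Ioc_disjoint_Ioi_same measurableSet_Ioi
        (hc'.mono_set Set.Ioc_subset_Ioi_self) (integrableOn_upperGamma s), add_sub_cancel_right]
  have hint : IntegrableOn (fun t : ℝ => t ^ (s.re - 1)) (Set.Ioc 0 1) := by
    rw [← intervalIntegrable_iff_integrableOn_Ioc_of_le zero_le_one]
    exact intervalIntegral.intervalIntegrable_rpow' (by linarith)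
  have hexp : ∀ z : ℂ, HasSum (fun j : ℕ => z ^ j / (j.factorial : ℂ)) (Complex.exp z) := by
    intro z
    rw [Complex.exp_eq_exp_ℂ]
    exact NormedSpace.expSeries_div_hasSum_exp z
  have h2 : HasSum (fun j : ℕ => ∫ t : ℝ in Set.Ioc 0 1,
      (-(t : ℂ)) ^ j / (j.factorial : ℂ) * (t : ℂ) ^ (s - 1))
      (∫ t : ℝ in Set.Ioc 0 1, (Real.exp (-t) : ℂ) * (t : ℂ) ^ (s - 1)) := by
    refine hasSum_integral_of_dominated_convergence
      (fun j t => 1 ^ j / (j.factorial : ℝ) * t ^ (s.re - 1)) ?_ ?_ ?_ ?_ ?_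
    · intro j
      refine ContinuousOn.aestronglyMeasurable ?_ measurableSet_Ioc
      refine ContinuousOn.mul (by fun_prop) ?_
      refine ContinuousOn.cpow_const (by fun_prop) fun t ht => ?_
      exact Or.inl (by simpa using ht.1)
    · intro j
      filter_upwards [ae_restrict_mem measurableSet_Ioc] with t ht
      rw [norm_mul, Complex.norm_cpow_eq_rpow_re_of_pos ht.1, norm_div, norm_pow, norm_neg,
        Complex.norm_real, Real.norm_of_nonneg ht.1.le, Complex.norm_natCast, Complex.sub_re,
        Complex.one_re]
      have := ht.1.le
      have := ht.2
      have : (0 : ℝ) ≤ t ^ (s.re - 1) := by positivity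
      gcongr
    · exact Eventually.of_forall fun t => (Real.summable_pow_div_factorial 1).mul_right _
    · simp_rw [tsum_mul_right]
      exact Integrable.const_mul hint _
    · refine Eventually.of_forall fun t => ?_
      have := (hexp (-(t : ℂ))).mul_right ((t : ℂ) ^ (s - 1))
      simpa using this
  rw [h1]
  refine h2.congr_fun ?_
  intro j
  have h3 : ∀ t ∈ Set.Ioc (0 : ℝ) 1, (-(t : ℂ)) ^ j / (j.factorial : ℂ) * (t : ℂ) ^ (s - 1) =
      (-1) ^ j / (j.factorial : ℂ) * (t : ℂ) ^ (s + j - 1) := by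
    intro t ht
    have ht0 : (t : ℂ) ≠ 0 := by exact_mod_cast ht.1.ne'
    rw [show s + j - 1 = j + (s - 1) by ring, Complex.cpow_add _ _ ht0, Complex.cpow_natCast,
      neg_pow]
    ring
  rw [setIntegral_congr_fun measurableSet_Ioc h3, integral_const_mul,
    ← intervalIntegral.integral_of_le zero_le_one, integral_cpow (Or.inl (by
      have : (0 : ℝ) ≤ j := Nat.cast_nonneg j
      simp; linarith))]
  have h4 : s + j ≠ 0 := by
    intro h
    have := congrArg Complex.re h
    simp at this
    have : (0 : ℝ) ≤ j := Nat.cast_nonneg j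
    linarith
  rw [sub_add_cancel, Complex.ofReal_one, Complex.one_cpow, Complex.ofReal_zero,
    Complex.zero_cpow h4, sub_zero]
  field_simp

/-- The Mittag-Leffler expansion of the Gamma function, extended to the left by the functional
equation. -/
theorem hasSum_Gamma_sub_upperGamma {s : ℂ} (hs : ∀ m : ℕ, s ≠ -m) :
    HasSum (fun j : ℕ => (-1) ^ j / ((j.factorial : ℂ) * (s + j)))
      (Complex.Gamma s - upperGamma s) := by
  obtain ⟨n, hn⟩ := exists_nat_gt (-s.re)
  induction n generalizing s with
  | zero =>
    exact hasSum_Gamma_sub_upperGamma_of_re_pos (by simpa using hn)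
  | succ n ih =>
    have hs0 : s ≠ 0 := by simpa using hs 0
    have h1 := ih (s := s + 1) (fun m h => hs (m + 1) (by push_cast; linear_combination h)) (by
      push_cast at hn
      simp; linarith)
    -- `s / (s + j) = 1 - j / (s + j)` turns the expansion at `s` into the one at `s + 1`
    have h2 : HasSum (fun j : ℕ => if j = 0 then (0 : ℂ) else
        (-1) ^ (j - 1) / (((j - 1).factorial : ℂ) * (s + j)))
        (Complex.Gamma (s + 1) - upperGamma (s + 1)) := by
      rw [← hasSum_nat_add_iff' 1]
      simp only [Finset.range_one, Finset.sum_singleton, if_true, sub_zero]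
      refine h1.congr_fun ?_
      intro j
      rw [if_neg (Nat.succ_ne_zero j), Nat.add_sub_cancel]
      push_cast
      ring
    have h3 : HasSum (fun j : ℕ => (-1 : ℂ) ^ j / (j.factorial : ℂ)) (Complex.exp (-1)) := by
      rw [Complex.exp_eq_exp_ℂ]
      exact NormedSpace.expSeries_div_hasSum_exp (-1)
    have h4 := (h2.add h3).div_const s
    rw [Complex.Gamma_add_one s hs0, upperGamma_add_one] at h4
    have h5 : (s * Complex.Gamma s - (s * upperGamma s + (Real.exp (-1) : ℂ)) +
        Complex.exp (-1)) / s = Complex.Gamma s - upperGamma s := by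
      push_cast
      field_simp
      ring
    rw [h5] at h4
    refine h4.congr_fun ?_
    intro j
    have hsj : s + j ≠ 0 := fun h => hs j (eq_neg_of_add_eq_zero_left h)
    rcases j with _ | j
    · simp
    · rw [if_neg (Nat.succ_ne_zero j), Nat.add_sub_cancel, Nat.factorial_succ]
      push_cast at hsj ⊢
      have : (j : ℂ) + 1 ≠ 0 := by exact_mod_cast Nat.succ_ne_zero j
      have : (j.factorial : ℂ) ≠ 0 := by exact_mod_cast j.factorial_ne_zero
      field_simp
      ring

/-- The reciprocal Gamma function decays faster than any exponential to the right of a vertical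
line, in horizontal strips: shifting by one multiplies `exp (B z) / Γ(z)` by `exp B / z`. -/
lemma exists_norm_Gamma_inv_le (B H : ℝ) : ∃ C, 0 ≤ C ∧ ∀ z : ℂ, 0 ≤ z.re → |z.im| ≤ H →
    ‖(Complex.Gamma z)⁻¹‖ ≤ C * Real.exp (-B * z.re) := by
  set g : ℂ → ℂ := fun z => Complex.exp (B * z) * (Complex.Gamma z)⁻¹ with hg
  have hgd : Continuous g := by
    have := Complex.differentiable_one_div_Gamma.continuous
    fun_prop
  set M := Real.exp B + 1 with hM
  have hM1 : 1 ≤ M := by rw [hM]; linarith [Real.exp_pos B]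
  obtain ⟨C, hC⟩ := ((isCompact_Icc (a := (0 : ℝ)) (b := M + 1)).reProdIm
    (isCompact_Icc (a := -H) (b := H))).exists_bound_of_continuousOn hgd.continuousOn
  have hrec : ∀ z : ℂ, g (z + 1) * z = Complex.exp B * g z := by
    intro z
    rw [hg]
    dsimp only
    rw [Complex.one_div_Gamma_eq_self_mul_one_div_Gamma_add_one z, mul_add, Complex.exp_add, mul_one]
    ring
  have hind : ∀ n : ℕ, ∀ z : ℂ, 0 ≤ z.re → |z.im| ≤ H → z.re ≤ M + 1 + n → ‖g z‖ ≤ C := by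
    intro n
    induction n with
    | zero =>
      intro z h0 h1 h2
      refine hC z ⟨⟨h0, by simpa using h2⟩, abs_le.mp h1⟩
    | succ n ih =>
      intro z h0 h1 h2
      rcases le_or_gt z.re (M + 1) with h3 | h3
      · exact hC z ⟨⟨h0, h3⟩, abs_le.mp h1⟩
      · push_cast at h2
        have h4 := ih (z - 1) (by simp; linarith) (by simpa using h1) (by simp; linarith)
        have h5 := hrec (z - 1)
        rw [sub_add_cancel] at h5
        have h6 := congrArg norm h5
        rw [norm_mul (g z), norm_mul (Complex.exp B), Complex.norm_exp, Complex.ofReal_re] at h6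
        have h7 : Real.exp B ≤ ‖z - 1‖ := by
          have := Complex.re_le_norm (z - 1)
          simp at this
          linarith
        have h8 : ‖g z‖ * Real.exp B ≤ C * Real.exp B := by
          calc ‖g z‖ * Real.exp B ≤ ‖g z‖ * ‖z - 1‖ := by gcongr
            _ = Real.exp B * ‖g (z - 1)‖ := h6
            _ ≤ Real.exp B * C := by gcongr
            _ = _ := mul_comm _ _
        exact le_of_mul_le_mul_right h8 (Real.exp_pos B)
  refine ⟨max C 0, le_max_right _ _, fun z h0 h1 => ?_⟩
  obtain ⟨n, hn⟩ := exists_nat_ge z.re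
  have h2 := hind n z h0 h1 (by linarith)
  rw [hg] at h2
  dsimp only at h2
  rw [norm_mul, Complex.norm_exp, Complex.re_ofReal_mul] at h2
  rw [neg_mul, Real.exp_neg, ← div_eq_mul_inv, le_div_iff₀ (Real.exp_pos _), mul_comm]
  exact h2.trans (le_max_left _ _)

/-! ### Residue calculus on Hankel contours -/

/-- The set of points of the contour of `hankelLeft δ h`. -/
def leftContour (δ h : ℝ) : Set ℂ :=
  {ω | ω.re ≤ -δ ∧ |ω.im| ≤ h ∧ (ω.re = -δ ∨ |ω.im| = h)}

section Contour

variable {δ h : ℝ}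

lemma sub_mem_leftContour (hh : 0 < h) {τ : ℝ} (hτ : τ ≤ -δ) :
    (τ : ℂ) - h * Complex.I ∈ leftContour δ h := by
  simp [leftContour, hτ, abs_of_pos hh]

lemma add_mem_leftContour (hh : 0 < h) {τ : ℝ} (hτ : τ ≤ -δ) :
    (τ : ℂ) + h * Complex.I ∈ leftContour δ h := by
  simp [leftContour, hτ, abs_of_pos hh]

lemma vertical_mem_leftContour {v : ℝ} (hv : |v| ≤ h) :
    -(δ : ℂ) + v * Complex.I ∈ leftContour δ h := by
  simp [leftContour, hv]

lemma abs_le_of_mem_uIoc (hh : 0 < h) {v : ℝ} (hv : v ∈ Set.uIoc (-h) h) : |v| ≤ h := by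
  rw [Set.uIoc_of_le (by linarith)] at hv
  exact abs_le.mpr ⟨hv.1.le, hv.2⟩

lemma abs_le_of_mem_uIcc (hh : 0 < h) {v : ℝ} (hv : v ∈ Set.uIcc (-h) h) : |v| ≤ h := by
  rw [Set.uIcc_of_le (by linarith)] at hv
  exact abs_le.mpr hv

lemma hankelLeft_congr (hh : 0 < h) {f g : ℂ → ℂ} (hfg : ∀ ω ∈ leftContour δ h, f ω = g ω) :
    hankelLeft δ h f = hankelLeft δ h g := by
  rw [hankelLeft, hankelLeft,
    setIntegral_congr_fun measurableSet_Iio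
      (fun τ hτ => hfg _ (sub_mem_leftContour hh (Set.mem_Iio.mp hτ).le)),
    setIntegral_congr_fun measurableSet_Iio
      (fun τ hτ => hfg _ (add_mem_leftContour hh (Set.mem_Iio.mp hτ).le)),
    intervalIntegral.integral_congr
      (fun v hv => hfg _ (vertical_mem_leftContour (abs_le_of_mem_uIcc hh hv)))]

/-- Both Hankel contours are exchanged by `z ↦ -z`. -/
lemma hankelRight_eq_hankelLeft (f : ℂ → ℂ) :
    hankelRight δ h f = hankelLeft δ h fun ω => f (-ω) := by
  have h1 : ∫ τ in Set.Iio (-δ), f (-((τ : ℂ) - h * Complex.I)) =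
      ∫ τ in Set.Ioi δ, f (τ + h * Complex.I) := by
    rw [← integral_Iic_eq_integral_Iio, ← integral_comp_neg_Ioi]
    refine setIntegral_congr_fun measurableSet_Ioi fun τ _ => ?_
    congr 1
    push_cast
    ring
  have h2 : ∫ τ in Set.Iio (-δ), f (-((τ : ℂ) + h * Complex.I)) =
      ∫ τ in Set.Ioi δ, f (τ - h * Complex.I) := by
    rw [← integral_Iic_eq_integral_Iio, ← integral_comp_neg_Ioi]
    refine setIntegral_congr_fun measurableSet_Ioi fun τ _ => ?_
    congr 1
    push_cast
    ring
  have h3 : ∫ v in (-h)..h, f (-(-(δ : ℂ) + v * Complex.I)) =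
      ∫ v in (-h)..h, f (δ + v * Complex.I) := by
    have h4 := intervalIntegral.integral_comp_neg (a := -h) (b := h)
      (fun v : ℝ => f (δ + v * Complex.I))
    rw [neg_neg] at h4
    rw [← h4]
    refine intervalIntegral.integral_congr fun v _ => ?_
    congr 1
    push_cast
    ring
  rw [hankelLeft, h1, h2, h3, hankelRight]
  ring

lemma le_norm_sub_of_mem_leftContour {κ w : ℝ} (h1 : κ ≤ h) (h2 : κ ≤ -δ - w) {ω : ℂ}
    (hω : ω ∈ leftContour δ h) : κ ≤ ‖ω - w‖ := by
  rcases hω.2.2 with h3 | h3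
  · have := Complex.re_le_norm (ω - w)
    simp at this
    linarith
  · have := Complex.abs_im_le_norm (ω - w)
    simp at this
    linarith

lemma hasSum_hankelLeft (hh : 0 < h) {g : ℕ → ℂ → ℂ} {G : ℂ → ℂ} {c : ℕ → ℝ}
    (hg : ∀ j, ContinuousOn (g j) (leftContour δ h))
    (hb : ∀ j, ∀ ω ∈ leftContour δ h, ‖g j ω‖ ≤ c j * Real.exp ω.re) (hc : Summable c)
    (hG : ∀ ω ∈ leftContour δ h, HasSum (fun j => g j ω) (G ω)) :
    HasSum (fun j => hankelLeft δ h (g j)) (hankelLeft δ h G) := by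
  have hexp : IntegrableOn (fun τ : ℝ => ∑' j, c j * Real.exp τ) (Set.Iio (-δ)) := by
    simp_rw [tsum_mul_right]
    exact Integrable.const_mul ((integrableOn_exp_Iic (-δ)).mono_set Set.Iio_subset_Iic_self) _
  have key : ∀ γ : ℝ → ℂ, Continuous γ → (∀ τ, (γ τ).re = τ) →
      (∀ τ ∈ Set.Iio (-δ), γ τ ∈ leftContour δ h) →
      HasSum (fun j => ∫ τ in Set.Iio (-δ), g j (γ τ)) (∫ τ in Set.Iio (-δ), G (γ τ)) := by
    intro γ hγ hre hmem
    refine hasSum_integral_of_dominated_convergence (fun j τ => c j * Real.exp τ) ?_ ?_ ?_ hexp ?_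
    · intro j
      exact ((hg j).comp hγ.continuousOn hmem).aestronglyMeasurable measurableSet_Iio
    · intro j
      filter_upwards [ae_restrict_mem measurableSet_Iio] with τ hτ
      have := hb j _ (hmem τ hτ)
      rwa [hre] at this
    · exact Eventually.of_forall fun τ => hc.mul_right _
    · filter_upwards [ae_restrict_mem measurableSet_Iio] with τ hτ
      exact hG _ (hmem τ hτ)
  have h1 := key (fun τ => τ - h * Complex.I) (by fun_prop) (fun τ => by simp)
    (fun τ hτ => sub_mem_leftContour hh (Set.mem_Iio.mp hτ).le)
  have h2 := key (fun τ => τ + h * Complex.I) (by fun_prop) (fun τ => by simp)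
    (fun τ hτ => add_mem_leftContour hh (Set.mem_Iio.mp hτ).le)
  have h3 : HasSum (fun j => ∫ v in (-h)..h, g j (-δ + v * Complex.I))
      (∫ v in (-h)..h, G (-δ + v * Complex.I)) := by
    refine intervalIntegral.hasSum_integral_of_dominated_convergence
      (fun j _ => c j * Real.exp (-δ)) ?_ ?_ ?_ ?_ ?_
    · intro j
      refine ContinuousOn.aestronglyMeasurable ?_ measurableSet_uIoc
      exact (hg j).comp (by fun_prop) fun v hv =>
        vertical_mem_leftContour (abs_le_of_mem_uIoc hh hv)
    · intro j
      refine Eventually.of_forall fun v hv => ?_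
      have := hb j _ (vertical_mem_leftContour (δ := δ) (abs_le_of_mem_uIoc hh hv))
      simpa using this
    · exact Eventually.of_forall fun v _ => hc.mul_right _
    · exact intervalIntegrable_const
    · exact Eventually.of_forall fun v hv =>
        hG _ (vertical_mem_leftContour (abs_le_of_mem_uIoc hh hv))
  exact ((h1.add (h3.mul_left Complex.I)).sub h2).mul_left _

end Contour

/-- The integral of `f` over the boundary of the rectangle `[A, B] × [-h, h]`. -/
def rectIntegral (A B h : ℝ) (f : ℂ → ℂ) : ℂ :=
  (∫ τ in A..B, f (τ - h * Complex.I)) - (∫ τ in A..B, f (τ + h * Complex.I)) +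
    Complex.I * (∫ v in (-h)..h, f (B + v * Complex.I)) -
    Complex.I * ∫ v in (-h)..h, f (A + v * Complex.I)

lemma rectIntegral_eq_zero {f : ℂ → ℂ} (hf : DifferentiableOn ℂ f {ω | ω.re < 0}) {A B h : ℝ}
    (hAB : A ≤ B) (hB : B < 0) : rectIntegral A B h f = 0 := by
  have h1 := Complex.integral_boundary_rect_eq_zero_of_differentiableOn f
    (⟨A, -h⟩ : ℂ) (⟨B, h⟩ : ℂ) (hf.mono fun ω hω => by
      have h2 := hω.1
      simp only [Set.mem_preimage, Set.uIcc_of_le hAB] at h2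
      exact lt_of_le_of_lt h2.2 hB)
  simp only [smul_eq_mul] at h1
  rw [rectIntegral, ← h1]
  push_cast
  simp only [neg_mul, sub_eq_add_neg]

lemma integral_inv_add_mul_I {p h : ℝ} (hp : p ≠ 0) :
    ∫ v in (-h)..h, (1 : ℂ) / (p + v * Complex.I) = 2 * Real.arctan (h / p) := by
  have hder : ∀ v ∈ Set.uIcc (-h) h, HasDerivAt
      (fun v : ℝ => (Real.arctan (v / p) : ℂ) - Complex.I / 2 * (Real.log (p ^ 2 + v ^ 2) : ℂ))
      ((1 : ℂ) / (p + v * Complex.I)) v := by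
    intro v _
    have hpos : p ^ 2 + v ^ 2 ≠ 0 := by positivity
    have h1 : HasDerivAt (fun v : ℝ => Real.arctan (v / p)) (p / (p ^ 2 + v ^ 2)) v := by
      refine (((hasDerivAt_id v).div_const p).arctan).congr_deriv ?_
      simp only [id]
      field_simp
    have h2 : HasDerivAt (fun v : ℝ => Real.log (p ^ 2 + v ^ 2)) (2 * v / (p ^ 2 + v ^ 2)) v := by
      refine ((((hasDerivAt_id v).pow 2).const_add (p ^ 2)).log hpos).congr_deriv ?_
      simp
    refine (h1.ofReal_comp.sub (h2.ofReal_comp.const_mul (Complex.I / 2))).congr_deriv ?_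
    have h3 : (p : ℂ) + v * Complex.I ≠ 0 := by
      intro h
      have := congrArg Complex.re h
      simp at this
      exact hp this
    have h4 : (p : ℂ) ^ 2 + v ^ 2 ≠ 0 := by exact_mod_cast hpos
    push_cast
    field_simp
    linear_combination -(v : ℂ) ^ 2 * Complex.I_sq
  rw [intervalIntegral.integral_eq_sub_of_hasDerivAt hder]
  · rw [neg_div, Real.arctan_neg, neg_sq]
    push_cast
    ring
  · refine ContinuousOn.intervalIntegrable fun v hv => ?_
    refine ContinuousAt.continuousWithinAt ?_
    refine ContinuousAt.div (by fun_prop) (by fun_prop) ?_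
    intro h
    have := congrArg Complex.re h
    simp at this
    exact hp this

lemma rectIntegral_inv_sub {A B w h : ℝ} (hh : 0 < h) (hA : A < w) (hB : w < B) :
    rectIntegral A B h (fun ω => 1 / (ω - w)) = 2 * Real.pi * Complex.I := by
  have hne : ∀ τ : ℝ, ((τ : ℂ) - h * Complex.I - w ≠ 0) ∧ ((τ : ℂ) + h * Complex.I - w ≠ 0) := by
    intro τ
    constructor <;>
    · intro h0
      have := congrArg Complex.im h0
      simp at this
      exact hh.ne' this
  have h1 : (∫ τ in A..B, (1 : ℂ) / ((τ : ℂ) - h * Complex.I - w)) -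
      ∫ τ in A..B, (1 : ℂ) / ((τ : ℂ) + h * Complex.I - w) =
      2 * Complex.I * (Real.arctan ((B - w) / h) - Real.arctan ((A - w) / h)) := by
    have hi1 : IntervalIntegrable (fun τ : ℝ => (1 : ℂ) / ((τ : ℂ) - h * Complex.I - w))
        volume A B :=
      (continuous_const.div (by fun_prop) fun v => (hne v).1).intervalIntegrable _ _
    have hi2 : IntervalIntegrable (fun τ : ℝ => (1 : ℂ) / ((τ : ℂ) + h * Complex.I - w))
        volume A B :=
      (continuous_const.div (by fun_prop) fun v => (hne v).2).intervalIntegrable _ _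
    rw [← intervalIntegral.integral_sub]
    · have hder : ∀ τ ∈ Set.uIcc A B, HasDerivAt
          (fun τ : ℝ => 2 * Complex.I * (Real.arctan ((τ - w) / h) : ℂ))
          ((1 : ℂ) / ((τ : ℂ) - h * Complex.I - w) - (1 : ℂ) / ((τ : ℂ) + h * Complex.I - w)) τ := by
        intro τ _
        have hpos : h ^ 2 + (τ - w) ^ 2 ≠ 0 := by positivity
        have h1 : HasDerivAt (fun τ : ℝ => Real.arctan ((τ - w) / h))
            (h / (h ^ 2 + (τ - w) ^ 2)) τ := by
          refine ((((hasDerivAt_id τ).sub_const w).div_const h).arctan).congr_deriv ?_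
          simp only [id]
          field_simp
        refine (h1.ofReal_comp.const_mul (2 * Complex.I)).congr_deriv ?_
        have h4 : (h : ℂ) ^ 2 + (τ - w) ^ 2 =
            ((τ : ℂ) - h * Complex.I - w) * ((τ : ℂ) + h * Complex.I - w) := by
          linear_combination (h : ℂ) ^ 2 * Complex.I_sq
        push_cast
        rw [h4, div_sub_div _ _ (hne τ).1 (hne τ).2, mul_div_assoc']
        congr 1
        ring
      rw [intervalIntegral.integral_eq_sub_of_hasDerivAt hder]
      · ring
      · exact hi1.sub hi2
    · exact hi1
    · exact hi2
  have h2 : ∀ p : ℝ, p ≠ w → ∫ v in (-h)..h, (1 : ℂ) / ((p : ℂ) + v * Complex.I - w) =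
      2 * Real.arctan (h / (p - w)) := by
    intro p hp
    rw [← integral_inv_add_mul_I (sub_ne_zero.mpr hp)]
    refine intervalIntegral.integral_congr fun v _ => ?_
    congr 1
    push_cast
    ring
  rw [rectIntegral, h1, h2 B hB.ne', h2 A hA.ne]
  have h3 := Real.arctan_inv_of_pos (x := (B - w) / h) (div_pos (by linarith) hh)
  have h4 := Real.arctan_inv_of_neg (x := (A - w) / h) (div_neg_of_neg_of_pos (by linarith) hh)
  rw [inv_div] at h3 h4
  rw [h3, h4]
  push_cast
  ring

/-- Cauchy's formula for a rectangle that is symmetric about the real axis. -/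
lemma rectIntegral_div_sub {f : ℂ → ℂ} (hf : DifferentiableOn ℂ f {ω | ω.re < 0}) {A B w h : ℝ}
    (hh : 0 < h) (hA : A < w) (hwB : w < B) (hB : B < 0) :
    rectIntegral A B h (fun ω => f ω / (ω - w)) = 2 * Real.pi * Complex.I * f w := by
  have hopen : IsOpen {ω : ℂ | ω.re < 0} := isOpen_lt Complex.continuous_re continuous_const
  have hw : (w : ℂ) ∈ {ω : ℂ | ω.re < 0} := by
    change (w : ℂ).re < 0
    rw [Complex.ofReal_re]; linarith
  -- `f ω / (ω - w)` is the divided difference, which is holomorphic, plus `f w / (ω - w)`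
  have hd : DifferentiableOn ℂ (dslope f w) {ω | ω.re < 0} :=
    (Complex.differentiableOn_dslope (hopen.mem_nhds hw)).mpr hf
  have h0 := rectIntegral_eq_zero hd (h := h) (hA.trans hwB).le hB
  have h1 := rectIntegral_inv_sub hh hA hwB
  have hdc := hd.continuousOn
  -- along each side of the rectangle
  have key : ∀ (γ : ℝ → ℂ) (l u : ℝ), Continuous γ → (∀ v ∈ Set.uIcc l u, (γ v).re < 0) →
      (∀ v ∈ Set.uIcc l u, γ v ≠ w) → ∫ v in l..u, f (γ v) / (γ v - w) =
      (∫ v in l..u, dslope f w (γ v)) + f w * ∫ v in l..u, 1 / (γ v - w) := by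
    intro γ l u hγ hre hne
    rw [← intervalIntegral.integral_const_mul, ← intervalIntegral.integral_add]
    · refine intervalIntegral.integral_congr fun v hv => ?_
      have h2 : γ v - w ≠ 0 := sub_ne_zero.mpr (hne v hv)
      rw [dslope_of_ne _ (hne v hv), slope_def_field]
      field_simp
      ring
    · exact (hdc.comp hγ.continuousOn hre).intervalIntegrable
    · refine ContinuousOn.intervalIntegrable (ContinuousOn.mul continuousOn_const ?_)
      exact continuousOn_const.div (by fun_prop) fun v hv => sub_ne_zero.mpr (hne v hv)
  have hAB : A ≤ B := (hA.trans hwB).le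
  rw [rectIntegral, key (fun τ => τ - h * Complex.I) A B (by fun_prop),
    key (fun τ => τ + h * Complex.I) A B (by fun_prop),
    key (fun v => B + v * Complex.I) (-h) h (by fun_prop),
    key (fun v => A + v * Complex.I) (-h) h (by fun_prop)]
  · rw [rectIntegral] at h0 h1
    linear_combination h0 + f w * h1
  · intro v _; simp; linarith
  · intro v _ h2
    have := congrArg Complex.re h2
    simp at this
    linarith
  · intro v _; simp; linarith
  · intro v _ h2
    have := congrArg Complex.re h2
    simp at this
    linarith
  · intro v hv
    rw [Set.uIcc_of_le hAB] at hv
    simp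
    linarith [hv.2]
  · intro v _ h2
    have := congrArg Complex.im h2
    simp at this
    exact hh.ne' this
  · intro v hv
    rw [Set.uIcc_of_le hAB] at hv
    simp
    linarith [hv.2]
  · intro v _ h2
    have := congrArg Complex.im h2
    simp at this
    exact hh.ne' this

/-- A Hankel integral is the limit of integrals over growing rectangles. -/
lemma hankelLeft_eq_of_rectIntegral {δ h C : ℝ} (hh : 0 < h) {f : ℂ → ℂ} {c : ℂ}
    (hcont : ContinuousOn f (leftContour δ h))
    (hbd : ∀ ω ∈ leftContour δ h, ‖f ω‖ ≤ C * Real.exp ω.re)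
    (hvert : Tendsto (fun A : ℝ => ∫ v in (-h)..h, f (A + v * Complex.I)) atBot (𝓝 0))
    (hrect : ∀ᶠ A in atBot, rectIntegral A (-δ) h f = 2 * Real.pi * Complex.I * c) :
    hankelLeft δ h f = c := by
  have key : ∀ γ : ℝ → ℂ, Continuous γ → (∀ τ, (γ τ).re = τ) →
      (∀ τ ∈ Set.Iic (-δ), γ τ ∈ leftContour δ h) →
      Tendsto (fun A => ∫ τ in A..(-δ), f (γ τ)) atBot (𝓝 (∫ τ in Set.Iio (-δ), f (γ τ))) := by
    intro γ hγ hre hmem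
    rw [← integral_Iic_eq_integral_Iio]
    refine intervalIntegral_tendsto_integral_Iic _ ?_ tendsto_id
    refine Integrable.mono' ((integrableOn_exp_Iic (-δ)).const_mul C) ?_ ?_
    · exact (hcont.comp hγ.continuousOn hmem).aestronglyMeasurable measurableSet_Iic
    · filter_upwards [ae_restrict_mem measurableSet_Iic] with τ hτ
      have := hbd _ (hmem τ hτ)
      rwa [hre] at this
  have h1 := key (fun τ => τ - h * Complex.I) (by fun_prop) (fun τ => by simp)
    (fun τ hτ => sub_mem_leftContour hh hτ)
  have h2 := key (fun τ => τ + h * Complex.I) (by fun_prop) (fun τ => by simp)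
    (fun τ hτ => add_mem_leftContour hh hτ)
  have h3 := ((h1.sub h2).add_const (Complex.I * ∫ v in (-h)..h,
    f (((-δ : ℝ) : ℂ) + v * Complex.I))).sub (hvert.const_mul Complex.I)
  have h4 := tendsto_nhds_unique h3 ((tendsto_const_nhds (x := 2 * Real.pi * Complex.I * c)).congr'
    (by filter_upwards [hrect] with A hA; rw [← hA, rectIntegral]))
  have h5 : (2 * Real.pi * Complex.I : ℂ) ≠ 0 := Complex.two_pi_I_ne_zero
  rw [hankelLeft, inv_mul_eq_iff_eq_mul₀ h5, ← h4]
  push_cast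
  ring

/-- The half-strip to the left of the contour of `hankelLeft δ h`. -/
def leftStrip (δ h : ℝ) : Set ℂ := {ω | ω.re ≤ -δ ∧ |ω.im| ≤ h}

lemma leftContour_subset {δ h : ℝ} (hδ : 0 < δ) : leftContour δ h ⊆ {ω | ω.re < 0} :=
  fun ω hω => lt_of_le_of_lt hω.1 (by linarith)

lemma tendsto_vertical {δ h C : ℝ} (hh : 0 < h) {f : ℂ → ℂ}
    (hbd : ∀ ω ∈ leftStrip δ h, ‖f ω‖ ≤ C * Real.exp ω.re) :
    Tendsto (fun A : ℝ => ∫ v in (-h)..h, f (A + v * Complex.I)) atBot (𝓝 0) := by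
  have h1 : Tendsto (fun A => C * Real.exp A * |h - -h|) atBot (𝓝 0) := by
    have := (Real.tendsto_exp_atBot.const_mul C).mul_const |h - -h|
    simpa using this
  refine squeeze_zero_norm' ?_ h1
  filter_upwards [eventually_le_atBot (-δ)] with A hA
  refine intervalIntegral.norm_integral_le_of_norm_le_const fun v hv => ?_
  have := hbd (A + v * Complex.I) ⟨by simpa using hA, by simpa using abs_le_of_mem_uIoc hh hv⟩
  simpa using this

lemma hankelLeft_eq_zero {δ h C : ℝ} (hδ : 0 < δ) (hh : 0 < h) {f : ℂ → ℂ}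
    (hf : DifferentiableOn ℂ f {ω | ω.re < 0})
    (hbd : ∀ ω ∈ leftStrip δ h, ‖f ω‖ ≤ C * Real.exp ω.re) : hankelLeft δ h f = 0 := by
  refine hankelLeft_eq_of_rectIntegral hh (hf.continuousOn.mono (leftContour_subset hδ))
    (fun ω hω => hbd ω ⟨hω.1, hω.2.1⟩) (tendsto_vertical hh hbd) ?_
  filter_upwards [eventually_le_atBot (-δ)] with A hA
  rw [rectIntegral_eq_zero hf hA (by linarith), mul_zero]

/-- Cauchy's formula for the Hankel contour. -/
lemma hankelLeft_div_sub {δ h C w : ℝ} (hδ : 0 < δ) (hh : 0 < h) {f : ℂ → ℂ}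
    (hf : DifferentiableOn ℂ f {ω | ω.re < 0})
    (hbd : ∀ ω ∈ leftStrip δ h, ‖f ω‖ ≤ C * Real.exp ω.re) (hw : w < -δ) :
    hankelLeft δ h (fun ω => f ω / (ω - w)) = f w := by
  set κ := min h (-δ - w) with hκ
  have hκ0 : 0 < κ := lt_min hh (by linarith)
  have hle : ∀ ω ∈ leftContour δ h, κ ≤ ‖ω - w‖ := fun ω hω =>
    le_norm_sub_of_mem_leftContour (min_le_left _ _) (min_le_right _ _) hω
  have hC : ∀ ω ∈ leftStrip δ h, 0 ≤ C * Real.exp ω.re := fun ω hω =>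
    (norm_nonneg _).trans (hbd ω hω)
  refine hankelLeft_eq_of_rectIntegral (C := C / κ) (f := fun ω => f ω / (ω - w)) hh ?_ ?_ ?_ ?_
  · refine (hf.continuousOn.mono (leftContour_subset hδ)).div (by fun_prop) fun ω hω h0 => ?_
    have := hle ω hω
    rw [h0, norm_zero] at this
    linarith
  · intro ω hω
    have hs : ω ∈ leftStrip δ h := ⟨hω.1, hω.2.1⟩
    rw [norm_div, div_mul_eq_mul_div]
    exact div_le_div₀ (hC ω hs) (hbd ω hs) hκ0 (hle ω hω)
  · refine tendsto_vertical (δ := 1 - w) (C := C) (f := fun ω => f ω / (ω - w)) hh fun ω hω => ?_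
    have hs : ω ∈ leftStrip δ h := ⟨by have := hω.1; linarith, hω.2⟩
    have h1 : 1 ≤ ‖ω - w‖ := by
      have h2 := Complex.abs_re_le_norm (ω - w)
      have h3 := neg_abs_le (ω - w).re
      have h4 := hω.1
      rw [Complex.sub_re, Complex.ofReal_re] at h2 h3
      linarith
    rw [norm_div]
    exact (div_le_self (norm_nonneg _) h1).trans (hbd ω hs)
  · filter_upwards [eventually_lt_atBot w] with A hA
    exact rectIntegral_div_sub hf hh hA hw (by linarith)

/-! ### Residue expansion of the Hankel integrals of Gamma functions -/

section GammaIntegral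

variable {η θ a b δ h y : ℝ}

lemma exists_norm_Gamma_inv_mul_cpow_le (hη : 0 < η) (ha : 0 < a) (hδ : 0 < δ) (hy : 0 < y) :
    ∃ C, 0 ≤ C ∧ ∀ ω ∈ leftStrip δ h,
      ‖(Complex.Gamma ((a - ω) / η))⁻¹ * (y : ℂ) ^ (-ω)‖ ≤ C * Real.exp ω.re := by
  -- this rate compensates the growth of `y ^ (-ω)` and leaves a factor `exp ω.re`
  obtain ⟨C, hC0, hC⟩ := exists_norm_Gamma_inv_le (η * (1 + Real.log y)) (h / η)
  refine ⟨C * Real.exp (-(1 + Real.log y) * a), by positivity, fun ω hω => ?_⟩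
  have hre : ((a - ω) / η : ℂ).re = (a - ω.re) / η := by
    rw [Complex.div_ofReal_re]; simp
  have him : ((a - ω) / η : ℂ).im = -ω.im / η := by
    rw [Complex.div_ofReal_im]; simp
  have h1 := hC ((a - ω) / η)
    (by rw [hre]; exact div_nonneg (by linarith [hω.1]) hη.le)
    (by
      rw [him, abs_div, abs_neg, abs_of_pos hη]
      exact div_le_div_of_nonneg_right hω.2 hη.le)
  rw [norm_mul, Complex.norm_cpow_eq_rpow_re_of_pos hy, Complex.neg_re,
    Real.rpow_def_of_pos hy]
  calc _ ≤ C * Real.exp (-(η * (1 + Real.log y)) * ((a - ω) / η : ℂ).re) *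
        Real.exp (Real.log y * -ω.re) := by gcongr
    _ = _ := by
      rw [hre, mul_assoc, mul_assoc, ← Real.exp_add, ← Real.exp_add]
      congr 2
      field_simp
      ring

lemma differentiableOn_Gamma_inv_mul_cpow (hy : 0 < y) {q : ℂ → ℂ}
    (hq : DifferentiableOn ℂ q {ω | ω.re < 0}) :
    DifferentiableOn ℂ (fun ω => (Complex.Gamma ((a - ω) / η))⁻¹ * (y : ℂ) ^ (-ω) * q ω)
      {ω | ω.re < 0} := by
  have h1 : Differentiable ℂ fun ω : ℂ => (Complex.Gamma ((a - ω) / η))⁻¹ :=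
    Complex.differentiable_one_div_Gamma.comp
      (((differentiable_const (a : ℂ)).sub differentiable_id).div_const _)
  have h2 : Differentiable ℂ fun ω : ℂ => (y : ℂ) ^ (-ω) :=
    differentiable_id.neg.const_cpow (Or.inl (by exact_mod_cast hy.ne'))
  exact (h1.mul h2).differentiableOn.mul hq

/-- The Hankel integral of a Gamma factor against a rapidly decreasing function is the sum of the
residues at the poles `-(b + θ j)`. -/
theorem hasSum_hankelLeft_Gamma (hη : 0 < η) (hθ : 0 < θ) (ha : 0 < a) (hδ : 0 < δ) (hδb : δ < b)
    (hh : 0 < h) (hy : 0 < y) {q : ℂ → ℂ} {D : ℝ} (hq : DifferentiableOn ℂ q {ω | ω.re < 0})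
    (hD : ∀ ω : ℂ, ω.re ≤ -δ → ‖q ω‖ ≤ D) :
    HasSum (fun j : ℕ => θ * (-1) ^ j / (j.factorial : ℂ) *
        ((Complex.Gamma ((a + (b + θ * j)) / η))⁻¹ * (y : ℂ) ^ ((b : ℂ) + θ * j) *
          q (-((b : ℂ) + θ * j))))
      (hankelLeft δ h fun ω => Complex.Gamma ((b + ω) / θ) *
        ((Complex.Gamma ((a - ω) / η))⁻¹ * (y : ℂ) ^ (-ω) * q ω)) := by
  set f : ℂ → ℂ := fun ω => (Complex.Gamma ((a - ω) / η))⁻¹ * (y : ℂ) ^ (-ω) * q ω with hf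
  have hfd : DifferentiableOn ℂ f {ω | ω.re < 0} := differentiableOn_Gamma_inv_mul_cpow hy hq
  obtain ⟨C, hC0, hC⟩ : ∃ C, 0 ≤ C ∧ ∀ ω ∈ leftStrip δ h, ‖f ω‖ ≤ C * Real.exp ω.re := by
    obtain ⟨C, hC0, hC⟩ := exists_norm_Gamma_inv_mul_cpow_le (h := h) hη ha hδ hy
    have hD0 : 0 ≤ D := (norm_nonneg _).trans (hD (-δ) (by simp))
    refine ⟨C * D, by positivity, fun ω hω => ?_⟩
    rw [hf]
    dsimp only
    rw [norm_mul, mul_right_comm]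
    exact mul_le_mul (hC ω hω) (hD ω hω.1) (norm_nonneg _) (by positivity)
  have hfc : ContinuousOn f (leftContour δ h) := hfd.continuousOn.mono (leftContour_subset hδ)
  have hsub : ∀ ω ∈ leftContour δ h, ω ∈ leftStrip δ h := fun ω hω => ⟨hω.1, hω.2.1⟩
  -- the entire part of the Gamma function contributes nothing
  set E : ℂ → ℂ := fun ω => upperGamma ((b + ω) / θ) * f ω with hE
  have hEd : DifferentiableOn ℂ E {ω | ω.re < 0} := by
    have h1 : Differentiable ℂ fun ω : ℂ => upperGamma ((b + ω) / θ) :=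
      differentiable_upperGamma.comp (((differentiable_const (b : ℂ)).add differentiable_id).div_const _)
    exact h1.differentiableOn.mul hfd
  set D' := ∫ t : ℝ in Set.Ioi 1, Real.exp (-t) * t ^ ((b - δ) / θ - 1) with hD'
  have hEb : ∀ ω ∈ leftStrip δ h, ‖E ω‖ ≤ D' * C * Real.exp ω.re := by
    intro ω hω
    have h1 : ‖upperGamma ((b + ω) / θ)‖ ≤ D' := by
      refine norm_upperGamma_le ?_
      rw [Complex.div_ofReal_re]
      refine div_le_div_of_nonneg_right ?_ hθ.le
      have := hω.1
      simp
      linarith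
    rw [hE]
    dsimp only
    rw [norm_mul, mul_assoc]
    exact mul_le_mul h1 (hC ω hω) (norm_nonneg _) ((norm_nonneg _).trans h1)
  have hE0 : hankelLeft δ h E = 0 := hankelLeft_eq_zero hδ hh hEd hEb
  -- the polar part, one pole at a time
  set w : ℕ → ℝ := fun j => -(b + θ * j) with hw
  have hwδ : ∀ j, w j < -δ := by
    intro j
    have : 0 ≤ θ * j := by positivity
    simp only [hw]
    linarith
  set κ := min h (b - δ) with hκ
  have hκ0 : 0 < κ := lt_min hh (by linarith)
  have hle : ∀ j, ∀ ω ∈ leftContour δ h, κ ≤ ‖ω - w j‖ := fun j ω hω =>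
    le_norm_sub_of_mem_leftContour (min_le_left _ _) (by
      have : 0 ≤ θ * j := by positivity
      refine (min_le_right _ _).trans ?_
      simp only [hw]
      linarith) hω
  have hne : ∀ j, ∀ ω ∈ leftContour δ h, ω - w j ≠ 0 := by
    intro j ω hω h0
    have := hle j ω hω
    rw [h0, norm_zero] at this
    linarith
  let p : ℕ → ℂ → ℂ := fun j ω => θ * (-1) ^ j / (j.factorial : ℂ) * f ω / (ω - w j)
  have hcoef : ∀ j : ℕ, ‖(θ : ℂ) * (-1) ^ j / (j.factorial : ℂ)‖ = θ * (1 ^ j / j.factorial) := by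
    intro j
    rw [norm_div, norm_mul, norm_pow, norm_neg, norm_one, Complex.norm_real,
      Real.norm_of_nonneg hθ.le, Complex.norm_natCast, mul_div_assoc]
  have hp : ∀ j, hankelLeft δ h (p j) = θ * (-1) ^ j / (j.factorial : ℂ) *
      ((Complex.Gamma ((a + (b + θ * j)) / η))⁻¹ * (y : ℂ) ^ ((b : ℂ) + θ * j) *
        q (-((b : ℂ) + θ * j))) := by
    intro j
    have h1 := hankelLeft_div_sub (C := θ * (1 ^ j / j.factorial) * C) hδ hh
      (hfd.const_mul (θ * (-1) ^ j / (j.factorial : ℂ))) (fun ω hω => by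
        rw [norm_mul, hcoef, mul_assoc _ C]
        exact mul_le_mul_of_nonneg_left (hC ω hω) (by positivity)) (hwδ j)
    refine h1.trans ?_
    simp only [hf, hw]
    push_cast
    rw [sub_neg_eq_add, neg_neg]
  have hsum := hasSum_hankelLeft (δ := δ) hh
    (g := fun n => Nat.casesOn n E p)
    (G := fun ω => Complex.Gamma ((b + ω) / θ) * f ω)
    (c := fun n => Nat.casesOn n (D' * C) fun j => θ * (1 ^ j / j.factorial) * (C / κ)) ?_ ?_ ?_ ?_
  · rw [← hasSum_nat_add_iff' 1, Finset.sum_range_one] at hsum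
    change HasSum _ (_ - hankelLeft δ h E) at hsum
    rw [hE0, sub_zero] at hsum
    exact hsum.congr_fun fun j => (hp j).symm
  · rintro (_ | j)
    · exact hEd.continuousOn.mono (leftContour_subset hδ)
    · exact (continuousOn_const.mul hfc).div (by fun_prop) (hne j)
  · rintro (_ | j) ω hω
    · exact hEb ω (hsub ω hω)
    · change ‖θ * (-1) ^ j / (j.factorial : ℂ) * f ω / (ω - w j)‖ ≤
        θ * (1 ^ j / j.factorial) * (C / κ) * Real.exp ω.re
      rw [norm_div, norm_mul, hcoef, mul_div_assoc, mul_assoc _ (C / κ)]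
      refine mul_le_mul_of_nonneg_left ?_ (by positivity)
      rw [div_mul_eq_mul_div]
      exact div_le_div₀ (by positivity) (hC ω (hsub ω hω)) hκ0 (hle j ω hω)
  · rw [← summable_nat_add_iff 1]
    exact ((Real.summable_pow_div_factorial 1).mul_left θ).mul_right (C / κ)
  · intro ω hω
    have hθ' : (θ : ℂ) ≠ 0 := by exact_mod_cast hθ.ne'
    have hpole : ∀ m : ℕ, (b + ω) / θ ≠ -(m : ℂ) := by
      intro m hm
      refine hne m ω hω ?_
      rw [div_eq_iff hθ'] at hm
      simp only [hw]
      push_cast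
      linear_combination hm
    have h1 := (hasSum_Gamma_sub_upperGamma hpole).mul_right (f ω)
    rw [← hasSum_nat_add_iff' 1, Finset.sum_range_one]
    change HasSum _ (_ - E ω)
    have h2 : Complex.Gamma ((b + ω) / θ) * f ω - E ω =
        (Complex.Gamma ((b + ω) / θ) - upperGamma ((b + ω) / θ)) * f ω := by
      rw [hE]; ring
    rw [h2]
    refine h1.congr_fun fun j => ?_
    have h3 : ω - w j = θ * ((b + ω) / θ + j) := by
      simp only [hw]
      push_cast
      field_simp
      ring
    have h4 := hne j ω hω
    change θ * (-1) ^ j / (j.factorial : ℂ) * f ω / (ω - w j) = _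
    rw [h3] at h4 ⊢
    have h5 := right_ne_zero_of_mul h4
    have h6 : (j.factorial : ℂ) ≠ 0 := by exact_mod_cast j.factorial_ne_zero
    field_simp

end GammaIntegral

/-! ### The contour integral for the hard-edge kernel -/

lemma heF_div_heF {α η θ : ℝ} (hη : 0 < η) (hθ : 0 < θ) (t : ℤ) (ζ ω : ℂ) :
    heF α η θ t ζ / heF α η θ t ω =
      Complex.Gamma ((((α + η) / 2 + η * (-t).toNat : ℝ) - ζ) / η) /
        Complex.Gamma ((((α + θ) / 2 + θ * t.toNat : ℝ) + ζ) / θ) *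
      (Complex.Gamma ((((α + θ) / 2 + θ * t.toNat : ℝ) + ω) / θ) *
        (Complex.Gamma ((((α + η) / 2 + η * (-t).toNat : ℝ) - ω) / η))⁻¹) := by
  have hη' : (η : ℂ) ≠ 0 := by exact_mod_cast hη.ne'
  have hθ' : (θ : ℂ) ≠ 0 := by exact_mod_cast hθ.ne'
  have h1 : ∀ z : ℂ, (α : ℂ) / (2 * η) - z / η + (-t).toNat + 1 / 2 =
      (((α + η) / 2 + η * (-t).toNat : ℝ) - z) / η := by
    intro z; push_cast; field_simp; ring
  have h2 : ∀ z : ℂ, (α : ℂ) / (2 * θ) + z / θ + t.toNat + 1 / 2 =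
      (((α + θ) / 2 + θ * t.toNat : ℝ) + z) / θ := by
    intro z; push_cast; field_simp; ring
  have h3 : (η : ℂ) ^ (-t).toNat / (θ : ℂ) ^ t.toNat ≠ 0 :=
    div_ne_zero (pow_ne_zero _ hη') (pow_ne_zero _ hθ')
  rw [heF, heF, mul_div_mul_left _ _ h3, h1, h1, h2, h2, div_div_div_eq]
  simp only [div_eq_mul_inv, mul_inv]
  ring

section Residues

variable {η θ a b : ℝ}

/-- The residue of `Γ((b + ω) / θ) / Γ((a - ω) / η) * y ^ (-ω)` at the pole `-(b + θ k)`. -/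
def residueCoeff (η θ a b y : ℝ) (k : ℕ) : ℂ :=
  θ * (-1) ^ k / (k.factorial : ℂ) *
    ((Complex.Gamma ((a + (b + θ * k)) / η))⁻¹ * (y : ℂ) ^ ((b : ℂ) + θ * k))

lemma summable_norm_residueCoeff (hη : 0 < η) (hθ : 0 < θ) (ha : 0 < a) (hb : 0 < b) {y : ℝ}
    (hy : 0 < y) : Summable fun k => ‖residueCoeff η θ a b y k‖ := by
  have h := hasSum_hankelLeft_Gamma (b := b) (δ := b / 2) (h := 1) (q := fun _ => 1) (D := 1) hη hθ ha
    (by linarith) (by linarith) one_pos hy (differentiableOn_const _) (fun _ _ => by simp)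
  simp only [mul_one] at h
  exact h.summable.norm

/-- The sum of the residues of the inner integral, as a function of `-ζ`. -/
def residueSum (η θ a b y : ℝ) (ω : ℂ) : ℂ :=
  ∑' k : ℕ, residueCoeff η θ a b y k / ((b + θ * k : ℝ) - ω)

lemma norm_residueCoeff_div_le (hθ : 0 < θ) (hb : 0 < b) (y : ℝ) (k : ℕ) {ω : ℂ}
    (hω : ω.re ≤ 0) :
    ‖residueCoeff η θ a b y k / ((b + θ * k : ℝ) - ω)‖ ≤ ‖residueCoeff η θ a b y k‖ / b := by
  rw [norm_div]
  refine div_le_div_of_nonneg_left (norm_nonneg _) hb ?_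
  have h1 := Complex.re_le_norm (((b + θ * k : ℝ) : ℂ) - ω)
  rw [Complex.sub_re, Complex.ofReal_re] at h1
  have : 0 ≤ θ * k := by positivity
  linarith

lemma differentiableOn_residueSum (hη : 0 < η) (hθ : 0 < θ) (ha : 0 < a) (hb : 0 < b) {y : ℝ}
    (hy : 0 < y) : DifferentiableOn ℂ (residueSum η θ a b y) {ω | ω.re < 0} := by
  refine Complex.differentiableOn_tsum_of_summable_norm
    ((summable_norm_residueCoeff hη hθ ha hb hy).div_const b) ?_
    (isOpen_lt Complex.continuous_re continuous_const)
    (fun k ω hω => norm_residueCoeff_div_le hθ hb y k (le_of_lt hω))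
  intro k
  refine DifferentiableOn.div (differentiableOn_const _) (by fun_prop) fun ω hω h0 => ?_
  have h1 := congrArg Complex.re h0
  rw [Complex.sub_re, Complex.ofReal_re, Complex.zero_re] at h1
  have h2 : ω.re < 0 := hω
  have : 0 ≤ θ * k := by positivity
  linarith

lemma norm_residueSum_le (hη : 0 < η) (hθ : 0 < θ) (ha : 0 < a) (hb : 0 < b) {y : ℝ}
    (hy : 0 < y) {ω : ℂ} (hω : ω.re ≤ 0) :
    ‖residueSum η θ a b y ω‖ ≤ ∑' k, ‖residueCoeff η θ a b y k‖ / b :=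
  tsum_of_norm_bounded ((summable_norm_residueCoeff hη hθ ha hb hy).div_const b).hasSum
    fun k => norm_residueCoeff_div_le hθ hb y k hω

/-- The inner contour integral. -/
lemma hankelLeft_Gamma_div_sub (hη : 0 < η) (hθ : 0 < θ) (ha : 0 < a) {δ h y : ℝ} (hδ : 0 < δ)
    (hδb : δ < b) (hh : 0 < h) (hy : 0 < y) (c : ℂ) {ζ : ℂ} (hζ : 0 ≤ ζ.re) :
    hankelLeft δ h (fun ω => Complex.Gamma ((b + ω) / θ) *
      ((Complex.Gamma ((a - ω) / η))⁻¹ * (y : ℂ) ^ (-ω) * (c / (ζ - ω)))) =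
    c * residueSum η θ a b y (-ζ) := by
  have h1 := hasSum_hankelLeft_Gamma (q := fun ω => c / (ζ - ω)) (D := ‖c‖ / δ) hη hθ ha hδ hδb
    hh hy ?_ ?_
  · rw [← h1.tsum_eq, residueSum, ← tsum_mul_left]
    refine tsum_congr fun k => ?_
    rw [residueCoeff]
    push_cast
    rw [sub_neg_eq_add, sub_neg_eq_add, add_comm ζ]
    ring
  · refine DifferentiableOn.div (differentiableOn_const _) (by fun_prop) fun ω hω h0 => ?_
    have h1 := congrArg Complex.re h0
    rw [Complex.sub_re, Complex.zero_re] at h1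
    have h2 : ω.re < 0 := hω
    linarith
  · intro ω hω
    rw [norm_div]
    refine div_le_div_of_nonneg_left (norm_nonneg _) hδ ?_
    have h1 := Complex.re_le_norm (ζ - ω)
    rw [Complex.sub_re] at h1
    linarith

lemma ofReal_hardEdgeTerm {x y : ℝ} (hx : 0 < x) (hy : 0 < y) (p : ℕ × ℕ) :
    (hardEdgeTerm η θ a b x y p : ℂ) = ((Real.sqrt (x * y))⁻¹ : ℝ) *
      (residueCoeff θ η b a x p.1 *
        (residueCoeff η θ a b y p.2 / ((b + θ * p.2 : ℝ) + (a + η * p.1 : ℝ)))) := by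
  obtain ⟨i, k⟩ := p
  have h1 : (x : ℂ) ^ ((a : ℂ) + η * i) = ((x ^ (a + η * i) : ℝ) : ℂ) := by
    rw [Complex.ofReal_cpow hx.le]; push_cast; rfl
  have h2 : (y : ℂ) ^ ((b : ℂ) + θ * k) = ((y ^ (b + θ * k) : ℝ) : ℂ) := by
    rw [Complex.ofReal_cpow hy.le]; push_cast; rfl
  have h3 : Complex.Gamma (((b : ℂ) + (a + η * i)) / θ) =
      (Real.Gamma ((a + η * i + b) / θ) : ℝ) := by
    rw [← Complex.Gamma_ofReal]; push_cast; rw [add_comm (b : ℂ)]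
  have h4 : Complex.Gamma (((a : ℂ) + (b + θ * k)) / η) =
      (Real.Gamma ((a + (b + θ * k)) / η) : ℝ) := by
    rw [← Complex.Gamma_ofReal]; push_cast; rfl
  dsimp only
  rw [residueCoeff, residueCoeff, h1, h2, h3, h4, hardEdgeTerm]
  dsimp only
  rw [Real.rpow_sub hx, Real.rpow_sub hy, ← Real.sqrt_eq_rpow, ← Real.sqrt_eq_rpow,
    Real.sqrt_mul hx.le, pow_add, add_comm (a + η * i) (b + θ * k)]
  push_cast
  simp only [div_eq_mul_inv, mul_inv]
  ring

/-- The iterated contour integral is the sum over the pairs of poles. -/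
theorem heKernel_eq_hardEdgeSeries {α δ h : ℝ} (hη : 0 < η) (hθ : 0 < θ) (hδ : 0 < δ)
    (hδη : δ < (α + η) / 2) (hδθ : δ < (α + θ) / 2) (hh : 0 < h) (t : ℤ) {x y : ℝ}
    (hx : 0 < x) (hy : 0 < y) :
    heKernel α η θ δ h t x y = (hardEdgeSeries η θ ((α + η) / 2 + η * (-t).toNat)
      ((α + θ) / 2 + θ * t.toNat) x y : ℂ) := by
  rw [heKernel]
  simp only [heF_div_heF hη hθ]
  set a := (α + η) / 2 + η * (-t).toNat with ha
  set b := (α + θ) / 2 + θ * t.toNat with hb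
  have hδa : δ < a := by
    have : 0 ≤ η * (-t).toNat := by positivity
    linarith
  have hδb : δ < b := by
    have : 0 ≤ θ * t.toNat := by positivity
    linarith
  have ha0 : 0 < a := hδ.trans hδa
  have hb0 : 0 < b := hδ.trans hδb
  have hinner : ∀ ω' ∈ leftContour δ h, hankelLeft δ h (fun ω =>
      Complex.Gamma ((a - -ω') / η) / Complex.Gamma ((b + -ω') / θ) *
        (Complex.Gamma ((b + ω) / θ) * (Complex.Gamma ((a - ω) / η))⁻¹) *
        ((x : ℂ) ^ (-ω') / (y : ℂ) ^ ω) * (1 / (-ω' - ω))) =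
      Complex.Gamma ((a + ω') / η) * ((Complex.Gamma ((b - ω') / θ))⁻¹ * (x : ℂ) ^ (-ω') *
        residueSum η θ a b y ω') := by
    intro ω' hω'
    have h1 := hankelLeft_Gamma_div_sub (h := h) hη hθ ha0 hδ hδb hh hy
      (Complex.Gamma ((a + ω') / η) * ((Complex.Gamma ((b - ω') / θ))⁻¹ * (x : ℂ) ^ (-ω')))
      (ζ := -ω') (by have := hω'.1; rw [Complex.neg_re]; linarith)
    rw [neg_neg] at h1
    refine Eq.trans ?_ (h1.trans (by ring))
    congr 1
    ext ω
    rw [sub_neg_eq_add, ← sub_eq_add_neg, Complex.cpow_neg (y : ℂ) ω]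
    ring
  rw [hankelRight_eq_hankelLeft, hankelLeft_congr hh hinner]
  have houter := hasSum_hankelLeft_Gamma (q := residueSum η θ a b y)
    (D := ∑' k, ‖residueCoeff η θ a b y k‖ / b) hθ hη hb0 hδ hδa hh hx
    (differentiableOn_residueSum hη hθ ha0 hb0 hy)
    (fun ω hω => norm_residueSum_le hη hθ ha0 hb0 hy (by linarith))
  have hA := summable_norm_residueCoeff hθ hη hb0 ha0 hx
  have hB := summable_norm_residueCoeff hη hθ ha0 hb0 hy
  have hprod : Summable fun p : ℕ × ℕ => residueCoeff θ η b a x p.1 *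
      (residueCoeff η θ a b y p.2 / ((b + θ * p.2 : ℝ) + (a + η * p.1 : ℝ))) := by
    refine Summable.of_norm_bounded (hA.mul_of_nonneg (hB.div_const b) (fun _ => norm_nonneg _)
      fun _ => by positivity) fun p => ?_
    rw [norm_mul]
    refine mul_le_mul_of_nonneg_left ?_ (norm_nonneg _)
    have h1 := norm_residueCoeff_div_le (η := η) (a := a) hθ hb0 y p.2
      (ω := -((a + η * p.1 : ℝ) : ℂ)) (by
        rw [Complex.neg_re, Complex.ofReal_re, neg_nonpos]; positivity)
    rwa [sub_neg_eq_add] at h1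
  rw [← houter.tsum_eq, hardEdgeSeries, Complex.ofReal_tsum]
  simp only [ofReal_hardEdgeTerm hx hy]
  rw [tsum_mul_left, hprod.tsum_prod]
  congr 1
  refine tsum_congr fun i => ?_
  dsimp only
  rw [tsum_mul_left, residueSum, residueCoeff]
  push_cast
  simp only [sub_neg_eq_add]
  ring

end Residues

/-! ### The hard-edge limit -/

lemma fredholmTerm_swap (μ : Measure ℝ) (K : ℝ → ℝ → ℝ) :
    fredholmTerm μ (fun x y => K y x) = fredholmTerm μ K := by
  ext m
  rw [fredholmTerm, fredholmTerm]
  congr 2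
  ext x
  rw [← Matrix.det_transpose]
  rfl

/-- Passage from a real Fredholm series to the complex one. -/
lemma hasFredholmDet_of_real {s : Set ℝ} (hs : MeasurableSet s) {K : ℝ → ℝ → ℝ} {L : ℝ → ℝ → ℂ}
    (hL : ∀ x ∈ s, ∀ y ∈ s, L x y = (K x y : ℂ))
    (hint : ∀ m, Integrable (fun x : Fin m → ℝ => (Matrix.of fun i j => K (x i) (x j)).det)
      (Measure.pi fun _ => volume.restrict s))
    (hsum : Summable (fredholmTerm (volume.restrict s) K)) :
    HasFredholmDet L s ((∑' m, fredholmTerm (volume.restrict s) K m : ℝ) : ℂ) := by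
  have hdet : ∀ n : ℕ, ∀ x ∈ (Set.univ.pi fun _ : Fin n => s),
      ((Matrix.of fun i j => K (x i) (x j)).det : ℂ) = (Matrix.of fun i j => L (x i) (x j)).det := by
    intro n x hx
    rw [← Complex.ofRealHom_eq_coe, RingHom.map_det]
    congr 1
    ext i j
    simp [hL _ (hx i trivial) _ (hx j trivial)]
  have hms : ∀ n : ℕ, MeasurableSet (Set.univ.pi fun _ : Fin n => s) :=
    fun n => MeasurableSet.univ_pi fun _ => hs
  have hvol : ∀ n : ℕ, (volume : Measure (Fin n → ℝ)).restrict (Set.univ.pi fun _ : Fin n => s) =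
      Measure.pi fun _ => volume.restrict s := fun n => by
    rw [volume_pi, Measure.restrict_pi_pi]
  refine ⟨fun n => ?_, ?_⟩
  · refine IntegrableOn.congr_fun ?_ (hdet n) (hms n)
    rw [IntegrableOn, hvol]
    exact (hint n).ofReal
  · refine (Complex.hasSum_ofReal.mpr hsum.hasSum).congr_fun fun n => ?_
    rw [← setIntegral_congr_fun (hms n) (hdet n), hvol, integral_complex_ofReal, fredholmTerm]
    push_cast
    rfl

/-- Convergence of rescaled gap probabilities given as ratios of determinants. -/
lemma tendsto_gap_of_det {η θ a b c r : ℝ} (hη : 0 < η) (hθ : 0 < θ) (ha : 0 < a) (hb : 0 < b)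
    (hc0 : 0 < c) {t : ℕ} (hc : c + θ * t = a + b) (hr : 0 < r) {P : ℕ → ℝ → ℝ}
    (hP : ∀ n, t ≤ n → (gapMatrix η θ c t (n + 1) 0).det ≠ 0 ∧ ∀ s, 0 ≤ s → s < 1 →
      P (n + 1) s = (gapMatrix η θ c t (n + 1) s).det / (gapMatrix η θ c t (n + 1) 0).det) :
    Tendsto (fun N : ℕ => P N (r * (N : ℝ) ^ (-(1 / η + 1 / θ)))) atTop
      (𝓝 (∑' m, fredholmTerm (volume.restrict (Set.Ioo 0 r)) (hardEdgeSeries η θ a b) m)) := by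
  have hγ : 0 < 1 / η + 1 / θ := by positivity
  have h1 := (tendsto_fredholm_finiteKernel hη hθ ha hb hc0 hc hr).2.2.comp
    (tendsto_add_atTop_nat 1)
  have hsmall : Tendsto (fun N : ℕ => r * (N : ℝ) ^ (-(1 / η + 1 / θ))) atTop (𝓝 (r * 0)) :=
    ((tendsto_rpow_neg_atTop hγ).comp tendsto_natCast_atTop_atTop).const_mul r
  rw [mul_zero] at hsmall
  have hev := (tendsto_add_atTop_nat (t + 1)).eventually
    (hsmall.eventually (eventually_lt_nhds one_pos))
  rw [← tendsto_add_atTop_iff_nat (t + 1)]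
  refine h1.congr' ?_
  filter_upwards [hev] with n hn
  rw [show n + (t + 1) = t + (n + 1) by omega] at hn ⊢
  have hN : (0 : ℝ) < (t + (n + 1) : ℕ) := by exact_mod_cast (by omega : 0 < t + (n + 1))
  obtain ⟨h2, h3⟩ := hP (t + n) (by omega)
  rw [add_assoc] at h2 h3
  rw [Function.comp_apply, h3 _ (by positivity) hn]
  exact (hasSum_finiteKernel hη hθ ha hb hr (Real.rpow_pos_of_pos hN _) hc h2).tsum_eq

lemma scaled_lt_iff {N : ℕ} (hN : 0 < N) (γ r p : ℝ) :
    r < (N : ℝ) ^ γ * p ↔ r * (N : ℝ) ^ (-γ) < p := by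
  have hN' : (0 : ℝ) < N := by exact_mod_cast hN
  rw [Real.rpow_neg hN'.le, ← div_eq_mul_inv, div_lt_iff₀ (Real.rpow_pos_of_pos hN' _), mul_comm p]

end

theorem theorem6 (α η θ : ℝ) (hα : 0 ≤ α) (hη : 0 < η) (hθ : 0 < θ)
    (δ h : ℝ) (hδ : 0 < δ) (hδη : δ < (α + η) / 2) (hδθ : δ < (α + θ) / 2) (hh : 0 < h)
    (t : ℤ) (r : ℝ) (hr : 0 < r) :
    ∃ d : ℝ, HasFredholmDet (heKernel α η θ δ h t) (Set.Ioo 0 r) (d : ℂ) ∧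
      Tendsto
        (fun N : ℕ => (mbProcess N N α η θ).real
          {X | r < (N : ℝ) ^ (1 / η + 1 / θ) * mbParticle X t 0})
        atTop (𝓝 d) := by
  set K := hardEdgeSeries η θ ((α + η) / 2 + η * (-t).toNat) ((α + θ) / 2 + θ * t.toNat) with hK
  have hevent : ∀ᶠ N : ℕ in atTop, (mbProcess N N α η θ).real
      {X | r * (N : ℝ) ^ (-(1 / η + 1 / θ)) < mbParticle X t 0} = (mbProcess N N α η θ).real
      {X | r < (N : ℝ) ^ (1 / η + 1 / θ) * mbParticle X t 0} := by
    filter_upwards [eventually_gt_atTop 0] with N hN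
    simp only [scaled_lt_iff hN]
  suffices hmain : (∀ m, Integrable (fun x : Fin m → ℝ =>
        (Matrix.of fun i j => K (x i) (x j)).det)
        (Measure.pi fun _ => volume.restrict (Set.Ioo 0 r))) ∧
      Summable (fredholmTerm (volume.restrict (Set.Ioo 0 r)) K) ∧
      Tendsto (fun N : ℕ => (mbProcess N N α η θ).real
        {X | r * (N : ℝ) ^ (-(1 / η + 1 / θ)) < mbParticle X t 0}) atTop
        (𝓝 (∑' m, fredholmTerm (volume.restrict (Set.Ioo 0 r)) K m)) by
    refine ⟨_, hasFredholmDet_of_real measurableSet_Ioo (fun x hx y hy => ?_) hmain.1 hmain.2.1,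
      hmain.2.2.congr' hevent⟩
    exact heKernel_eq_hardEdgeSeries hη hθ hδ hδη hδθ hh t hx.1 hy.1
  have hc0 : 0 < α + (η + θ) / 2 := by positivity
  obtain ⟨n, rfl | rfl⟩ := t.eq_nat_or_neg
  · have hc : α + (η + θ) / 2 + θ * n = (α + η) / 2 + ((α + θ) / 2 + θ * n) := by ring
    have hKn : K = hardEdgeSeries η θ ((α + η) / 2) ((α + θ) / 2 + θ * n) := by
      rw [hK]; simp
    have hlim := tendsto_fredholm_finiteKernel hη hθ (by positivity) (by positivity) hc0 hc hr
    rw [hKn]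
    exact ⟨hlim.1, hlim.2.1, tendsto_gap_of_det hη hθ (by positivity) (by positivity) hc0 hc hr
      (P := fun N s => (mbProcess N N α η θ).real {X | s < mbParticle X (n : ℤ) 0})
      fun m hm => real_mbProcess_upper hα hη hθ hm⟩
  · -- below the main diagonal the roles of `η` and `θ` are exchanged
    rw [add_comm η θ] at hc0
    have hc : α + (θ + η) / 2 + η * n = (α + θ) / 2 + ((α + η) / 2 + η * n) := by ring
    have hKn : K = fun x y => hardEdgeSeries θ η ((α + θ) / 2) ((α + η) / 2 + η * n) y x := by
      ext x y
      rw [hK, hardEdgeSeries_swap]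
      simp
    have hlim := tendsto_fredholm_finiteKernel hθ hη (by positivity) (by positivity) hc0 hc hr
    rw [hKn, fredholmTerm_swap]
    refine ⟨fun m => (hlim.1 m).congr (Eventually.of_forall fun x => ?_), hlim.2.1, ?_⟩
    · dsimp only
      rw [← Matrix.det_transpose]
      rfl
    · have h1 := tendsto_gap_of_det hθ hη (by positivity) (by positivity) hc0 hc hr
        (P := fun N s => (mbProcess N N α η θ).real {X | s < mbParticle X (-n : ℤ) 0})
        fun m hm => real_mbProcess_lower hα hη hθ hm
      rwa [add_comm (1 / θ)] at h1
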